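/- Let $\nu\in\mathbb N$, $\langle x\rangle=(1+|x|^2)^{1/2}$ and $D_x=-\mathrm i\nabla_x$. A function $g$ on $\mathbb R^\nu$ is called rotation invariant if, for every $O\in O(\nu)$, $g(Ox)=g(x)$ for a.e. $x$. Assume the following. * $\Omega:\mathbb R^\nu\to[0,\infty)$ is real-analytic and rotation invariant, and for some $s_\Omega\in[0,2]$: there is $C>0$ with $\Omega(\eta)\ge C^{-1}\langle\eta\rangle^{s_\Omega}-C$ for all $\eta$, and for every multi-index $\alpha$ there is $C_\alpha>0$ with $|\partial^\alpha\Omega(\eta)|\le C_\alpha\langle\eta\rangle^{s_\Omega-|\alpha|}$ for all $\eta$. * $\omega:\mathbb R^\nu\to[0,\infty)$ is real-analytic and rotation invariant, $\sup_k|\partial^\alpha\omega(k)|<\infty$ for every multi-index $\alpha$ with $|\alpha|\ge1$, and, if $s_\Omega=0$, then $\omega(k)\to\infty$ as $|k|\to\infty$. * $\rho\in L^2(\mathbb R^\nu)$ (complex-valued) is rotation invariant, its Fourier transform satisfies $\hat\rho\in C^2(\mathbb R^\nu)$ and $\langle\cdot\rangle|\nabla\hat\rho|,\ \langle\cdot\rangle\|\nabla^2\hat\rho\|\in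 L^2(\mathbb R^\nu)$, and there are $C,\mu>0$ with $|\rho(x)|\le C\langle x\rangle^{-1-\nu/2-\mu}$ for a.e. $x$. On $\mathcal K=\mathbb C\oplus L^2(\mathbb R^\nu)$ let, for $P\in\mathbb R^\nu$, $$H(P)=\begin{pmatrix}\Omega(P)&\langle\rho|\\ |\rho\rangle&\Omega(P-D_x)+\omega(D_x)\end{pmatrix},$$ with domain $\mathbb C\oplus\mathcal D(\Omega(P-D_x)+\omega(D_x))$, and let $$\theta(P)=\{\lambda\in\mathbb R:\ \exists k\in\mathbb R^\nu,\ \lambda=\Omega(P-k)+\omega(k),\ \nabla\Omega(P-k)=\nabla\omega(k)\}$$ be the set of thresholds. Let $v_P(k)=\nabla\omega(k)-\nabla\Omega(P-k)$, let $a_P$ be the closure of $\tfrac12\bigl(v_P(D_x)\cdot x+x\cdot v_P(D_x)\bigr)$ on the Schwartz space, and let $A_P=\begin{pmatrix}0&0\\0&a_P\end{pmatrix}$ on $\mathbb C\oplus\mathcal D(a_P)$. Write $[H(P),\mathrm iA_{P_0}]^\circ$ for the extension of the commutator form $[H(P),\mathrm iA_{P_0}]$, defined on $\mathcal D(H(P))\cap\mathcal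 D(A_{P_0})$, to an element of $\mathcal B(\mathcal D(H(P));\mathcal D(H(P))^*)$, where $\mathcal D(H(P))$ carries the graph norm. **Theorem.** Let $(P_0,\lambda_0)\in\mathbb R^{\nu+1}$, and assume that $\lambda_0\notin\theta(P_0)$ and that $\lambda_0$ is not an eigenvalue of $H(P_0)$. Then there exist a constant $C>0$, a neighbourhood $\mathcal O$ of $P_0$ and a real-valued function $f\in C_0^\infty(\mathbb R)$ with $f=1$ in a neighbourhood of $\lambda_0$ such that, for all $P\in\mathcal O$, the extension $[H(P),\mathrm iA_{P_0}]^\circ$ exists and is unique, $f(H(P))$ maps $\mathcal K$ into $\mathcal D(H(P))$, and $$f(H(P))\,[H(P),\mathrm iA_{P_0}]^\circ f(H(P))\ \ge\ C f^2(H(P))$$ in the sense of quadratic forms on $\mathcal K$. -/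

import Mathlib

open MeasureTheory Filter Topology
open scoped FourierTransform SchwartzMap InnerProductSpace ComplexConjugate

noncomputable section

namespace Nelson

/-! ### Unbounded operators on a Hilbert space -/

section Abstract

variable {K : Type*} [NormedAddCommGroup K] [InnerProductSpace ℂ K]

/-- `R` is the bounded two-sided inverse of `T - z`, that is `R = (T - z)⁻¹`. -/
def IsResolventAt (T : K →ₗ.[ℂ] K) (z : ℂ) (R : K →L[ℂ] K) : Prop :=
  (∀ u : K, ∃ h : R u ∈ T.domain, T ⟨R u, h⟩ - z • R u = u) ∧
    ∀ u : T.domain, R (T u - z • (u : K)) = u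

open Classical in
/-- The resolvent `(T - z)⁻¹` (by convention `0` when `z` is in the spectrum of `T`). -/
def resolventAt (T : K →ₗ.[ℂ] K) (z : ℂ) : K →L[ℂ] K :=
  if h : ∃ R, IsResolventAt T z R then h.choose else 0

/-- The operator `f(T)` for a self-adjoint operator `T` and a function `f` on the line that vanishes
at infinity. It is obtained from the continuous functional calculus of the bounded normal operator
`R = (T - i)⁻¹`: the substitution `z = (x - i)⁻¹`, `x = z⁻¹ + i`, identifies the real line
with the part off `0` of a circle that contains the spectrum of `R`, and the point `z = 0`
corresponds to `x = ∞`. -/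
def functionalCalculus [CompleteSpace K] (T : K →ₗ.[ℂ] K) (f : ℝ → ℝ) : K →L[ℂ] K :=
  cfc (fun z : ℂ => if z = 0 then 0 else ((f (z⁻¹ + Complex.I).re : ℝ) : ℂ))
    (resolventAt T Complex.I)

/-- The real eigenvalues of `T` (the pure point spectrum, if `T` is self-adjoint). -/
def pointSpectrum (T : K →ₗ.[ℂ] K) : Set ℝ :=
  {l | ∃ u : T.domain, (u : K) ≠ 0 ∧ T u = (l : ℂ) • (u : K)}

/-- `B` is an extension of the commutator form
`[T, iA](u, w) = ⟨T u, i A w⟩ - ⟨(i A)^* u, T w⟩`, given on `D(T) ∩ D(A)`, to an element of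
`𝓑(D(T); D(T)^*)`: a sesquilinear form on `D(T)` that is bounded for the graph norm of `T`. -/
structure IsCommutatorExtension (T A : K →ₗ.[ℂ] K)
    (B : T.domain →ₗ⋆[ℂ] T.domain →ₗ[ℂ] ℂ) : Prop where
  bounded : ∃ M : ℝ, ∀ u w : T.domain,
    ‖B u w‖ ≤ M * (‖(u : K)‖ + ‖T u‖) * (‖(w : K)‖ + ‖T w‖)
  extends_form : ∀ (u w : K) (hu : u ∈ T.domain) (hu' : u ∈ A.domain)
    (hw : w ∈ T.domain) (hw' : w ∈ A.domain),
    B ⟨u, hu⟩ ⟨w, hw⟩ =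
      ⟪T ⟨u, hu⟩, Complex.I • A ⟨w, hw'⟩⟫_ℂ - ⟪-(Complex.I • A ⟨u, hu'⟩), T ⟨w, hw⟩⟫_ℂ

end Abstract

/-! ### Hypotheses on the dispersion relations and on the coupling function -/

/-- The Euclidean space `ℝ^ν`. -/
abbrev E (ν : ℕ) : Type := EuclideanSpace ℝ (Fin ν)

/-- The space `L²(ℝ^ν)` of complex-valued functions. -/
abbrev L2 (ν : ℕ) : Type := Lp (α := E ν) ℂ 2

/-- The fiber Hilbert space `ℂ ⊕ L²(ℝ^ν)`. -/
abbrev FiberSpace (ν : ℕ) : Type := WithLp 2 (ℂ × L2 ν)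

variable {ν : ℕ}

/-- `⟨x⟩ = (1 + x²)^{1/2}`. -/
def bracket (x : E ν) : ℝ := Real.sqrt (1 + ‖x‖ ^ 2)

/-- Invariance almost everywhere under the orthogonal group. -/
def RotationInvariant {β : Type*} (f : E ν → β) : Prop :=
  ∀ O : E ν ≃ₗᵢ[ℝ] E ν, ∀ᵐ x, f (O x) = f x

/-- The hypotheses on the matter dispersion relation `Ω`, with growth exponent `s`. -/
structure IsMatterDispersion (s : ℝ) (Ω : E ν → ℝ) : Prop where
  exponent : s ∈ Set.Icc (0 : ℝ) 2
  nonneg : ∀ η, 0 ≤ Ω η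
  analytic : AnalyticOnNhd ℝ Ω Set.univ
  rotation : RotationInvariant Ω
  lower : ∃ C : ℝ, 0 < C ∧ ∀ η, C⁻¹ * bracket η ^ s - C ≤ Ω η
  symbol : ∀ n : ℕ, ∃ C : ℝ, 0 < C ∧
    ∀ η, ‖iteratedFDeriv ℝ n Ω η‖ ≤ C * bracket η ^ (s - (n : ℝ))

/-- The hypotheses on the field dispersion relation `ω`; the exponent `s` is that of `Ω`. -/
structure IsFieldDispersion (s : ℝ) (ω : E ν → ℝ) : Prop where
  nonneg : ∀ k, 0 ≤ ω k
  analytic : AnalyticOnNhd ℝ ω Set.univ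
  rotation : RotationInvariant ω
  deriv_bounded : ∀ n : ℕ, 1 ≤ n → ∃ C : ℝ, ∀ k, ‖iteratedFDeriv ℝ n ω k‖ ≤ C
  coercive : s = 0 → Tendsto ω (cocompact (E ν)) atTop

/-- The hypotheses on the coupling function `ρ ∈ L²(ℝ^ν)`: its Fourier transform has a `C²`
representative `r` with weighted square integrable first and second derivatives, and `ρ` is short
range. (These conditions do not depend on how the Fourier transform is normalized.) -/
structure IsCoupling (ρ : L2 ν) : Prop where
  rotation : RotationInvariant (ρ : E ν → ℂ)
  fourier : ∃ r : E ν → ℂ, ((𝓕 ρ : L2 ν) : E ν → ℂ) =ᵐ[volume] r ∧ ContDiff ℝ 2 r ∧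
    MemLp (fun k => bracket k * ‖fderiv ℝ r k‖) 2 volume ∧
    MemLp (fun k => bracket k * ‖iteratedFDeriv ℝ 2 r k‖) 2 volume
  short_range : ∃ C μ : ℝ, 0 < C ∧ 0 < μ ∧
    ∀ᵐ x, ‖ρ x‖ ≤ C * bracket x ^ (-1 - (ν : ℝ) / 2 - μ)

/-! ### The fiber Hamiltonians -/

/-- Multiplication by the function `m` on its maximal domain in `L²(ℝ^ν)`. -/
def multiplication (m : E ν → ℂ) : L2 ν →ₗ.[ℂ] L2 ν where
  domain :=
    { carrier := {u | MemLp (fun ξ => m ξ * u ξ) 2 volume}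
      zero_mem' := by
        refine (memLp_congr_ae (g := 0) ?_).2 MemLp.zero
        filter_upwards [Lp.coeFn_zero ℂ 2 (volume : Measure (E ν))] with ξ hξ
        simp only [hξ, Pi.zero_apply, mul_zero]
      add_mem' := by
        intro u w hu hw
        refine (memLp_congr_ae ?_).2 (hu.add hw)
        filter_upwards [Lp.coeFn_add u w] with ξ hξ
        simp only [hξ, Pi.add_apply, mul_add]
      smul_mem' := by
        intro c u hu
        refine (memLp_congr_ae ?_).2 (hu.const_smul c)
        filter_upwards [Lp.coeFn_smul c u] with ξ hξ
        simp only [hξ, Pi.smul_apply, smul_eq_mul, mul_left_comm] }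
  toFun :=
    { toFun := fun u => MemLp.toLp (fun ξ => m ξ * (u : L2 ν) ξ) u.2
      map_add' := by
        intro u w
        refine Eq.trans (MemLp.toLp_congr _ (u.2.add w.2) ?_) (MemLp.toLp_add _ _)
        filter_upwards [Lp.coeFn_add (u : L2 ν) (w : L2 ν)] with ξ hξ
        simp only [Submodule.coe_add, hξ, Pi.add_apply, mul_add]
      map_smul' := by
        intro c u
        refine Eq.trans (MemLp.toLp_congr _ (u.2.const_smul c) ?_) (MemLp.toLp_const_smul _ _)
        filter_upwards [Lp.coeFn_smul c (u : L2 ν)] with ξ hξ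
        simp only [Submodule.coe_smul, hξ, Pi.smul_apply, smul_eq_mul, mul_left_comm] }

/-- The operator `g(D_x)`, `D_x = -i∇`, on its maximal domain in `L²(ℝ^ν)`. With the normalization
`𝓕 u (ξ) = ∫ e^{-2πi x·ξ} u(x) dx` the operator `D_x` is multiplication by `2πξ` after `𝓕`. -/
def fourierMultiplier (g : E ν → ℝ) : L2 ν →ₗ.[ℂ] L2 ν :=
  let M := multiplication fun ξ : E ν => ((g ((2 * Real.pi) • ξ) : ℝ) : ℂ)
  let U : L2 ν →ₗ[ℂ] L2 ν := (Lp.fourierTransformₗᵢ (E ν) ℂ).toLinearEquiv.toLinearMap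
  let U' : L2 ν →ₗ[ℂ] L2 ν := (Lp.fourierTransformₗᵢ (E ν) ℂ).symm.toLinearEquiv.toLinearMap
  { domain := M.domain.comap U
    toFun := U' ∘ₗ M.toFun ∘ₗ
      (U.restrict (p := M.domain.comap U) (q := M.domain) fun _ hu => hu) }

/-- The operator `diag(c, T)` on `ℂ ⊕ L²(ℝ^ν)`, with domain `ℂ ⊕ D(T)`. -/
def diagonal (c : ℂ) (T : L2 ν →ₗ.[ℂ] L2 ν) : FiberSpace ν →ₗ.[ℂ] FiberSpace ν where
  domain := T.domain.comap (WithLp.sndₗ (p := 2) (𝕜 := ℂ) (α := ℂ) (β := L2 ν))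
  toFun :=
    { toFun := fun u => WithLp.toLp 2 (c * (u : FiberSpace ν).fst, T ⟨(u : FiberSpace ν).snd, u.2⟩)
      map_add' := by
        intro u w
        rw [← WithLp.toLp_add, Prod.mk_add_mk, ← LinearPMap.map_add, ← mul_add]
        rfl
      map_smul' := by
        intro a u
        rw [RingHom.id_apply, ← WithLp.toLp_smul, Prod.smul_mk, ← LinearPMap.map_smul,
          smul_eq_mul, mul_left_comm]
        rfl }

/-- The interaction `(u₀, u₁) ↦ (⟨ρ, u₁⟩, u₀ ρ)`. -/
def interaction (ρ : L2 ν) : FiberSpace ν →ₗ[ℂ] FiberSpace ν where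
  toFun u := WithLp.toLp 2 (⟪ρ, u.snd⟫_ℂ, u.fst • ρ)
  map_add' u w :=
    congrArg (WithLp.toLp 2) (Prod.ext (inner_add_right _ u.snd w.snd) (add_smul u.fst w.fst ρ))
  map_smul' a u :=
    congrArg (WithLp.toLp 2) (Prod.ext (inner_smul_right _ u.snd a) (mul_smul a u.fst ρ))

/-- The fiber Hamiltonian `H(P)`: the sum of the free Hamiltonian
`diag(Ω(P), Ω(P - D_x) + ω(D_x))` and of the interaction. -/
def hamiltonian (Ω ω : E ν → ℝ) (ρ : L2 ν) (P : E ν) : FiberSpace ν →ₗ.[ℂ] FiberSpace ν :=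
  interaction ρ +ᵥ diagonal (Ω P : ℂ) (fourierMultiplier fun k => Ω (P - k) + ω k)

/-- The set of thresholds `θ(P)`. -/
def thresholds (Ω ω : E ν → ℝ) (P : E ν) : Set ℝ :=
  {l | ∃ k : E ν, l = Ω (P - k) + ω k ∧ gradient Ω (P - k) = gradient ω k}

/-! ### The conjugate operator -/

/-- The operator `½ (v(D_x)·x + x·v(D_x))` on Schwartz functions, for a smooth vector field `v`
of temperate growth. -/
def conjugateSchwartz (v : E ν → E ν) : 𝓢(E ν, ℂ) →L[ℂ] 𝓢(E ν, ℂ) :=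
  (1 / 2 : ℂ) • ∑ j : Fin ν,
    (SchwartzMap.fourierMultiplierCLM ℂ (fun ξ : E ν => ((v ((2 * Real.pi) • ξ) j : ℝ) : ℂ)) ∘L
        SchwartzMap.smulLeftCLM ℂ (fun x : E ν => ((x j : ℝ) : ℂ)) +
      SchwartzMap.smulLeftCLM ℂ (fun x : E ν => ((x j : ℝ) : ℂ)) ∘L
        SchwartzMap.fourierMultiplierCLM ℂ (fun ξ : E ν => ((v ((2 * Real.pi) • ξ) j : ℝ) : ℂ)))

/-- The inclusion of Schwartz functions in `L²(ℝ^ν)`. -/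
def schwartzToL2 (ν : ℕ) : 𝓢(E ν, ℂ) →ₗ[ℂ] L2 ν :=
  (SchwartzMap.toLpCLM ℂ (E := E ν) ℂ 2 volume).toLinearMap

theorem schwartzToL2_injective (ν : ℕ) : Function.Injective (schwartzToL2 ν) :=
  SchwartzMap.injective_toLp 2 volume

/-- The self-adjoint operator `a` in `L²(ℝ^ν)`: the closure of `½ (v(D_x)·x + x·v(D_x))` on the
Schwartz functions. -/
def conjugateOneParticle (v : E ν → E ν) : L2 ν →ₗ.[ℂ] L2 ν :=
  LinearPMap.closure
    { domain := LinearMap.range (schwartzToL2 ν)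
      toFun := schwartzToL2 ν ∘ₗ (conjugateSchwartz v).toLinearMap ∘ₗ
        (LinearEquiv.ofInjective (schwartzToL2 ν) (schwartzToL2_injective ν)).symm.toLinearMap }

/-- The vector field `v_P(k) = ∇ω(k) - ∇Ω(P - k)`. -/
def vectorField (Ω ω : E ν → ℝ) (P : E ν) (k : E ν) : E ν :=
  gradient ω k - gradient Ω (P - k)

/-- The conjugate operator `A_P = diag(0, a_P)`. -/
def conjugateOperator (Ω ω : E ν → ℝ) (P : E ν) : FiberSpace ν →ₗ.[ℂ] FiberSpace ν :=
  diagonal 0 (conjugateOneParticle (vectorField Ω ω P))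

end Nelson

end

/-! Write `E_P(k) = Ω(P - k) + ω(k)`, so that `v_P = ∇E_P`. In momentum space `i a_{P₀}` is, up to
sign, transport along `v_{P₀}` plus half its divergence. Its commutator with `E_P(D)` is therefore
multiplication by `v_{P₀}·v_P`, and its commutator with the interaction is the finite rank form
given by a vector `η`, formally `-i a_{P₀} ρ`. Since `|∇Ω|² ≤ C(1 + Ω)`, the symbol `v_{P₀}·v_P` is
bounded by `1 + E_P` for `P` near `P₀` (`norm_mul_norm_vectorField_le`). This gives a form bounded
in the graph norm (`isCommutatorExtension_commutatorForm`), which is unique because Schwartz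
functions form a core (`hamiltonian_core`).

Positivity has two sources. Because `λ₀` is not a threshold and energy shells are compact,
`v_{P₀}·v_P ≥ c` near the shell `E_P = λ₀`. Away from it the symbol is at worst linear in `E_P`,
whence `v_{P₀}·v_P ≥ c - K (E_P - λ₀)²` everywhere (`inner_vectorField_ge`). With `u = (u₀, u₁)` the
form is thus at least `c‖u₁‖² - K‖(E_P(D) - λ₀)u₁‖² + 2 Re(ū₀⟨η, u₁⟩)`.

Because `λ₀` is not an eigenvalue, normalized vectors with `(H(P_n) - λ₀)u_n → 0` and `P_n → P₀`
converge weakly to zero: a nonzero weak limit would be an eigenvector of `H(P₀)`. Then `u₀ → 0` in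
`ℂ`, so `‖u₁‖ → 1`. Also `(E_P(D) - λ₀)u₁`, which is the second component of `(H(P) - λ₀)u` minus
`u₀ρ`, tends to zero, and the lower bound tends to `c`. By contradiction, one `ε` works for all
approximate eigenvectors of all nearby fibers (`exists_positivity`), with no compact remainder to
absorb.

Finally, if `f` is supported within `ε` of `λ₀`, every vector `f(H(P))u` is such an approximate
eigenvector (`norm_sub_smul_functionalCalculus_le`), which turns the bound on vectors into the
operator estimate. -/

noncomputable section

namespace Nelson

/-! ### Functional calculus of a symmetric operator with resolvents at `±i` -/

section AbstractCalculus

variable {K : Type*} [NormedAddCommGroup K] [InnerProductSpace ℂ K]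

theorem IsResolventAt.unique {T : K →ₗ.[ℂ] K} {z : ℂ} {R R' : K →L[ℂ] K}
    (h : IsResolventAt T z R) (h' : IsResolventAt T z R') : R = R' := by
  ext u
  obtain ⟨hu, hu'⟩ := h'.1 u
  simpa [hu'] using h.2 ⟨R' u, hu⟩

theorem IsResolventAt.resolventAt_eq {T : K →ₗ.[ℂ] K} {z : ℂ} {R : K →L[ℂ] K}
    (h : IsResolventAt T z R) : resolventAt T z = R := by
  have hex : ∃ R, IsResolventAt T z R := ⟨R, h⟩
  rw [resolventAt, dif_pos hex]
  exact hex.choose_spec.unique h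

/-- The function on the complex plane that corresponds to the function `g` on the line under
`z = (x - i)⁻¹`. -/
def cayleyPullback (g : ℝ → ℂ) (z : ℂ) : ℂ := if z = 0 then 0 else g (z⁻¹ + Complex.I).re

/-- The circle `{(x - i)⁻¹} ∪ {0}`. -/
def cayleyCircle : Set ℂ := {z | z.im = Complex.normSq z}

/-- On the circle the imaginary part of `z⁻¹` equals `-1`. Hence `z⁻¹ + i` is real, and the `re` in
`cayleyPullback` loses nothing there. -/
theorem inv_of_mem_cayleyCircle {z : ℂ} (hz : z ∈ cayleyCircle) (h0 : z ≠ 0) :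
    z⁻¹ = ((z⁻¹ + Complex.I).re : ℂ) - Complex.I := by
  have h : Complex.normSq z ≠ 0 := by simpa using h0
  have hz' : z.im = Complex.normSq z := hz
  apply Complex.ext
  · simp
  · simp [Complex.inv_im, hz', h]

/-- The only delicate point is `z = 0`, the image of infinity. Compact support of `g` makes the
pullback vanish on the part of the circle near it. -/
theorem continuousOn_cayleyPullback {g : ℝ → ℂ} (hg : Continuous g) (hs : HasCompactSupport g) :
    ContinuousOn (cayleyPullback g) cayleyCircle := by
  intro z hz
  by_cases h0 : z = 0
  · subst h0
    obtain ⟨M, hM⟩ := hs.isCompact.isBounded.exists_norm_le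
    have hM0 : 0 < |M| + 1 + 1 := by positivity
    have : ∀ᶠ y in 𝓝[cayleyCircle] (0 : ℂ), cayleyPullback g y = 0 := by
      have h1 : ∀ᶠ y in 𝓝[cayleyCircle] (0 : ℂ), ‖y‖ < (|M| + 1 + 1)⁻¹ := by
        apply mem_nhdsWithin_of_mem_nhds
        have := Metric.ball_mem_nhds (0 : ℂ) (inv_pos.2 hM0)
        filter_upwards [this] with y hy
        simpa using hy
      filter_upwards [h1, self_mem_nhdsWithin] with y hy hyc
      by_cases hy0 : y = 0
      · simp [cayleyPullback, hy0]
      rw [cayleyPullback, if_neg hy0]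
      by_contra hne
      have h2 := hM _ (subset_tsupport _ hne)
      have h3 := inv_of_mem_cayleyCircle hyc hy0
      have h4 : ‖y⁻¹‖ ≤ |M| + 1 := by
        rw [h3]
        refine (norm_sub_le _ _).trans ?_
        rw [Complex.norm_real, Complex.norm_I]
        linarith [le_abs_self M]
      have h5 : |M| + 1 + 1 < ‖y⁻¹‖ := by
        rw [norm_inv, lt_inv_comm₀ hM0 (norm_pos_iff.2 hy0)]
        exact hy
      linarith
    have h2 : Tendsto (cayleyPullback g) (𝓝[cayleyCircle] 0) (𝓝 0) :=
      tendsto_const_nhds.congr' (this.mono fun _ h => h.symm)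
    simpa [ContinuousWithinAt, cayleyPullback] using h2
  · apply ContinuousAt.continuousWithinAt
    have h1 : ContinuousAt (fun z : ℂ => g (z⁻¹ + Complex.I).re) z :=
      hg.continuousAt.comp (Complex.continuous_re.continuousAt.comp
        ((continuousAt_inv₀ h0).add continuousAt_const))
    refine h1.congr ?_
    filter_upwards [isOpen_ne.mem_nhds h0] with y hy
    rw [cayleyPullback, if_neg hy]

variable {T : K →ₗ.[ℂ] K} {R R' : K →L[ℂ] K}

theorem IsResolventAt.sub_eq (hR : IsResolventAt T Complex.I R)
    (hR' : IsResolventAt T (-Complex.I) R') : R - R' = (2 * Complex.I) • (R * R') := by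
  ext y
  obtain ⟨hy, hy'⟩ := hR'.1 y
  have h := hR.2 ⟨R' y, hy⟩
  have h2 : T ⟨R' y, hy⟩ = y - Complex.I • R' y := by
    rw [eq_add_of_sub_eq hy']
    module
  rw [h2] at h
  simp only [map_sub, map_smul] at h
  simp only [sub_apply, smul_apply, mul_apply_eq_comp]
  rw [← sub_eq_zero] at h ⊢
  rw [← h]
  module

theorem IsResolventAt.sub_eq' (hR : IsResolventAt T Complex.I R)
    (hR' : IsResolventAt T (-Complex.I) R') : R - R' = (2 * Complex.I) • (R' * R) := by
  ext y
  obtain ⟨hy, hy'⟩ := hR.1 y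
  have h := hR'.2 ⟨R y, hy⟩
  have h2 : T ⟨R y, hy⟩ = y + Complex.I • R y := by
    exact eq_add_of_sub_eq hy'
  rw [h2] at h
  simp only [map_sub, map_add, map_smul] at h
  simp only [sub_apply, smul_apply, mul_apply_eq_comp]
  rw [← sub_eq_zero] at h ⊢
  rw [← neg_eq_zero, ← h]
  module

variable [CompleteSpace K]

theorem IsResolventAt.adjoint_eq (hT : ∀ u w : T.domain, ⟪T u, (w : K)⟫_ℂ = ⟪(u : K), T w⟫_ℂ)
    (hR : IsResolventAt T Complex.I R) (hR' : IsResolventAt T (-Complex.I) R') :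
    star R = R' := by
  rw [ContinuousLinearMap.star_eq_adjoint]
  symm
  rw [ContinuousLinearMap.eq_adjoint_iff]
  intro x y
  obtain ⟨hy, hy'⟩ := hR.1 y
  obtain ⟨hx, hx'⟩ := hR'.1 x
  have h := hT ⟨R' x, hx⟩ ⟨R y, hy⟩
  conv_lhs => rw [← hy']
  conv_rhs => rw [← hx']
  simp only [inner_sub_right, inner_sub_left, inner_smul_left, inner_smul_right] at h ⊢
  rw [h]
  simp

/-- The two orders of the first resolvent identity give `R R' = R' R`, and `R'` is the adjoint of
`R`. -/
theorem isStarNormal_of_isResolventAt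
    (hT : ∀ u w : T.domain, ⟪T u, (w : K)⟫_ℂ = ⟪(u : K), T w⟫_ℂ)
    (hR : IsResolventAt T Complex.I R) (hR' : IsResolventAt T (-Complex.I) R') :
    IsStarNormal R := by
  refine ⟨?_⟩
  rw [hR.adjoint_eq hT hR', Commute, SemiconjBy]
  have h := (hR.sub_eq hR').symm.trans (hR.sub_eq' hR')
  have h2 : (2 * Complex.I) ≠ 0 := by simp
  exact ((smul_right_injective _ h2) h).symm

/-- The resolvent identity `R - R* = 2i R R*`, read on the spectrum, says `z - z̄ = 2i |z|²`. -/
theorem spectrum_subset_cayleyCircle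
    (hT : ∀ u w : T.domain, ⟪T u, (w : K)⟫_ℂ = ⟪(u : K), T w⟫_ℂ)
    (hR : IsResolventAt T Complex.I R) (hR' : IsResolventAt T (-Complex.I) R') :
    spectrum ℂ R ⊆ cayleyCircle := by
  have hn := isStarNormal_of_isResolventAt hT hR hR'
  have h : cfc (fun z : ℂ => z - star z) R = cfc (fun z : ℂ => (2 * Complex.I) • (z * star z)) R := by
    rw [cfc_sub _ _ R, cfc_smul _ _ R, cfc_mul _ _ R, cfc_star_id R, cfc_id' ℂ R,
      hR.adjoint_eq hT hR']
    exact hR.sub_eq hR'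
  have h2 := (cfc_eq_cfc_iff_eqOn (ha := hn)).1 h
  intro z hz
  have h3 := congrArg Complex.im (h2 hz)
  simp only [Complex.star_def, Complex.mul_conj, smul_eq_mul] at h3
  simp at h3
  change z.im = Complex.normSq z
  linarith

theorem functionalCalculus_eq (hR : IsResolventAt T Complex.I R) (f : ℝ → ℝ) :
    functionalCalculus T f = cfc (cayleyPullback fun x => (f x : ℂ)) R := by
  rw [functionalCalculus, hR.resolventAt_eq]
  rfl

theorem functionalCalculus_mul (hT : ∀ u w : T.domain, ⟪T u, (w : K)⟫_ℂ = ⟪(u : K), T w⟫_ℂ)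
    (hR : IsResolventAt T Complex.I R) (hR' : IsResolventAt T (-Complex.I) R')
    {f g : ℝ → ℝ} (hf : Continuous f) (hfs : HasCompactSupport f)
    (hg : Continuous g) (hgs : HasCompactSupport g) :
    functionalCalculus T (fun x => f x * g x) =
      functionalCalculus T f * functionalCalculus T g := by
  have hs := spectrum_subset_cayleyCircle hT hR hR'
  have cf := (continuousOn_cayleyPullback (g := fun x => (f x : ℂ)) (by fun_prop)
    (hfs.comp_left Complex.ofReal_zero)).mono hs
  have cg := (continuousOn_cayleyPullback (g := fun x => (g x : ℂ)) (by fun_prop)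
    (hgs.comp_left Complex.ofReal_zero)).mono hs
  simp only [functionalCalculus_eq hR]
  rw [← cfc_mul _ _ R cf cg]
  congr 1
  ext z
  by_cases h : z = 0 <;> simp [cayleyPullback, h]

theorem functionalCalculus_selfAdjoint (hR : IsResolventAt T Complex.I R) (f : ℝ → ℝ) :
    star (functionalCalculus T f) = functionalCalculus T f := by
  rw [functionalCalculus_eq hR, ← cfc_star]
  congr 1
  ext z
  by_cases h : z = 0 <;> simp [cayleyPullback, h]

theorem inner_functionalCalculus_sq (hT : ∀ u w : T.domain, ⟪T u, (w : K)⟫_ℂ = ⟪(u : K), T w⟫_ℂ)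
    (hR : IsResolventAt T Complex.I R) (hR' : IsResolventAt T (-Complex.I) R')
    {f : ℝ → ℝ} (hf : Continuous f) (hfs : HasCompactSupport f)
    (u : K) : (⟪u, functionalCalculus T (fun x => f x ^ 2) u⟫_ℂ).re =
      ‖functionalCalculus T f u‖ ^ 2 := by
  simp only [sq (f _)]
  rw [functionalCalculus_mul hT hR hR' hf hfs hf hfs, mul_apply_eq_comp]
  nth_rewrite 1 [← functionalCalculus_selfAdjoint hR]
  rw [ContinuousLinearMap.star_eq_adjoint, ContinuousLinearMap.adjoint_inner_right,
    inner_self_eq_norm_sq_to_K]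
  norm_cast

/-- Functions of `T` supported near `l` map into the domain, and there `T` is close to `l`. -/
theorem norm_sub_smul_functionalCalculus_le (hT : ∀ u w : T.domain, ⟪T u, (w : K)⟫_ℂ = ⟪(u : K), T w⟫_ℂ)
    (hR : IsResolventAt T Complex.I R) (hR' : IsResolventAt T (-Complex.I) R')
    {f : ℝ → ℝ} (hf : Continuous f)
    (hfs : HasCompactSupport f) {l δ : ℝ} (hδ : ∀ x, f x ≠ 0 → |x - l| ≤ δ) (u : K) :
    ∃ h : functionalCalculus T f u ∈ T.domain,
      ‖T ⟨functionalCalculus T f u, h⟩ - (l : ℂ) • functionalCalculus T f u‖ ≤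
        δ * ‖functionalCalculus T f u‖ := by
  have hs := spectrum_subset_cayleyCircle hT hR hR'
  have hn := isStarNormal_of_isResolventAt hT hR hR'
  have cf := (continuousOn_cayleyPullback (g := fun x => (f x : ℂ)) (by fun_prop)
    (hfs.comp_left Complex.ofReal_zero)).mono hs
  have cg := (continuousOn_cayleyPullback (g := fun x => (f x : ℂ) * ((x : ℂ) - Complex.I))
    (by fun_prop) ((hfs.comp_left Complex.ofReal_zero).mul_right)).mono hs
  set S := cfc (cayleyPullback fun x => (f x : ℂ) * ((x : ℂ) - Complex.I)) R with hS
  -- `S` plays the role of `(T - i) f(T)`. Factoring `R` out on the left puts the range of `f(T)` in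
  -- the domain.
  have h1 : functionalCalculus T f = R * S := by
    rw [functionalCalculus_eq hR, hS]
    have h0 := cfc_mul (fun z : ℂ => z) _ R (continuousOn_id' _) cg
    rw [cfc_id' ℂ R] at h0
    rw [← h0]
    apply cfc_congr
    intro z hz
    by_cases h : z = 0
    · simp [cayleyPullback, h]
    · simp only [cayleyPullback, h, if_false]
      rw [← inv_of_mem_cayleyCircle (hs hz) h]
      field_simp
  have h2 : S - (((l : ℂ) - Complex.I)) • functionalCalculus T f =
      functionalCalculus T (fun x => f x * (x - l)) := by
    have h0 := cfc_sub _ _ R cg (cf.const_smul ((l : ℂ) - Complex.I))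
    have h0' := cfc_smul ((l : ℂ) - Complex.I) _ R cf
    rw [show (fun x => ((l : ℂ) - Complex.I) • cayleyPullback (fun x => (f x : ℂ)) x) =
      ((l : ℂ) - Complex.I) • cayleyPullback (fun x => (f x : ℂ)) from rfl] at h0'
    rw [h0'] at h0
    rw [hS, functionalCalculus_eq hR, functionalCalculus_eq hR, ← h0]
    congr 1
    ext z
    by_cases h : z = 0
    · simp [cayleyPullback, h]
    · simp only [Pi.smul_apply, cayleyPullback, h, if_false, smul_eq_mul]
      push_cast
      ring
  obtain ⟨hu, hu'⟩ := hR.1 (S u)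
  have h3 : functionalCalculus T f u = R (S u) := by rw [h1]; rfl
  refine ⟨h3 ▸ hu, ?_⟩
  have h4 : T ⟨functionalCalculus T f u, h3 ▸ hu⟩ - (l : ℂ) • functionalCalculus T f u =
      functionalCalculus T (fun x => f x * (x - l)) u := by
    rw [← h2]
    simp only [sub_apply, smul_apply, h3]
    rw [eq_add_of_sub_eq hu']
    module
  rw [h4]
  have hg : Continuous fun x => f x * (x - l) := by fun_prop
  have hgs : HasCompactSupport fun x => f x * (x - l) := hfs.mul_right
  -- Pythagorean complement: the squares of `f (x - l)` and of this function add up to `δ² f²`.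
  -- Where the radicand is negative, `f` vanishes, so the truncation in `Real.sqrt` is harmless.
  have hk : Continuous fun x => f x * Real.sqrt (δ ^ 2 - (x - l) ^ 2) := by fun_prop
  have hks : HasCompactSupport fun x => f x * Real.sqrt (δ ^ 2 - (x - l) ^ 2) := hfs.mul_right
  have e1 := inner_functionalCalculus_sq hT hR hR' hg hgs u
  have e2 := inner_functionalCalculus_sq hT hR hR' hk hks u
  have e3 := inner_functionalCalculus_sq hT hR hR' hf hfs u
  have e4 : functionalCalculus T (fun x => (f x * (x - l)) ^ 2) +
      functionalCalculus T (fun x => (f x * Real.sqrt (δ ^ 2 - (x - l) ^ 2)) ^ 2) =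
      ((δ : ℂ) ^ 2) • functionalCalculus T (fun x => f x ^ 2) := by
    have c1 := (continuousOn_cayleyPullback (g := fun x => (((f x * (x - l)) ^ 2 : ℝ) : ℂ))
      (by fun_prop) ((hgs.comp_left (g := fun y : ℝ => ((y ^ 2 : ℝ) : ℂ)) (by simp)))).mono hs
    have c2 := (continuousOn_cayleyPullback
      (g := fun x => (((f x * Real.sqrt (δ ^ 2 - (x - l) ^ 2)) ^ 2 : ℝ) : ℂ))
      (by fun_prop) ((hks.comp_left (g := fun y : ℝ => ((y ^ 2 : ℝ) : ℂ)) (by simp)))).mono hs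
    have c3 := (continuousOn_cayleyPullback (g := fun x => ((f x ^ 2 : ℝ) : ℂ))
      (by fun_prop) ((hfs.comp_left (g := fun y : ℝ => ((y ^ 2 : ℝ) : ℂ)) (by simp)))).mono hs
    rw [functionalCalculus_eq hR, functionalCalculus_eq hR, functionalCalculus_eq hR,
      ← cfc_add _ _ _ c1 c2, ← cfc_smul _ _ R c3]
    congr 1
    ext z
    by_cases h : z = 0
    · simp [cayleyPullback, h]
    · simp only [cayleyPullback, h, if_false, smul_eq_mul]
      generalize (z⁻¹ + Complex.I).re = x
      by_cases hx : f x = 0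
      · simp [hx]
      · have : 0 ≤ δ ^ 2 - (x - l) ^ 2 := by
          have := sq_le_sq' (by linarith [neg_le_of_abs_le (hδ x hx)]) (le_of_abs_le (hδ x hx))
          linarith
        rw [mul_pow, mul_pow, Real.sq_sqrt this]
        push_cast
        ring
  have e5 := congrArg (fun S : K →L[ℂ] K => (⟪u, S u⟫_ℂ).re) e4
  simp only [add_apply, smul_apply, inner_add_right,
    inner_smul_right, Complex.add_re, e1, e2] at e5
  rw [← Complex.ofReal_pow, Complex.re_ofReal_mul, e3] at e5
  -- For `f = 0` the hypothesis does not force `δ ≥ 0`; otherwise it does, and square roots may be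
  -- taken.
  by_cases hz : functionalCalculus T f = 0
  · have : ‖functionalCalculus T (fun x => f x * (x - l)) u‖ ^ 2 ≤ 0 := by
      rw [hz] at e5
      simp at e5
      nlinarith [sq_nonneg ‖functionalCalculus T
        (fun x => f x * Real.sqrt (δ ^ 2 - (x - l) ^ 2)) u‖]
    have := pow_eq_zero_iff (two_ne_zero) |>.1 (le_antisymm this (sq_nonneg _))
    simp [this, hz]
  have hδ0 : 0 ≤ δ := by
    by_contra hneg
    apply hz
    have : f = fun _ => 0 := by
      ext x
      by_contra hx
      linarith [abs_nonneg (x - l), hδ x hx]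
    rw [functionalCalculus_eq hR, this]
    have : cayleyPullback (fun _ => ((0 : ℝ) : ℂ)) = fun _ => 0 := by
      ext z; simp [cayleyPullback]
    rw [this]
    exact cfc_const_zero ℂ R
  refine abs_le_of_sq_le_sq' ?_ (by positivity) |>.2
  rw [mul_pow]
  nlinarith [sq_nonneg ‖functionalCalculus T
        (fun x => f x * Real.sqrt (δ ^ 2 - (x - l) ^ 2)) u‖]

end AbstractCalculus

/-! ### Existence of resolvents of symmetric operators -/

section AbstractResolvent

variable {K : Type*} [NormedAddCommGroup K] [InnerProductSpace ℂ K]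

theorem inner_self_eq_ofReal (u : K) : ⟪u, u⟫_ℂ = ((‖u‖ ^ 2 : ℝ) : ℂ) := by
  rw [inner_self_eq_norm_sq_to_K, Complex.ofReal_pow]
  rfl

/-- The operator is symmetric on its domain. -/
def IsSymm (T : K →ₗ.[ℂ] K) : Prop := ∀ u w : T.domain, ⟪T u, (w : K)⟫_ℂ = ⟪(u : K), T w⟫_ℂ

theorem IsSymm.im_inner_eq_zero {T : K →ₗ.[ℂ] K} (hT : IsSymm T) (u : T.domain) :
    (⟪(u : K), T u⟫_ℂ).im = 0 := by
  have h := hT u u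
  rw [← inner_conj_symm] at h
  exact Complex.conj_eq_iff_im.1 h

theorem IsSymm.norm_le {T : K →ₗ.[ℂ] K} (hT : IsSymm T) (z : ℂ) (u : T.domain) :
    |z.im| * ‖(u : K)‖ ≤ ‖T u - z • (u : K)‖ := by
  by_cases hu : (u : K) = 0
  · simp [hu]
  have h0 : 0 < ‖(u : K)‖ := norm_pos_iff.2 hu
  have h1 : (⟪(u : K), T u - z • (u : K)⟫_ℂ).im = -(z.im * ‖(u : K)‖ ^ 2) := by
    rw [inner_sub_right, inner_smul_right, inner_self_eq_ofReal, Complex.sub_im,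
      hT.im_inner_eq_zero, Complex.im_mul_ofReal, zero_sub]
  have h2 := (Complex.abs_im_le_norm _).trans (norm_inner_le_norm (𝕜 := ℂ) (u : K)
    (T u - z • (u : K)))
  rw [h1, abs_neg, abs_mul, abs_of_nonneg (sq_nonneg ‖(u : K)‖)] at h2
  refine le_of_mul_le_mul_left ?_ h0
  linarith

/-- Only surjectivity has to be assumed: `IsSymm.norm_le` gives injectivity of `T - z` and the bound
`|Im z|⁻¹` on its inverse. -/
theorem IsSymm.exists_isResolventAt {T : K →ₗ.[ℂ] K} (hT : IsSymm T) {z : ℂ} (hz : z.im ≠ 0)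
    (hs : ∀ f : K, ∃ u : T.domain, T u - z • (u : K) = f) : ∃ R, IsResolventAt T z R := by
  have hz' : 0 < |z.im| := abs_pos.2 hz
  let S : T.domain →ₗ[ℂ] K := T.toFun - z • T.domain.subtype
  have hS : ∀ u, S u = T u - z • (u : K) := fun u => rfl
  have hinj : Function.Injective S := by
    rw [injective_iff_map_eq_zero]
    intro u hu
    have := hT.norm_le z u
    rw [← hS, hu, norm_zero] at this
    have h3 : ‖(u : K)‖ ≤ 0 := by
      by_contra hlt
      push Not at hlt
      nlinarith
    exact Subtype.ext (norm_le_zero_iff.1 h3)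
  let e := LinearEquiv.ofBijective S ⟨hinj, hs⟩
  have he : ∀ u, e u = T u - z • (u : K) := fun u => rfl
  let R : K →L[ℂ] K := LinearMap.mkContinuous (T.domain.subtype ∘ₗ e.symm.toLinearMap) (|z.im|⁻¹) (by
    intro f
    have := hT.norm_le z (e.symm f)
    rw [← he, e.apply_symm_apply] at this
    rw [inv_mul_eq_div, le_div_iff₀ hz', mul_comm]
    exact this)
  have hR : ∀ f, R f = e.symm f := fun f => rfl
  refine ⟨R, fun f => ?_, fun u => ?_⟩
  · refine ⟨(e.symm f).2, ?_⟩
    exact e.apply_symm_apply f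
  · rw [← he, hR, e.symm_apply_apply]

end AbstractResolvent

variable {ν : ℕ}

/-! ### Multiplication by bounded continuous functions -/

theorem memLp_bounded_mul (m : BoundedContinuousFunction (E ν) ℂ) (f : L2 ν) :
    MemLp (fun ξ => m ξ * f ξ) 2 volume :=
  (Lp.memLp f).of_le_mul (c := ‖m‖)
    (m.continuous.aestronglyMeasurable.mul (Lp.aestronglyMeasurable f))
    (ae_of_all _ fun ξ => by
      rw [norm_mul]
      exact mul_le_mul_of_nonneg_right (m.norm_coe_le_norm ξ) (norm_nonneg _))

/-- Multiplication by a bounded continuous function, as a bounded operator. -/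
def mulOp (m : BoundedContinuousFunction (E ν) ℂ) : L2 ν →L[ℂ] L2 ν :=
  LinearMap.mkContinuous
    ((multiplication (m : E ν → ℂ)).toFun ∘ₗ
      (LinearMap.id.codRestrict (multiplication (m : E ν → ℂ)).domain
        fun f => memLp_bounded_mul m f)) ‖m‖ (by
    intro f
    refine Lp.norm_le_mul_norm_of_ae_le_mul ?_
    filter_upwards [(memLp_bounded_mul m f).coeFn_toLp] with ξ hξ
    refine (congrArg norm hξ).trans_le ?_
    rw [norm_mul]
    exact mul_le_mul_of_nonneg_right (m.norm_coe_le_norm ξ) (norm_nonneg _))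

theorem coeFn_mulOp (m : BoundedContinuousFunction (E ν) ℂ) (f : L2 ν) :
    mulOp m f =ᵐ[volume] fun ξ => m ξ * f ξ :=
  (memLp_bounded_mul m f).coeFn_toLp

theorem inner_L2_eq (f g : L2 ν) : ⟪f, g⟫_ℂ = ∫ ξ, conj (f ξ) * g ξ := by
  rw [L2.inner_def]
  refine integral_congr_ae (ae_of_all _ fun ξ => ?_)
  simp [mul_comm]

theorem inner_mulOp_left (m m' : BoundedContinuousFunction (E ν) ℂ) (hm : ∀ ξ, m' ξ = conj (m ξ))
    (f g : L2 ν) : ⟪mulOp m f, g⟫_ℂ = ⟪f, mulOp m' g⟫_ℂ := by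
  rw [inner_L2_eq, inner_L2_eq]
  refine integral_congr_ae ?_
  filter_upwards [coeFn_mulOp m f, coeFn_mulOp m' g] with ξ h1 h2
  rw [h1, h2, hm, map_mul]
  ring

/-- Convergence in `L²` by dominated convergence. -/
theorem tendsto_L2_of_dominated {f : ℕ → L2 ν} {g h : L2 ν}
    (hb : ∀ n, ∀ᵐ ξ, ‖f n ξ - g ξ‖ ≤ ‖h ξ‖)
    (hl : ∀ᵐ ξ, Tendsto (fun n => f n ξ) atTop (𝓝 (g ξ))) : Tendsto f atTop (𝓝 g) := by
  rw [tendsto_iff_norm_sub_tendsto_zero]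
  have h1 : Tendsto (fun n => ∫ ξ, ‖f n ξ - g ξ‖ ^ 2) atTop (𝓝 (∫ _ : E ν, (0 : ℝ))) := by
    refine tendsto_integral_of_dominated_convergence (fun ξ => ‖h ξ‖ ^ 2) ?_ ?_ ?_ ?_
    · intro n
      exact (((Lp.aestronglyMeasurable (f n)).sub (Lp.aestronglyMeasurable g)).norm).pow 2
    · exact (Lp.memLp h).norm.integrable_sq
    · intro n
      filter_upwards [hb n] with ξ hξ
      rw [Real.norm_of_nonneg (by positivity)]
      exact pow_le_pow_left₀ (norm_nonneg _) hξ 2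
    · filter_upwards [hl] with ξ hξ
      have := (tendsto_iff_norm_sub_tendsto_zero.1 hξ).pow 2
      simpa using this
  have h2 : ∀ n, ∫ ξ, ‖f n ξ - g ξ‖ ^ 2 = ‖f n - g‖ ^ 2 := by
    intro n
    rw [← integral_congr_ae (f := fun ξ => ‖(f n - g) ξ‖ ^ 2)]
    · have := inner_self_eq_ofReal (f n - g)
      rw [L2.inner_def] at this
      have h3 : ∫ ξ, ⟪(f n - g) ξ, (f n - g) ξ⟫_ℂ = ((∫ ξ, ‖(f n - g) ξ‖ ^ 2 : ℝ) : ℂ) := by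
        rw [← integral_complex_ofReal]
        refine integral_congr_ae (ae_of_all _ fun ξ => ?_)
        exact inner_self_eq_ofReal _
      rw [h3] at this
      exact_mod_cast this
    · filter_upwards [Lp.coeFn_sub (f n) g] with ξ hξ
      rw [hξ, Pi.sub_apply]
  simp only [h2, integral_zero] at h1
  have h3 := (Real.continuous_sqrt.tendsto 0).comp h1
  rw [Real.sqrt_zero] at h3
  refine h3.congr fun n => ?_
  simp

theorem tendsto_mulOp {m : ℕ → BoundedContinuousFunction (E ν) ℂ}
    {m' : BoundedContinuousFunction (E ν) ℂ} {C : ℝ} (hC : ∀ n ξ, ‖m n ξ‖ ≤ C)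
    (hm : ∀ ξ, Tendsto (fun n => m n ξ) atTop (𝓝 (m' ξ))) (f : L2 ν) :
    Tendsto (fun n => mulOp (m n) f) atTop (𝓝 (mulOp m' f)) := by
  refine tendsto_L2_of_dominated (h := (2 * C : ℂ) • f) (fun n => ?_) ?_
  · filter_upwards [coeFn_mulOp (m n) f, coeFn_mulOp m' f, Lp.coeFn_smul (2 * C : ℂ) f]
      with ξ h1 h2 h3
    have h4 : ‖m' ξ‖ ≤ C := le_of_tendsto' ((hm ξ).norm) fun n => hC n ξ
    have hC0 : 0 ≤ C := (norm_nonneg _).trans h4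
    rw [h1, h2, h3, Pi.smul_apply, smul_eq_mul, ← sub_mul, norm_mul, norm_mul, norm_mul,
      Complex.norm_real, Complex.norm_two, Real.norm_of_nonneg hC0]
    refine mul_le_mul_of_nonneg_right ?_ (norm_nonneg _)
    linarith [norm_sub_le (m n ξ) (m' ξ), hC n ξ]
  · filter_upwards [ae_all_iff.2 fun n => coeFn_mulOp (m n) f, coeFn_mulOp m' f] with ξ h1 h2
    simp only [h1, h2]
    exact (hm ξ).mul_const _

/-! ### Fourier multipliers -/

/-- The Fourier transform on `L²`. -/
abbrev fourierL2 (ν : ℕ) : L2 ν ≃ₗᵢ[ℂ] L2 ν := Lp.fourierTransformₗᵢ (E ν) ℂ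

theorem mem_fourierMultiplier_domain {g : E ν → ℝ} {u h : L2 ν}
    (hh : h =ᵐ[volume] fun ξ => ((g ((2 * Real.pi) • ξ) : ℝ) : ℂ) * fourierL2 ν u ξ) :
    u ∈ (fourierMultiplier g).domain :=
  (memLp_congr_ae hh).1 (Lp.memLp h)

theorem coeFn_fourier_fourierMultiplier {g : E ν → ℝ} (u : (fourierMultiplier g).domain) :
    fourierL2 ν (fourierMultiplier g u) =ᵐ[volume]
      fun ξ => ((g ((2 * Real.pi) • ξ) : ℝ) : ℂ) * fourierL2 ν u ξ := by
  have h : fourierL2 ν (fourierMultiplier g u) = MemLp.toLp _ u.2 :=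
    (fourierL2 ν).apply_symm_apply _
  rw [h]
  exact MemLp.coeFn_toLp u.2

theorem isSymm_fourierMultiplier (g : E ν → ℝ) : IsSymm (fourierMultiplier g) := by
  intro u w
  rw [← (fourierL2 ν).inner_map_map, ← (fourierL2 ν).inner_map_map (u : L2 ν),
    inner_L2_eq, inner_L2_eq]
  refine integral_congr_ae ?_
  filter_upwards [coeFn_fourier_fourierMultiplier u, coeFn_fourier_fourierMultiplier w]
    with ξ h1 h2
  rw [h1, h2, map_mul, Complex.conj_ofReal]
  ring

/-- The function `1 / (g(2πξ) - z)`. -/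
def resolventSymbol (g : E ν → ℝ) (hg : Continuous g) (z : ℂ) (hz : z.im ≠ 0) :
    BoundedContinuousFunction (E ν) ℂ :=
  BoundedContinuousFunction.ofNormedAddCommGroup
    (fun ξ => (((g ((2 * Real.pi) • ξ) : ℝ) : ℂ) - z)⁻¹)
    (Continuous.inv₀ (by fun_prop) fun ξ h => hz (by simpa using congrArg Complex.im h)) |z.im|⁻¹
    (fun ξ => by
      rw [norm_inv]
      refine inv_anti₀ (abs_pos.2 hz) ?_
      simpa using Complex.abs_im_le_norm (((g ((2 * Real.pi) • ξ) : ℝ) : ℂ) - z))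

theorem resolventSymbol_apply (g : E ν → ℝ) (hg : Continuous g) (z : ℂ) (hz : z.im ≠ 0) (ξ : E ν) :
    resolventSymbol g hg z hz ξ = (((g ((2 * Real.pi) • ξ) : ℝ) : ℂ) - z)⁻¹ := rfl

theorem norm_resolventSymbol_le (g : E ν → ℝ) (hg : Continuous g) (z : ℂ) (hz : z.im ≠ 0)
    (ξ : E ν) : ‖resolventSymbol g hg z hz ξ‖ ≤ |z.im|⁻¹ := by
  rw [resolventSymbol_apply, norm_inv]
  refine inv_anti₀ (abs_pos.2 hz) ?_
  simpa using Complex.abs_im_le_norm (((g ((2 * Real.pi) • ξ) : ℝ) : ℂ) - z)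

theorem fourierMultiplier_surjective {g : E ν → ℝ} (hg : Continuous g) {z : ℂ} (hz : z.im ≠ 0)
    (f : L2 ν) : ∃ u : (fourierMultiplier g).domain,
      fourierMultiplier g u - z • (u : L2 ν) = f := by
  set r := mulOp (resolventSymbol g hg z hz) (fourierL2 ν f) with hr
  have h : (fourierL2 ν f + z • r : L2 ν) =ᵐ[volume] fun ξ => ((g ((2 * Real.pi) • ξ) : ℝ) : ℂ) *
      fourierL2 ν ((fourierL2 ν).symm r) ξ := by
    rw [LinearIsometryEquiv.apply_symm_apply]
    filter_upwards [Lp.coeFn_add (fourierL2 ν f) (z • r), Lp.coeFn_smul z r,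
      coeFn_mulOp (resolventSymbol g hg z hz) (fourierL2 ν f)] with ξ h1 h2 h3
    rw [h1, Pi.add_apply, h2, Pi.smul_apply, hr, h3, resolventSymbol_apply, smul_eq_mul]
    have : (((g ((2 * Real.pi) • ξ) : ℝ) : ℂ) - z) ≠ 0 :=
      fun h => hz (by simpa using congrArg Complex.im h)
    field_simp
    ring
  refine ⟨⟨_, mem_fourierMultiplier_domain h⟩, ?_⟩
  apply (fourierL2 ν).injective
  have h2 := coeFn_fourier_fourierMultiplier ⟨_, mem_fourierMultiplier_domain h⟩
  have h3 := Lp.ext (h2.trans h.symm)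
  rw [map_sub, h3, map_smul, LinearIsometryEquiv.apply_symm_apply, add_sub_cancel_right]

/-! ### The fiber Hamiltonian -/

section Hamiltonian

variable {Ω ω : E ν → ℝ} {ρ : L2 ν} {P : E ν}

/-- The free energy `Ω(P - k) + ω(k)`. -/
def energy (Ω ω : E ν → ℝ) (P k : E ν) : ℝ := Ω (P - k) + ω k

theorem hamiltonian_fst (u : (hamiltonian Ω ω ρ P).domain) :
    (hamiltonian Ω ω ρ P u).fst = ⟪ρ, (u : FiberSpace ν).snd⟫_ℂ + Ω P * (u : FiberSpace ν).fst :=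
  rfl

theorem hamiltonian_snd (u : (hamiltonian Ω ω ρ P).domain) :
    (hamiltonian Ω ω ρ P u).snd = (u : FiberSpace ν).fst • ρ +
      fourierMultiplier (energy Ω ω P) ⟨(u : FiberSpace ν).snd, u.2⟩ :=
  rfl

theorem fiber_inner (u w : FiberSpace ν) : ⟪u, w⟫_ℂ = conj u.fst * w.fst + ⟪u.snd, w.snd⟫_ℂ := by
  rw [WithLp.prod_inner_apply]
  congr 1
  simp [mul_comm]

theorem isSymm_hamiltonian : IsSymm (hamiltonian Ω ω ρ P) := by
  intro u w
  have h := isSymm_fourierMultiplier (energy Ω ω P) ⟨(u : FiberSpace ν).snd, u.2⟩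
    ⟨(w : FiberSpace ν).snd, w.2⟩
  simp only [fiber_inner, hamiltonian_fst, hamiltonian_snd, inner_add_left, inner_add_right,
    inner_smul_left, inner_smul_right, map_add, map_mul, Complex.conj_ofReal, inner_conj_symm] at h ⊢
  rw [h]
  ring

/-- Schur complement. With `y = (E - z)⁻¹ρ` and `v = (E - z)⁻¹f₁`, the second row forces the second
component `v - x y`. The first row becomes a scalar equation for `x`. -/
theorem hamiltonian_surjective (hE : Continuous (energy Ω ω P)) {z : ℂ} (hz : z.im ≠ 0)
    (f : FiberSpace ν) : ∃ u : (hamiltonian Ω ω ρ P).domain,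
      hamiltonian Ω ω ρ P u - z • (u : FiberSpace ν) = f := by
  obtain ⟨y, hy⟩ := fourierMultiplier_surjective hE hz ρ
  obtain ⟨v, hv⟩ := fourierMultiplier_surjective hE hz f.snd
  -- The imaginary part of this scalar is `-(Im z)(1 + ‖y‖²)`.
  have hD : (Ω P : ℂ) - z - ⟪ρ, (y : L2 ν)⟫_ℂ ≠ 0 := by
    have h1 := (isSymm_fourierMultiplier (energy Ω ω P)).im_inner_eq_zero y
    have h2 : (⟪ρ, (y : L2 ν)⟫_ℂ).im = z.im * ‖(y : L2 ν)‖ ^ 2 := by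
      nth_rewrite 1 [← hy]
      rw [inner_sub_left, inner_smul_left, inner_self_eq_ofReal,
        isSymm_fourierMultiplier (energy Ω ω P) y y, Complex.sub_im, h1, Complex.im_mul_ofReal,
        Complex.conj_im]
      ring
    intro h
    have h3 := congrArg Complex.im h
    simp only [Complex.sub_im, Complex.ofReal_im, h2, Complex.zero_im] at h3
    have : z.im * (1 + ‖(y : L2 ν)‖ ^ 2) = 0 := by linarith
    rcases mul_eq_zero.1 this with h4 | h4
    · exact hz h4
    · nlinarith [sq_nonneg ‖(y : L2 ν)‖]
  set x : ℂ := (f.fst - ⟪ρ, (v : L2 ν)⟫_ℂ) / ((Ω P : ℂ) - z - ⟪ρ, (y : L2 ν)⟫_ℂ) with hx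
  have hx' : x * ((Ω P : ℂ) - z - ⟪ρ, (y : L2 ν)⟫_ℂ) = f.fst - ⟪ρ, (v : L2 ν)⟫_ℂ :=
    div_mul_cancel₀ _ hD
  have hmem : WithLp.toLp 2 (x, ((v - x • y : (fourierMultiplier (energy Ω ω P)).domain) : L2 ν)) ∈
      (hamiltonian Ω ω ρ P).domain := (v - x • y).2
  refine ⟨⟨_, hmem⟩, ?_⟩
  have e1 : (hamiltonian Ω ω ρ P ⟨_, hmem⟩ - z • (WithLp.toLp 2 (x, ((v - x • y :
      (fourierMultiplier (energy Ω ω P)).domain) : L2 ν)))).fst = f.fst := by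
    rw [WithLp.sub_fst, hamiltonian_fst, WithLp.smul_fst]
    change ⟪ρ, (v : L2 ν) - x • (y : L2 ν)⟫_ℂ + Ω P * x - z * x = f.fst
    rw [inner_sub_right, inner_smul_right]
    linear_combination hx'
  have e2 : (hamiltonian Ω ω ρ P ⟨_, hmem⟩ - z • (WithLp.toLp 2 (x, ((v - x • y :
      (fourierMultiplier (energy Ω ω P)).domain) : L2 ν)))).snd = f.snd := by
    rw [WithLp.sub_snd, hamiltonian_snd, WithLp.smul_snd]
    change x • ρ + fourierMultiplier (energy Ω ω P) (v - x • y) - z • ((v : L2 ν) - x • (y : L2 ν))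
      = f.snd
    rw [LinearPMap.map_sub, LinearPMap.map_smul, ← hv]
    nth_rewrite 1 [← hy]
    module
  exact congrArg (WithLp.toLp 2) (Prod.ext e1 e2)

theorem exists_isResolventAt_hamiltonian (hE : Continuous (energy Ω ω P)) {z : ℂ} (hz : z.im ≠ 0) :
    ∃ R, IsResolventAt (hamiltonian Ω ω ρ P) z R :=
  isSymm_hamiltonian.exists_isResolventAt hz (hamiltonian_surjective hE hz)

end Hamiltonian

/-! ### The conjugate operator on the Fourier side -/

/-- The components of a vector field in the frequency variable `ξ`, `k = 2πξ`. -/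
def component (v : E ν → E ν) (j : Fin ν) (ξ : E ν) : ℝ := v ((2 * Real.pi) • ξ) j

/-- The `j`-th partial derivative. -/
def partialDeriv {F : Type*} [NormedAddCommGroup F] [NormedSpace ℝ F] (j : Fin ν) (f : E ν → F)
    (ξ : E ν) : F :=
  fderiv ℝ f ξ (EuclideanSpace.single j 1)

/-- Smooth vector fields of temperate growth with bounded derivative. -/
structure IsAdmissibleField (v : E ν → E ν) : Prop where
  temperate : ∀ j, (component v j).HasTemperateGrowth
  bounded_deriv : ∃ C : ℝ, ∀ j ξ, |partialDeriv j (component v j) ξ| ≤ C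

theorem IsAdmissibleField.temperate_complex {v : E ν → E ν} (hv : IsAdmissibleField v) (j : Fin ν) :
    (fun ξ => (component v j ξ : ℂ)).HasTemperateGrowth := by
  have := hv.temperate j
  fun_prop

theorem IsAdmissibleField.differentiable {v : E ν → E ν} (hv : IsAdmissibleField v) (j : Fin ν) :
    Differentiable ℝ (component v j) :=
  (hv.temperate j).1.differentiable (by simp)

theorem IsAdmissibleField.continuous_component {v : E ν → E ν} (hv : IsAdmissibleField v)
    (j : Fin ν) : Continuous (component v j) := (hv.differentiable j).continuous

theorem continuous_partialDeriv {F : Type*} [NormedAddCommGroup F] [NormedSpace ℝ F] {f : E ν → F}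
    (hf : ContDiff ℝ 1 f) (j : Fin ν) : Continuous (partialDeriv j f) :=
  (hf.continuous_fderiv one_ne_zero).clm_apply continuous_const

theorem IsAdmissibleField.continuous_partialDeriv {v : E ν → E ν} (hv : IsAdmissibleField v)
    (j : Fin ν) : Continuous (partialDeriv j (component v j)) :=
  Nelson.continuous_partialDeriv ((hv.temperate j).1.of_le (by exact_mod_cast le_top)) j

theorem partialDeriv_conj {f : E ν → ℂ} (hf : Differentiable ℝ f) (j : Fin ν) (ξ : E ν) :
    fderiv ℝ (fun ξ => conj (f ξ)) ξ (EuclideanSpace.single j 1) = conj (partialDeriv j f ξ) := by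
  have h := (Complex.conjCLE.toContinuousLinearMap.hasFDerivAt (x := f ξ)).comp ξ
    (hf ξ).hasFDerivAt
  have h2 : HasFDerivAt (fun ξ => conj (f ξ))
    (Complex.conjCLE.toContinuousLinearMap.comp (fderiv ℝ f ξ)) ξ := h
  rw [h2.fderiv]
  rfl

theorem partialDeriv_ofReal_mul {f : E ν → ℝ} {g : E ν → ℂ} {ξ : E ν}
    (hf : DifferentiableAt ℝ f ξ) (hg : DifferentiableAt ℝ g ξ) (j : Fin ν) :
    partialDeriv j (fun ξ => (f ξ : ℂ) * g ξ) ξ =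
      ((partialDeriv j f ξ : ℝ) : ℂ) * g ξ + (f ξ : ℂ) * partialDeriv j g ξ := by
  have h1 : HasFDerivAt (fun ξ => (f ξ : ℂ)) (Complex.ofRealCLM.comp (fderiv ℝ f ξ)) ξ :=
    (Complex.ofRealCLM.hasFDerivAt (x := f ξ)).comp ξ hf.hasFDerivAt
  have h2 : HasFDerivAt (fun ξ => (f ξ : ℂ) * g ξ) _ ξ := h1.mul hg.hasFDerivAt
  rw [partialDeriv, h2.fderiv]
  simp [partialDeriv]
  ring

/-- Multiplication of a Schwartz function by the `j`-th component of a field. -/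
def componentMul (v : E ν → E ν) (j : Fin ν) : 𝓢(E ν, ℂ) →L[ℂ] 𝓢(E ν, ℂ) :=
  SchwartzMap.smulLeftCLM ℂ fun ξ => (component v j ξ : ℂ)

theorem componentMul_apply {v : E ν → E ν} (hv : IsAdmissibleField v) (j : Fin ν)
    (φ : 𝓢(E ν, ℂ)) : (componentMul v j φ : E ν → ℂ) = fun ξ => (component v j ξ : ℂ) * φ ξ :=
  SchwartzMap.smulLeftCLM_apply (hv.temperate_complex j) φ

/-- The Fourier transform of Schwartz functions. -/
abbrev fourierS (u : 𝓢(E ν, ℂ)) : 𝓢(E ν, ℂ) := 𝓕 u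

open LineDeriv in
theorem fourier_coordinate_mul (j : Fin ν) (u : 𝓢(E ν, ℂ)) :
    fourierS (SchwartzMap.smulLeftCLM ℂ (fun x : E ν => ((x j : ℝ) : ℂ)) u) =
      (Complex.I / (2 * Real.pi)) • ∂_{(EuclideanSpace.single j 1 : E ν)} (fourierS u) := by
  rw [fourierS, SchwartzMap.lineDerivOp_fourier_eq, FourierTransform.fourier_smul, smul_smul]
  have h1 : (fun x : E ν => inner ℝ x (EuclideanSpace.single j (1 : ℝ))) = fun x => x j := by
    ext x
    simp [EuclideanSpace.inner_single_right]
  have h2 : (fun x : E ν => x j).HasTemperateGrowth := by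
    rw [← h1]
    fun_prop
  have h3 := SchwartzMap.smulLeftCLM_ofReal ℂ h2 u
  have h4 : Complex.I / (2 * Real.pi) * -(2 * Real.pi * Complex.I) = 1 := by
    have : (Real.pi : ℂ) ≠ 0 := by exact_mod_cast Real.pi_ne_zero
    field_simp
    simp
  rw [h1, h4, one_smul]
  exact congrArg _ h3

theorem partialDeriv_componentMul {v : E ν → E ν} (hv : IsAdmissibleField v) (j : Fin ν)
    (φ : 𝓢(E ν, ℂ)) (ξ : E ν) : partialDeriv j (componentMul v j φ) ξ =
      ((partialDeriv j (component v j) ξ : ℝ) : ℂ) * φ ξ + component v j ξ * partialDeriv j φ ξ := by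
  rw [componentMul_apply hv]
  exact partialDeriv_ofReal_mul (hv.differentiable j ξ) φ.differentiableAt j

open LineDeriv in
theorem fourier_conjugateSchwartz_eq (v : E ν → E ν) (u : 𝓢(E ν, ℂ)) :
    fourierS (conjugateSchwartz v u) = (1 / 2 : ℂ) • ∑ j, (Complex.I / (2 * Real.pi)) •
      (componentMul v j (∂_{(EuclideanSpace.single j 1 : E ν)} (fourierS u)) +
        ∂_{(EuclideanSpace.single j 1 : E ν)} (componentMul v j (fourierS u))) := by
  rw [fourierS, conjugateSchwartz, smul_apply, FourierTransform.fourier_smul]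
  congr 1
  rw [← FourierTransform.fourierCLM_apply (R := ℂ)]
  rw [sum_apply, map_sum]
  refine Finset.sum_congr rfl fun j _ => ?_
  rw [add_apply, map_add, smul_add]
  congr 1
  · change fourierS (SchwartzMap.fourierMultiplierCLM ℂ (fun ξ => (component v j ξ : ℂ))
      (SchwartzMap.smulLeftCLM ℂ (fun x : E ν => ((x j : ℝ) : ℂ)) u)) = _
    rw [fourierS, SchwartzMap.fourierMultiplierCLM_apply, FourierTransform.fourier_fourierInv_eq,
      ← fourierS, fourier_coordinate_mul, map_smul]
    rfl
  · change fourierS (SchwartzMap.smulLeftCLM ℂ (fun x : E ν => ((x j : ℝ) : ℂ))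
      (SchwartzMap.fourierMultiplierCLM ℂ (fun ξ => (component v j ξ : ℂ)) u)) = _
    rw [fourier_coordinate_mul, SchwartzMap.fourierMultiplierCLM_apply, fourierS,
      FourierTransform.fourier_fourierInv_eq]
    rfl

/-- The expression `-(2π)⁻¹ (v·∇φ + ½ (div v) φ)`, that is `i a` on the Fourier side. -/
def transport (v : E ν → E ν) (φ : E ν → ℂ) (ξ : E ν) : ℂ :=
  -(1 / (4 * Real.pi)) * ∑ j, (2 * component v j ξ * partialDeriv j φ ξ +
    partialDeriv j (component v j) ξ * φ ξ)

/-- Position acts as `(i/2π)∂` on the Fourier side, which gives the factor `i · ½ · i/(2π) =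
-1/(4π)`. The product rule for `∂_j(v_j φ)` doubles the transport term and adds the divergence. -/
theorem I_mul_fourier_conjugateSchwartz {v : E ν → E ν} (hv : IsAdmissibleField v) (u : 𝓢(E ν, ℂ))
    (ξ : E ν) : Complex.I * fourierS (conjugateSchwartz v u) ξ = transport v (fourierS u) ξ := by
  rw [fourier_conjugateSchwartz_eq, transport, smul_apply, sum_apply,
    smul_eq_mul, Finset.mul_sum, Finset.mul_sum, Finset.mul_sum]
  refine Finset.sum_congr rfl fun j _ => ?_
  rw [smul_apply, add_apply, SchwartzMap.lineDerivOp_apply_eq_fderiv]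
  change Complex.I * (1 / 2 * (_ • (_ + partialDeriv j (componentMul v j (fourierS u)) ξ))) = _
  rw [partialDeriv_componentMul hv, componentMul_apply hv]
  change Complex.I * (1 / 2 * (Complex.I / (2 * Real.pi) *
    (component v j ξ * partialDeriv j (fourierS u) ξ + _))) = _
  have : (Real.pi : ℂ) ≠ 0 := by exact_mod_cast Real.pi_ne_zero
  field_simp
  rw [Complex.I_sq]
  ring

/-- Integration by parts against a Schwartz function. -/
theorem integral_partialDeriv_conj_mul {r : E ν → ℂ} (hr : ContDiff ℝ 1 r) (hr2 : MemLp r 2 volume)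
    (ψ : 𝓢(E ν, ℂ)) (j : Fin ν)
    (hi : Integrable (fun ξ => conj (partialDeriv j r ξ) * ψ ξ) volume) :
    Integrable (fun ξ => conj (r ξ) * partialDeriv j ψ ξ + conj (partialDeriv j r ξ) * ψ ξ) volume ∧
    ∫ ξ, (conj (r ξ) * partialDeriv j ψ ξ + conj (partialDeriv j r ξ) * ψ ξ) = 0 := by
  have hc : MemLp (fun ξ => conj (r ξ)) 2 volume := hr2.star
  have hd : Differentiable ℝ r := hr.differentiable one_ne_zero
  have h1 : Integrable (fun ξ => conj (r ξ) * partialDeriv j ψ ξ) volume := by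
    refine hc.integrable_mul (q := 2) ?_
    exact (LineDeriv.lineDerivOp (EuclideanSpace.single j 1 : E ν) ψ).memLp 2 volume
  have h2 : Integrable (fun ξ => conj (r ξ) * ψ ξ) volume := hc.integrable_mul (ψ.memLp 2 volume)
  refine ⟨h1.add hi, ?_⟩
  rw [integral_add h1 hi]
  have hdc : Differentiable ℝ fun ξ => conj (r ξ) :=
    Complex.conjCLE.toContinuousLinearMap.differentiable.comp hd
  have h3 := integral_mul_fderiv_eq_neg_fderiv_mul_of_integrable (μ := (volume : Measure (E ν)))
    (f := fun ξ => conj (r ξ)) (g := ψ) (v := EuclideanSpace.single j 1)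
    (by simpa only [partialDeriv_conj hd] using hi) h1 h2 (fun ξ _ => hdc ξ)
    (fun ξ _ => ψ.differentiableAt)
  simp only [partialDeriv_conj hd] at h3
  change (∫ ξ, conj (r ξ) * fderiv ℝ ψ ξ (EuclideanSpace.single j 1)) + _ = 0
  rw [h3]
  change -(∫ ξ, conj (partialDeriv j r ξ) * ψ ξ) + _ = 0
  rw [neg_add_cancel]

theorem coeFn_fourier_schwartzToL2 (u : 𝓢(E ν, ℂ)) :
    fourierL2 ν (schwartzToL2 ν u) =ᵐ[volume] fourierS u := by
  have h : fourierL2 ν (schwartzToL2 ν u) = (fourierS u).toLp 2 := SchwartzMap.toLp_fourier_eq u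
  rw [h]
  exact (fourierS u).coeFn_toLp 2

theorem coeFn_fourier_I_smul_conjugate {v : E ν → E ν} (hv : IsAdmissibleField v) (u : 𝓢(E ν, ℂ)) :
    fourierL2 ν (Complex.I • schwartzToL2 ν (conjugateSchwartz v u)) =ᵐ[volume]
      transport v (fourierS u) := by
  rw [map_smul]
  filter_upwards [Lp.coeFn_smul Complex.I (fourierL2 ν (schwartzToL2 ν (conjugateSchwartz v u))),
    coeFn_fourier_schwartzToL2 (conjugateSchwartz v u)] with ξ h1 h2
  rw [h1, Pi.smul_apply, h2, smul_eq_mul, I_mul_fourier_conjugateSchwartz hv]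

/-- Antisymmetry of `i a` against a function that is only `C¹`, as needed both for the transform of
`ρ` and for products `G φ̂`. The sum of the two integrands is `-(2π)⁻¹ ∑ ∂_j(r̄ v_j û)`, which
integrates to zero. -/
theorem inner_fourier_I_smul_conjugateSchwartz {v : E ν → E ν} (hv : IsAdmissibleField v)
    {r : E ν → ℂ} (hr : ContDiff ℝ 1 r)
    (hrd : ∀ j, MemLp (fun ξ => (component v j ξ : ℂ) * partialDeriv j r ξ) 2 volume)
    {f h : L2 ν} (hf : f =ᵐ[volume] r) (hh : h =ᵐ[volume] transport v r) (u : 𝓢(E ν, ℂ)) :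
    ⟪f, fourierL2 ν (Complex.I • schwartzToL2 ν (conjugateSchwartz v u))⟫_ℂ =
      -⟪h, fourierL2 ν (schwartzToL2 ν u)⟫_ℂ := by
  have hr2 : MemLp r 2 volume := (memLp_congr_ae hf).1 (Lp.memLp f)
  have hI : ∀ j, Integrable (fun ξ => conj (partialDeriv j r ξ) * componentMul v j (fourierS u) ξ)
      volume := by
    intro j
    have := (hrd j).star.integrable_mul ((fourierS u).memLp 2 volume)
    refine this.congr (ae_of_all _ fun ξ => ?_)
    simp only [componentMul_apply hv, Pi.mul_apply, Pi.star_apply, star_mul',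
      RCLike.star_def, Complex.conj_ofReal]
    ring
  have key := fun j => integral_partialDeriv_conj_mul hr hr2 (componentMul v j (fourierS u)) j (hI j)
  rw [eq_neg_iff_add_eq_zero, L2.inner_def, L2.inner_def,
    ← integral_add (L2.integrable_inner _ _) (L2.integrable_inner _ _)]
  have : ∀ᵐ ξ, ⟪f ξ, fourierL2 ν (Complex.I • schwartzToL2 ν (conjugateSchwartz v u)) ξ⟫_ℂ +
      ⟪h ξ, fourierL2 ν (schwartzToL2 ν u) ξ⟫_ℂ = ∑ j, (-(1 / (2 * Real.pi)) : ℂ) *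
      (conj (r ξ) * partialDeriv j (componentMul v j (fourierS u)) ξ +
        conj (partialDeriv j r ξ) * componentMul v j (fourierS u) ξ) := by
    filter_upwards [hf, hh, coeFn_fourier_I_smul_conjugate hv u, coeFn_fourier_schwartzToL2 u]
      with ξ h1 h2 h3 h4
    rw [h1, h2, h3, h4, transport, transport]
    simp only [RCLike.inner_apply, map_mul, map_sum, map_add, map_neg, map_div₀, map_one,
      Complex.conj_ofReal, Finset.mul_sum, Finset.sum_mul, map_ofNat]
    rw [← Finset.sum_add_distrib]
    refine Finset.sum_congr rfl fun j _ => ?_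
    rw [partialDeriv_componentMul hv, componentMul_apply hv]
    have : (Real.pi : ℂ) ≠ 0 := by exact_mod_cast Real.pi_ne_zero
    field_simp
    ring
  rw [integral_congr_ae this, integral_finsetSum _ fun j _ => (key j).1.const_mul _]
  refine Finset.sum_eq_zero fun j _ => ?_
  rw [integral_const_mul, (key j).2, mul_zero]

/-! ### Closability and the closure -/

/-- The operator `½ (v(D_x)·x + x·v(D_x))` on the Schwartz functions in `L²`. -/
def conjugateCore (v : E ν → E ν) : L2 ν →ₗ.[ℂ] L2 ν :=
  { domain := LinearMap.range (schwartzToL2 ν)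
    toFun := schwartzToL2 ν ∘ₗ (conjugateSchwartz v).toLinearMap ∘ₗ
      (LinearEquiv.ofInjective (schwartzToL2 ν) (schwartzToL2_injective ν)).symm.toLinearMap }

theorem mem_graph_conjugateCore {v : E ν → E ν} {p : L2 ν × L2 ν} :
    p ∈ (conjugateCore v).graph ↔
      ∃ u : 𝓢(E ν, ℂ), p = (schwartzToL2 ν u, schwartzToL2 ν (conjugateSchwartz v u)) := by
  have key : ∀ (u : 𝓢(E ν, ℂ)), conjugateCore v ⟨schwartzToL2 ν u, ⟨u, rfl⟩⟩ =
      schwartzToL2 ν (conjugateSchwartz v u) := by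
    intro u
    change schwartzToL2 ν (conjugateSchwartz v ((LinearEquiv.ofInjective (schwartzToL2 ν)
      (schwartzToL2_injective ν)).symm (LinearEquiv.ofInjective (schwartzToL2 ν)
      (schwartzToL2_injective ν) u))) = _
    rw [LinearEquiv.symm_apply_apply]
  rw [LinearPMap.mem_graph_iff]
  constructor
  · rintro ⟨⟨_, u, rfl⟩, h1, h2⟩
    refine ⟨u, Prod.ext h1.symm ?_⟩
    rw [← h2, key]
  · rintro ⟨u, rfl⟩
    exact ⟨⟨_, u, rfl⟩, rfl, key u⟩

theorem dense_range_schwartzToL2 (ν : ℕ) : DenseRange (schwartzToL2 ν) :=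
  SchwartzMap.denseRange_toLpCLM (F := ℂ) (p := 2) (μ := (volume : Measure (E ν))) (by simp)

/-- Both sides are continuous in `p`, so the identity passes from the graph of the core to its
closure. -/
theorem inner_I_smul_of_mem_closure {v : E ν → E ν} {f h : L2 ν}
    (hfh : ∀ u : 𝓢(E ν, ℂ),
      ⟪f, fourierL2 ν (Complex.I • schwartzToL2 ν (conjugateSchwartz v u))⟫_ℂ =
      -⟪h, fourierL2 ν (schwartzToL2 ν u)⟫_ℂ) {p : L2 ν × L2 ν}
    (hp : p ∈ (conjugateCore v).graph.topologicalClosure) :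
    ⟪f, fourierL2 ν (Complex.I • p.2)⟫_ℂ = -⟪h, fourierL2 ν p.1⟫_ℂ := by
  have hc : IsClosed {p : L2 ν × L2 ν |
      ⟪f, fourierL2 ν (Complex.I • p.2)⟫_ℂ = -⟪h, fourierL2 ν p.1⟫_ℂ} :=
    isClosed_eq (by fun_prop) (by fun_prop)
  refine closure_minimal (fun q hq => ?_) hc hp
  obtain ⟨u, rfl⟩ := mem_graph_conjugateCore.1 hq
  exact hfh u

theorem memLp_component_mul_partialDeriv {v : E ν → E ν} (hv : IsAdmissibleField v) (j : Fin ν)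
    (φ : 𝓢(E ν, ℂ)) : MemLp (fun ξ => (component v j ξ : ℂ) * partialDeriv j φ ξ) 2 volume := by
  have := (componentMul v j
    (LineDeriv.lineDerivOp (EuclideanSpace.single j 1 : E ν) φ)).memLp 2 volume
  rw [componentMul_apply hv] at this
  exact this

theorem inner_conjugateSchwartz_symm {v : E ν → E ν} (hv : IsAdmissibleField v)
    (w u : 𝓢(E ν, ℂ)) :
    ⟪fourierL2 ν (schwartzToL2 ν w),
      fourierL2 ν (Complex.I • schwartzToL2 ν (conjugateSchwartz v u))⟫_ℂ =
    -⟪fourierL2 ν (Complex.I • schwartzToL2 ν (conjugateSchwartz v w)),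
      fourierL2 ν (schwartzToL2 ν u)⟫_ℂ :=
  inner_fourier_I_smul_conjugateSchwartz hv ((fourierS w).smooth 1)
    (fun j => memLp_component_mul_partialDeriv hv j (fourierS w)) (coeFn_fourier_schwartzToL2 w)
    (coeFn_fourier_I_smul_conjugate hv w) u

/-- A densely defined symmetric operator is closable: if `(0, p.2)` is a limit of graph points,
symmetry makes `p.2` orthogonal to all Schwartz functions. This matters because `LinearPMap.closure`
returns the operator unchanged when it is not closable. -/
theorem isClosable_conjugateCore {v : E ν → E ν} (hv : IsAdmissibleField v) :
    (conjugateCore v).IsClosable := by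
  refine ⟨(conjugateCore v).graph.topologicalClosure.toLinearPMap, ?_⟩
  rw [Submodule.toLinearPMap_graph_eq]
  intro p hp hp0
  have h : ∀ w : 𝓢(E ν, ℂ), ⟪schwartzToL2 ν w, p.2⟫_ℂ = 0 := by
    intro w
    have := inner_I_smul_of_mem_closure (inner_conjugateSchwartz_symm hv w) hp
    rw [hp0, map_zero, inner_zero_right, neg_zero, LinearIsometryEquiv.inner_map_map,
      inner_smul_right] at this
    exact (mul_eq_zero.1 this).resolve_left Complex.I_ne_zero
  have hc : (fun x : L2 ν => ⟪x, p.2⟫_ℂ) = fun _ => 0 := by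
    refine (dense_range_schwartzToL2 ν).equalizer (by fun_prop) continuous_const ?_
    ext w
    exact h w
  exact inner_self_eq_zero.1 (congrFun hc p.2)

theorem mem_closure_graph {v : E ν → E ν} (hv : IsAdmissibleField v)
    (u : (conjugateOneParticle v).domain) :
    ((u : L2 ν), conjugateOneParticle v u) ∈ (conjugateCore v).graph.topologicalClosure := by
  rw [(isClosable_conjugateCore hv).graph_closure_eq_closure_graph]
  exact LinearPMap.mem_graph _ u

theorem schwartzToL2_mem_domain (v : E ν → E ν) (u : 𝓢(E ν, ℂ)) :
    schwartzToL2 ν u ∈ (conjugateOneParticle v).domain :=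
  (LinearPMap.le_closure (conjugateCore v)).1 ⟨u, rfl⟩

theorem inner_fourier_I_smul_conjugateOneParticle {v : E ν → E ν} (hv : IsAdmissibleField v)
    {r : E ν → ℂ} (hr : ContDiff ℝ 1 r)
    (hrd : ∀ j, MemLp (fun ξ => (component v j ξ : ℂ) * partialDeriv j r ξ) 2 volume)
    {f h : L2 ν} (hf : f =ᵐ[volume] r) (hh : h =ᵐ[volume] transport v r)
    (u : (conjugateOneParticle v).domain) :
    ⟪f, fourierL2 ν (Complex.I • conjugateOneParticle v u)⟫_ℂ = -⟪h, fourierL2 ν u⟫_ℂ :=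
  inner_I_smul_of_mem_closure (inner_fourier_I_smul_conjugateSchwartz hv hr hrd hf hh)
    (mem_closure_graph hv u)

/-! ### Commutators with bounded Fourier multipliers -/

/-- The commutator of `i a` with a bounded function `G(D_x)`, on Schwartz functions. -/
theorem commutator_mulOp_schwartz {v : E ν → E ν} (hv : IsAdmissibleField v) {G : E ν → ℝ}
    (hG : ContDiff ℝ 1 G) {C : ℝ} (hGd : ∀ j ξ, |partialDeriv j G ξ| ≤ C)
    {g q : BoundedContinuousFunction (E ν) ℂ} (hg : ∀ ξ, g ξ = G ξ)
    (hq : ∀ ξ, q ξ =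
      (1 / (2 * Real.pi)) * ∑ j, (component v j ξ : ℂ) * ((partialDeriv j G ξ : ℝ) : ℂ))
    (φ : 𝓢(E ν, ℂ)) (w : (conjugateOneParticle v).domain) :
    ⟪mulOp g (fourierL2 ν (schwartzToL2 ν φ)),
        fourierL2 ν (Complex.I • conjugateOneParticle v w)⟫_ℂ +
      ⟪mulOp g (fourierL2 ν (Complex.I • schwartzToL2 ν (conjugateSchwartz v φ))),
        fourierL2 ν w⟫_ℂ =
    ⟪mulOp q (fourierL2 ν (schwartzToL2 ν φ)), fourierL2 ν w⟫_ℂ := by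
  have hGdiff : Differentiable ℝ G := hG.differentiable one_ne_zero
  have hpd : ∀ j ξ, partialDeriv j (fun ξ => (G ξ : ℂ) * fourierS φ ξ) ξ =
      ((partialDeriv j G ξ : ℝ) : ℂ) * fourierS φ ξ + (G ξ : ℂ) * partialDeriv j (fourierS φ) ξ := fun j ξ =>
    partialDeriv_ofReal_mul (hGdiff ξ) (fourierS φ).differentiableAt j
  -- Antisymmetry is applied to `r = G φ̂`. By the product rule, transport of `G φ̂` is `G` times
  -- transport of `φ̂`, minus `(2π)⁻¹ (v·∇G) φ̂`; the last term is the commutator.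
  have h1 := inner_fourier_I_smul_conjugateOneParticle hv
    (r := fun ξ => (G ξ : ℂ) * fourierS φ ξ)
    (f := mulOp g (fourierL2 ν (schwartzToL2 ν φ)))
    (h := mulOp g (fourierL2 ν (Complex.I • schwartzToL2 ν (conjugateSchwartz v φ))) -
      mulOp q (fourierL2 ν (schwartzToL2 ν φ)))
    ((Complex.ofRealCLM.contDiff.comp hG).mul ((fourierS φ).smooth 1)) ?_ ?_ ?_ w
  · rw [h1, inner_sub_left]
    ring
  · intro j
    have e1 : MemLp (fun ξ => ((partialDeriv j G ξ : ℝ) : ℂ) * componentMul v j (fourierS φ) ξ) 2 volume := by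
      refine ((componentMul v j (fourierS φ)).memLp 2 volume).of_le_mul (c := C)
        (((Complex.continuous_ofReal.comp (continuous_partialDeriv hG j)).mul
          (componentMul v j (fourierS φ)).continuous).aestronglyMeasurable) (ae_of_all _ fun ξ => ?_)
      rw [norm_mul, Complex.norm_real]
      exact mul_le_mul_of_nonneg_right (hGd j ξ) (norm_nonneg _)
    have e2 : MemLp (fun ξ => g ξ * ((component v j ξ : ℂ) * partialDeriv j (fourierS φ) ξ)) 2 volume := by
      have h := memLp_component_mul_partialDeriv hv j (fourierS φ)
      refine h.of_le_mul (c := ‖g‖) (g.continuous.aestronglyMeasurable.mul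
        h.aestronglyMeasurable) (ae_of_all _ fun ξ => ?_)
      rw [norm_mul]
      exact mul_le_mul_of_nonneg_right (g.norm_coe_le_norm ξ) (norm_nonneg _)
    refine (memLp_congr_ae (ae_of_all _ fun ξ => ?_)).1 (e1.add e2)
    simp only [Pi.add_apply, hpd, hg, componentMul_apply hv]
    ring
  · filter_upwards [coeFn_mulOp g (fourierL2 ν (schwartzToL2 ν φ)), coeFn_fourier_schwartzToL2 φ]
      with ξ h1 h2
    rw [h1, h2, hg]
  · filter_upwards [coeFn_mulOp g (fourierL2 ν (Complex.I • schwartzToL2 ν (conjugateSchwartz v φ))),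
      coeFn_mulOp q (fourierL2 ν (schwartzToL2 ν φ)), coeFn_fourier_schwartzToL2 φ,
      coeFn_fourier_I_smul_conjugate hv φ, Lp.coeFn_sub (mulOp g (fourierL2 ν
        (Complex.I • schwartzToL2 ν (conjugateSchwartz v φ))))
        (mulOp q (fourierL2 ν (schwartzToL2 ν φ)))] with ξ h1 h2 h3 h4 h5
    rw [h5, Pi.sub_apply, h1, h2, h3, h4, hg, hq, transport, transport]
    simp only [hpd, Finset.mul_sum, Finset.sum_mul]
    rw [← Finset.sum_sub_distrib]
    refine Finset.sum_congr rfl fun j _ => ?_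
    have : (Real.pi : ℂ) ≠ 0 := by exact_mod_cast Real.pi_ne_zero
    field_simp
    ring

theorem inner_add_inner_of_mem_closure {v : E ν → E ν} {M N : L2 ν →L[ℂ] L2 ν} {x y : L2 ν}
    (h : ∀ φ : 𝓢(E ν, ℂ), ⟪M (fourierL2 ν (schwartzToL2 ν φ)), fourierL2 ν y⟫_ℂ +
        ⟪M (fourierL2 ν (Complex.I • schwartzToL2 ν (conjugateSchwartz v φ))), fourierL2 ν x⟫_ℂ =
      ⟪N (fourierL2 ν (schwartzToL2 ν φ)), fourierL2 ν x⟫_ℂ) {p : L2 ν × L2 ν}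
    (hp : p ∈ (conjugateCore v).graph.topologicalClosure) :
    ⟪M (fourierL2 ν p.1), fourierL2 ν y⟫_ℂ + ⟪M (fourierL2 ν (Complex.I • p.2)), fourierL2 ν x⟫_ℂ =
      ⟪N (fourierL2 ν p.1), fourierL2 ν x⟫_ℂ := by
  have hc : IsClosed {p : L2 ν × L2 ν | ⟪M (fourierL2 ν p.1), fourierL2 ν y⟫_ℂ +
      ⟪M (fourierL2 ν (Complex.I • p.2)), fourierL2 ν x⟫_ℂ =
      ⟪N (fourierL2 ν p.1), fourierL2 ν x⟫_ℂ} :=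
    isClosed_eq (by fun_prop) (by fun_prop)
  refine closure_minimal (fun q hq => ?_) hc hp
  obtain ⟨φ, rfl⟩ := mem_graph_conjugateCore.1 hq
  exact h φ

/-- The commutator of `i a` with a bounded function `G(D_x)`. -/
theorem commutator_mulOp {v : E ν → E ν} (hv : IsAdmissibleField v) {G : E ν → ℝ}
    (hG : ContDiff ℝ 1 G) {C : ℝ} (hGd : ∀ j ξ, |partialDeriv j G ξ| ≤ C)
    {g q : BoundedContinuousFunction (E ν) ℂ} (hg : ∀ ξ, g ξ = G ξ)
    (hq : ∀ ξ, q ξ = (1 / (2 * Real.pi)) * ∑ j, (component v j ξ : ℂ) *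
      ((partialDeriv j G ξ : ℝ) : ℂ))
    (u w : (conjugateOneParticle v).domain) :
    ⟪mulOp g (fourierL2 ν u), fourierL2 ν (Complex.I • conjugateOneParticle v w)⟫_ℂ +
      ⟪fourierL2 ν (Complex.I • conjugateOneParticle v u), mulOp g (fourierL2 ν w)⟫_ℂ =
    ⟪fourierL2 ν u, mulOp q (fourierL2 ν w)⟫_ℂ := by
  have key := fun φ => commutator_mulOp_schwartz hv hG hGd hg hq φ w
  have gself : ∀ ξ, g ξ = conj (g ξ) := fun ξ => by rw [hg, Complex.conj_ofReal]
  have qself : ∀ ξ, q ξ = conj (q ξ) := fun ξ => by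
    rw [hq]
    simp only [map_mul, map_sum, map_div₀, map_one, map_ofNat, Complex.conj_ofReal]
  -- The real symbols are moved to the left argument, where the closure argument for `u` applies.
  rw [← inner_mulOp_left g g gself, ← inner_mulOp_left q q qself]
  have hu := mem_closure_graph hv u
  generalize conjugateOneParticle v u = y' at hu ⊢
  generalize conjugateOneParticle v w = y at key ⊢
  have h := inner_add_inner_of_mem_closure key hu
  dsimp only at h
  exact h

/-! ### Bounds on the dispersion relations -/

theorem one_le_bracket (x : E ν) : 1 ≤ bracket x := by
  rw [bracket, Real.one_le_sqrt]
  nlinarith [sq_nonneg ‖x‖]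

theorem bracket_le (x : E ν) : bracket x ≤ 1 + ‖x‖ := by
  rw [bracket, Real.sqrt_le_left (by positivity)]
  nlinarith [norm_nonneg x]

theorem norm_le_bracket (x : E ν) : ‖x‖ ≤ bracket x :=
  Real.le_sqrt_of_sq_le (by linarith)

theorem bracket_le_two_mul {x y : E ν} (h : ‖x - y‖ ≤ 1) : bracket x ≤ 2 * bracket y := by
  have h1 : ‖x‖ ≤ 1 + ‖y‖ := by
    have := norm_add_le (x - y) y
    rw [sub_add_cancel] at this
    linarith
  rw [bracket, bracket, Real.sqrt_le_left (by positivity), mul_pow, Real.sq_sqrt (by positivity)]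
  nlinarith [norm_nonneg x, norm_nonneg y, sq_nonneg (‖y‖ - 1)]

theorem norm_iteratedFDeriv_two_eq {F : Type*} [NormedAddCommGroup F] [NormedSpace ℝ F]
    (f : E ν → F) (x : E ν) : ‖fderiv ℝ (fderiv ℝ f) x‖ = ‖iteratedFDeriv ℝ 2 f x‖ := by
  rw [← norm_iteratedFDeriv_one, norm_iteratedFDeriv_fderiv]

variable {s : ℝ} {Ω ω : E ν → ℝ}

namespace IsMatterDispersion

theorem contDiff (h : IsMatterDispersion s Ω) {n : WithTop ℕ∞} : ContDiff ℝ n Ω :=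
  h.analytic.contDiff

theorem norm_fderiv_le (h : IsMatterDispersion s Ω) :
    ∃ C : ℝ, 0 < C ∧ ∀ η, ‖fderiv ℝ Ω η‖ ≤ C * bracket η := by
  obtain ⟨C, hC, hb⟩ := h.symbol 1
  refine ⟨C, hC, fun η => ?_⟩
  rw [← norm_iteratedFDeriv_one]
  refine (hb η).trans (mul_le_mul_of_nonneg_left ?_ hC.le)
  have := Real.rpow_le_rpow_of_exponent_le (one_le_bracket η)
    (show s - ((1 : ℕ) : ℝ) ≤ 1 by push_cast; linarith [h.exponent.2])
  rwa [Real.rpow_one] at this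

theorem norm_fderiv_fderiv_le (h : IsMatterDispersion s Ω) :
    ∃ C : ℝ, 0 < C ∧ ∀ η, ‖fderiv ℝ (fderiv ℝ Ω) η‖ ≤ C := by
  obtain ⟨C, hC, hb⟩ := h.symbol 2
  refine ⟨C, hC, fun η => ?_⟩
  rw [norm_iteratedFDeriv_two_eq]
  refine (hb η).trans ?_
  have := Real.rpow_le_rpow_of_exponent_le (one_le_bracket η)
    (show s - ((2 : ℕ) : ℝ) ≤ 0 by push_cast; linarith [h.exponent.2])
  rw [Real.rpow_zero] at this
  exact mul_le_of_le_one_right hC.le this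

theorem rpow_le (h : IsMatterDispersion s Ω) :
    ∃ C : ℝ, 0 < C ∧ ∀ η, bracket η ^ s ≤ C * (1 + Ω η) := by
  obtain ⟨C, hC, hb⟩ := h.lower
  refine ⟨C * max 1 C, by positivity, fun η => ?_⟩
  have h1 := hb η
  have h2 : bracket η ^ s ≤ C * (Ω η + C) := by
    have : C⁻¹ * bracket η ^ s ≤ Ω η + C := by linarith
    rwa [inv_mul_le_iff₀ hC] at this
  refine h2.trans ?_
  rw [mul_assoc]
  refine mul_le_mul_of_nonneg_left ?_ hC.le
  have h3 := h.nonneg η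
  nlinarith [le_max_left 1 C, le_max_right 1 C]

/-- The squared gradient has order `2(s - 1)`, which is at most `s` exactly because `s ≤ 2`. -/
theorem norm_fderiv_sq_le (h : IsMatterDispersion s Ω) :
    ∃ C : ℝ, 0 < C ∧ ∀ η, ‖fderiv ℝ Ω η‖ ^ 2 ≤ C * (1 + Ω η) := by
  obtain ⟨C, hC, hb⟩ := h.symbol 1
  obtain ⟨C', hC', hb'⟩ := h.rpow_le
  refine ⟨C ^ 2 * C', by positivity, fun η => ?_⟩
  have hpos : 0 ≤ bracket η := zero_le_one.trans (one_le_bracket η)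
  rw [← norm_iteratedFDeriv_one]
  refine (pow_le_pow_left₀ (norm_nonneg _) (hb η) 2).trans ?_
  rw [mul_pow, mul_assoc]
  refine mul_le_mul_of_nonneg_left (le_trans ?_ (hb' η)) (by positivity)
  rw [← Real.rpow_natCast, ← Real.rpow_mul hpos]
  refine Real.rpow_le_rpow_of_exponent_le (one_le_bracket η) ?_
  push_cast
  linarith [h.exponent.2]

/-- `⟨η⟩ˢ` changes by a factor of at most `2ˢ ≤ 4` under a unit shift, and `Ω` is comparable to it
up to constants. This allows the energy at `P₀` to be bounded by the energy at a nearby `P`. -/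
theorem one_add_le (h : IsMatterDispersion s Ω) :
    ∃ C : ℝ, 1 ≤ C ∧ ∀ η η', ‖η - η'‖ ≤ 1 → 1 + Ω η ≤ C * (1 + Ω η') := by
  obtain ⟨C, hC, hb⟩ := h.symbol 0
  obtain ⟨C', hC', hb'⟩ := h.rpow_le
  refine ⟨1 + C * (4 * C'), by nlinarith [mul_pos hC hC'], fun η η' hη => ?_⟩
  have hpos : 0 ≤ bracket η := zero_le_one.trans (one_le_bracket η)
  have hpos' : 0 ≤ bracket η' := zero_le_one.trans (one_le_bracket η')
  have h1 := hb η
  rw [norm_iteratedFDeriv_zero, Nat.cast_zero, sub_zero] at h1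
  have h2 : bracket η ^ s ≤ 4 * bracket η' ^ s := by
    refine (Real.rpow_le_rpow hpos (bracket_le_two_mul hη) h.exponent.1).trans ?_
    rw [Real.mul_rpow zero_le_two hpos']
    refine mul_le_mul_of_nonneg_right ?_ (Real.rpow_nonneg hpos' _)
    have := Real.rpow_le_rpow_of_exponent_le one_le_two h.exponent.2
    norm_num at this
    exact this
  have h3 : Ω η ≤ C * (4 * (C' * (1 + Ω η'))) :=
    (le_abs_self _).trans (h1.trans (mul_le_mul_of_nonneg_left
      (h2.trans (mul_le_mul_of_nonneg_left (hb' η') zero_le_four)) hC.le))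
  nlinarith [h.nonneg η']

theorem hasTemperateGrowth_fderiv (h : IsMatterDispersion s Ω) :
    (fderiv ℝ Ω).HasTemperateGrowth := by
  refine ⟨h.contDiff.fderiv_right (m := (⊤ : ℕ∞)) (n := (⊤ : ℕ∞)) (by simp), fun n => ?_⟩
  obtain ⟨C, hC, hb⟩ := h.symbol (n + 1)
  refine ⟨2, C, fun η => ?_⟩
  rw [norm_iteratedFDeriv_fderiv]
  refine (hb η).trans (mul_le_mul_of_nonneg_left ?_ hC.le)
  have h1 := Real.rpow_le_rpow_of_exponent_le (one_le_bracket η)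
    (show s - ((n + 1 : ℕ) : ℝ) ≤ (2 : ℕ) by push_cast; linarith [h.exponent.2, n.cast_nonneg (α := ℝ)])
  rw [Real.rpow_natCast] at h1
  exact h1.trans (pow_le_pow_left₀ (zero_le_one.trans (one_le_bracket η)) (bracket_le η) 2)

end IsMatterDispersion

namespace IsFieldDispersion

theorem contDiff (h : IsFieldDispersion s ω) {n : WithTop ℕ∞} : ContDiff ℝ n ω :=
  h.analytic.contDiff

theorem norm_fderiv_le (h : IsFieldDispersion s ω) :
    ∃ C : ℝ, 0 < C ∧ ∀ k, ‖fderiv ℝ ω k‖ ≤ C := by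
  obtain ⟨C, hb⟩ := h.deriv_bounded 1 le_rfl
  refine ⟨max C 1, by positivity, fun k => ?_⟩
  rw [← norm_iteratedFDeriv_one]
  exact (hb k).trans (le_max_left _ _)

theorem norm_fderiv_fderiv_le (h : IsFieldDispersion s ω) :
    ∃ C : ℝ, 0 < C ∧ ∀ k, ‖fderiv ℝ (fderiv ℝ ω) k‖ ≤ C := by
  obtain ⟨C, hb⟩ := h.deriv_bounded 2 one_le_two
  refine ⟨max C 1, by positivity, fun k => ?_⟩
  rw [norm_iteratedFDeriv_two_eq]
  exact (hb k).trans (le_max_left _ _)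

theorem hasTemperateGrowth_fderiv (h : IsFieldDispersion s ω) :
    (fderiv ℝ ω).HasTemperateGrowth := by
  refine ⟨h.contDiff.fderiv_right (m := (⊤ : ℕ∞)) (n := (⊤ : ℕ∞)) (by simp), fun n => ?_⟩
  obtain ⟨C, hb⟩ := h.deriv_bounded (n + 1) (by omega)
  refine ⟨0, C, fun k => ?_⟩
  rw [norm_iteratedFDeriv_fderiv, pow_zero, mul_one]
  exact hb k

end IsFieldDispersion

/-! ### The total energy and the vector field -/

theorem norm_gradient_eq {f : E ν → ℝ} (x : E ν) : ‖gradient f x‖ = ‖fderiv ℝ f x‖ := by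
  rw [gradient, LinearIsometryEquiv.norm_map]

theorem gradient_apply (f : E ν → ℝ) (x : E ν) (j : Fin ν) :
    gradient f x j = fderiv ℝ f x (EuclideanSpace.single j 1) := by
  have h : ⟪gradient f x, EuclideanSpace.single j (1 : ℝ)⟫_ℝ =
      fderiv ℝ f x (EuclideanSpace.single j 1) := by
    rw [gradient, InnerProductSpace.toDual_symm_apply]
  rw [← h, EuclideanSpace.inner_single_right]
  simp

theorem component_vectorField (P : E ν) (j : Fin ν) (ξ : E ν) :
    component (vectorField Ω ω P) j ξ =
      fderiv ℝ ω ((2 * Real.pi) • ξ) (EuclideanSpace.single j 1) -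
        fderiv ℝ Ω (P - (2 * Real.pi) • ξ) (EuclideanSpace.single j 1) := by
  rw [component, vectorField, PiLp.sub_apply, gradient_apply, gradient_apply]

theorem abs_partialDeriv_le {f : E ν → ℝ} (hf : Differentiable ℝ (fderiv ℝ f)) {C : ℝ}
    (hC : ∀ x, ‖fderiv ℝ (fderiv ℝ f) x‖ ≤ C) (j : Fin ν) {L : E ν → E ν} {A : E ν →L[ℝ] E ν}
    {ξ : E ν} (hL : HasFDerivAt L A ξ) :
    |partialDeriv j (fun ξ => fderiv ℝ f (L ξ) (EuclideanSpace.single j 1)) ξ| ≤ C * ‖A‖ := by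
  have h1 := (hf (L ξ)).hasFDerivAt.comp ξ hL
  have h2 : HasFDerivAt (fun ξ => fderiv ℝ f (L ξ) (EuclideanSpace.single j 1)) _ ξ :=
    (ContinuousLinearMap.apply ℝ ℝ (EuclideanSpace.single j (1 : ℝ))).hasFDerivAt.comp ξ h1
  rw [partialDeriv, h2.fderiv]
  change ‖fderiv ℝ (fderiv ℝ f) (L ξ) (A (EuclideanSpace.single j 1))
    (EuclideanSpace.single j 1)‖ ≤ _
  have hn : ‖(EuclideanSpace.single j 1 : E ν)‖ = 1 := by simp
  refine (ContinuousLinearMap.le_opNorm _ _).trans ?_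
  rw [hn, mul_one]
  refine (ContinuousLinearMap.le_opNorm _ _).trans ?_
  refine mul_le_mul (hC _) ?_ (norm_nonneg _) (le_trans (norm_nonneg (fderiv ℝ (fderiv ℝ f) ξ)) (hC ξ))
  have := A.le_opNorm (EuclideanSpace.single j 1)
  rwa [hn, mul_one] at this

theorem isAdmissibleField_vectorField (hΩ : IsMatterDispersion s Ω) (hω : IsFieldDispersion s ω)
    (P : E ν) : IsAdmissibleField (vectorField Ω ω P) := by
  have hc : ∀ j, component (vectorField Ω ω P) j = fun ξ =>
      fderiv ℝ ω ((2 * Real.pi) • ξ) (EuclideanSpace.single j 1) -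
        fderiv ℝ Ω (P - (2 * Real.pi) • ξ) (EuclideanSpace.single j 1) := fun j =>
    funext fun ξ => component_vectorField P j ξ
  have d1 : Differentiable ℝ (fderiv ℝ ω) :=
    (hω.contDiff.fderiv_right (m := 1) (n := 2) (by norm_num)).differentiable one_ne_zero
  have d2 : Differentiable ℝ (fderiv ℝ Ω) :=
    (hΩ.contDiff.fderiv_right (m := 1) (n := 2) (by norm_num)).differentiable one_ne_zero
  constructor
  · intro j
    rw [hc]
    have h1 : (fun ξ : E ν => (2 * Real.pi) • ξ).HasTemperateGrowth := by fun_prop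
    have h2 : (fun ξ : E ν => P - (2 * Real.pi) • ξ).HasTemperateGrowth := by fun_prop
    have h3 := (ContinuousLinearMap.apply ℝ ℝ (EuclideanSpace.single j (1 : ℝ) : E ν)).hasTemperateGrowth
    exact (h3.comp (hω.hasTemperateGrowth_fderiv.comp h1)).sub
      (h3.comp (hΩ.hasTemperateGrowth_fderiv.comp h2))
  · obtain ⟨C, hC, hb⟩ := hω.norm_fderiv_fderiv_le
    obtain ⟨C', hC', hb'⟩ := hΩ.norm_fderiv_fderiv_le
    have a1 : ∀ ξ : E ν, HasFDerivAt (fun ξ : E ν => (2 * Real.pi) • ξ)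
        ((2 * Real.pi) • ContinuousLinearMap.id ℝ (E ν)) ξ := fun ξ =>
      ((2 * Real.pi) • ContinuousLinearMap.id ℝ (E ν)).hasFDerivAt
    have a2 : ∀ ξ : E ν, HasFDerivAt (fun ξ : E ν => P - (2 * Real.pi) • ξ)
        (-((2 * Real.pi) • ContinuousLinearMap.id ℝ (E ν))) ξ := fun ξ =>
      (a1 ξ).const_sub P
    refine ⟨C * ‖(2 * Real.pi) • ContinuousLinearMap.id ℝ (E ν)‖ +
      C' * ‖-((2 * Real.pi) • ContinuousLinearMap.id ℝ (E ν))‖, fun j ξ => ?_⟩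
    have e1 : DifferentiableAt ℝ (fun ξ : E ν =>
        fderiv ℝ ω ((2 * Real.pi) • ξ) (EuclideanSpace.single j 1)) ξ := by
      have := d1.comp (fun ξ => (a1 ξ).differentiableAt)
      exact (this ξ).clm_apply (differentiableAt_const _)
    have e2 : DifferentiableAt ℝ (fun ξ : E ν =>
        fderiv ℝ Ω (P - (2 * Real.pi) • ξ) (EuclideanSpace.single j 1)) ξ := by
      have := d2.comp (fun ξ => (a2 ξ).differentiableAt)
      exact (this ξ).clm_apply (differentiableAt_const _)
    rw [hc, partialDeriv, fderiv_fun_sub e1 e2]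
    exact (abs_sub _ _).trans (add_le_add (abs_partialDeriv_le d1 hb j (a1 ξ))
      (abs_partialDeriv_le d2 hb' j (a2 ξ)))

theorem contDiff_energy (hΩ : IsMatterDispersion s Ω) (hω : IsFieldDispersion s ω) (P : E ν)
    {n : WithTop ℕ∞} : ContDiff ℝ n (energy Ω ω P) :=
  (hΩ.contDiff.comp (contDiff_const.sub contDiff_id)).add hω.contDiff

theorem continuous_energy (hΩ : IsMatterDispersion s Ω) (hω : IsFieldDispersion s ω) (P : E ν) :
    Continuous (energy Ω ω P) := (contDiff_energy hΩ hω P (n := 0)).continuous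

theorem continuous_energy_uncurry (hΩ : IsMatterDispersion s Ω) (hω : IsFieldDispersion s ω) :
    Continuous fun p : E ν × E ν => energy Ω ω p.1 p.2 := by
  have h1 : Continuous Ω := (hΩ.contDiff (n := 0)).continuous
  have h2 : Continuous ω := (hω.contDiff (n := 0)).continuous
  unfold energy
  fun_prop

theorem continuous_gradient {f : E ν → ℝ} (hf : ContDiff ℝ 1 f) : Continuous (gradient f) := by
  have := hf.continuous_fderiv one_ne_zero
  unfold gradient
  fun_prop

theorem continuous_vectorField_uncurry (hΩ : IsMatterDispersion s Ω) (hω : IsFieldDispersion s ω) :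
    Continuous fun p : E ν × E ν => vectorField Ω ω p.1 p.2 := by
  have h1 : Continuous (gradient Ω) := continuous_gradient hΩ.contDiff
  have h2 : Continuous (gradient ω) := continuous_gradient hω.contDiff
  unfold vectorField
  fun_prop

theorem energy_nonneg (hΩ : IsMatterDispersion s Ω) (hω : IsFieldDispersion s ω) (P k : E ν) :
    0 ≤ energy Ω ω P k := add_nonneg (hΩ.nonneg _) (hω.nonneg _)

theorem partialDeriv_energy (hΩ : IsMatterDispersion s Ω) (hω : IsFieldDispersion s ω) (P : E ν)
    (j : Fin ν) (ξ : E ν) : partialDeriv j (fun ξ => energy Ω ω P ((2 * Real.pi) • ξ)) ξ =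
      2 * Real.pi * component (vectorField Ω ω P) j ξ := by
  have d1 : Differentiable ℝ ω := hω.contDiff.differentiable one_ne_zero
  have d2 : Differentiable ℝ Ω := hΩ.contDiff.differentiable one_ne_zero
  have a1 : HasFDerivAt (fun ξ : E ν => (2 * Real.pi) • ξ)
      ((2 * Real.pi) • ContinuousLinearMap.id ℝ (E ν)) ξ :=
    ((2 * Real.pi) • ContinuousLinearMap.id ℝ (E ν)).hasFDerivAt
  have b1 := (d1 ((2 * Real.pi) • ξ)).hasFDerivAt.comp ξ a1
  have b2 := (d2 (P - (2 * Real.pi) • ξ)).hasFDerivAt.comp ξ (a1.const_sub P)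
  have b3 : HasFDerivAt (fun ξ => energy Ω ω P ((2 * Real.pi) • ξ)) _ ξ := b2.add b1
  rw [partialDeriv, b3.fderiv, component_vectorField]
  simp
  ring

theorem norm_vectorField_sq_le (hΩ : IsMatterDispersion s Ω) (hω : IsFieldDispersion s ω) :
    ∃ C : ℝ, 0 < C ∧ ∀ P k, ‖vectorField Ω ω P k‖ ^ 2 ≤ C * (1 + energy Ω ω P k) := by
  obtain ⟨C, hC, hb⟩ := hω.norm_fderiv_le
  obtain ⟨C', hC', hb'⟩ := hΩ.norm_fderiv_sq_le
  refine ⟨2 * C ^ 2 + 2 * C', by positivity, fun P k => ?_⟩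
  have h1 := norm_sub_le (gradient ω k) (gradient Ω (P - k))
  rw [norm_gradient_eq, norm_gradient_eq] at h1
  have h2 := hb k
  have h3 := hb' (P - k)
  have h4 := hω.nonneg k
  have h5 := hΩ.nonneg (P - k)
  have h6 := pow_le_pow_left₀ (norm_nonneg _) h1 2
  have h7 := pow_le_pow_left₀ (norm_nonneg _) h2 2
  rw [vectorField, energy]
  have h8 : (‖fderiv ℝ ω k‖ + ‖fderiv ℝ Ω (P - k)‖) ^ 2 ≤
      2 * ‖fderiv ℝ ω k‖ ^ 2 + 2 * ‖fderiv ℝ Ω (P - k)‖ ^ 2 := by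
    nlinarith [sq_nonneg (‖fderiv ℝ ω k‖ - ‖fderiv ℝ Ω (P - k)‖)]
  nlinarith [mul_nonneg (sq_nonneg C) h4, mul_nonneg (sq_nonneg C) h5, mul_nonneg hC'.le h4]

/-- The product is at most the mean of the squares, each controlled by an energy. This is the
relative bound that keeps the commutator form finite on the domain of `H(P)`, although the field is
taken at `P₀`. -/
theorem norm_mul_norm_vectorField_le (hΩ : IsMatterDispersion s Ω) (hω : IsFieldDispersion s ω) :
    ∃ C : ℝ, 0 < C ∧ ∀ P₀ P k, ‖P - P₀‖ ≤ 1 →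
      ‖vectorField Ω ω P₀ k‖ * ‖vectorField Ω ω P k‖ ≤ C * (1 + energy Ω ω P k) := by
  obtain ⟨C, hC, hb⟩ := norm_vectorField_sq_le hΩ hω
  obtain ⟨D, hD, hb'⟩ := hΩ.one_add_le
  refine ⟨C * D, by positivity, fun P₀ P k hP => ?_⟩
  have h1 := hb P₀ k
  have h2 := hb P k
  have h3 := hb' (P₀ - k) (P - k) (by rwa [sub_sub_sub_cancel_right, norm_sub_rev])
  have h4 := hω.nonneg k
  have h5 := hΩ.nonneg (P - k)
  have h6 : 1 + energy Ω ω P₀ k ≤ D * (1 + energy Ω ω P k) := by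
    rw [energy, energy]
    nlinarith
  have h7 : 1 + energy Ω ω P k ≤ D * (1 + energy Ω ω P k) :=
    le_mul_of_one_le_left (by rw [energy]; positivity) hD
  have h8 := mul_le_mul_of_nonneg_left h6 hC.le
  have h9 := mul_le_mul_of_nonneg_left h7 hC.le
  nlinarith [sq_nonneg (‖vectorField Ω ω P₀ k‖ - ‖vectorField Ω ω P k‖)]

/-- Linear growth is what the weight `⟨·⟩` on the gradient of the transform of `ρ` can absorb. -/
theorem norm_vectorField_le_bracket (hΩ : IsMatterDispersion s Ω) (hω : IsFieldDispersion s ω)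
    (P : E ν) : ∃ C : ℝ, 0 < C ∧ ∀ ξ, ‖vectorField Ω ω P ((2 * Real.pi) • ξ)‖ ≤ C * bracket ξ := by
  obtain ⟨C, hC, hb⟩ := hω.norm_fderiv_le
  obtain ⟨C', hC', hb'⟩ := hΩ.norm_fderiv_le
  refine ⟨C + C' * (1 + ‖P‖ + 2 * Real.pi), by positivity, fun ξ => ?_⟩
  have h1 := norm_sub_le (gradient ω ((2 * Real.pi) • ξ)) (gradient Ω (P - (2 * Real.pi) • ξ))
  rw [norm_gradient_eq, norm_gradient_eq] at h1
  have h2 : bracket (P - (2 * Real.pi) • ξ) ≤ (1 + ‖P‖ + 2 * Real.pi) * bracket ξ := by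
    refine (bracket_le _).trans ?_
    have h3 := norm_sub_le P ((2 * Real.pi) • ξ)
    rw [norm_smul, Real.norm_of_nonneg (by positivity)] at h3
    have h4 := one_le_bracket ξ
    have h5 := mul_le_mul_of_nonneg_left (norm_le_bracket ξ) (show 0 ≤ 2 * Real.pi by positivity)
    nlinarith [norm_nonneg P]
  refine h1.trans ?_
  rw [add_mul]
  refine add_le_add ((hb _).trans (le_mul_of_one_le_right hC.le (one_le_bracket ξ))) ?_
  refine (hb' _).trans ?_
  rw [mul_assoc]
  exact mul_le_mul_of_nonneg_left h2 hC'.le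

/-! ### The lower bound away from thresholds -/

/-- For `s = 0` the growth of `ω` confines `k`; for `s > 0` the lower bound on `Ω` confines `P - k`.
In both cases the other dispersion relation only needs to be nonnegative. -/
theorem exists_norm_le_of_energy_le (hΩ : IsMatterDispersion s Ω) (hω : IsFieldDispersion s ω)
    (P₀ : E ν) (M : ℝ) : ∃ R : ℝ, ∀ P k, ‖P - P₀‖ ≤ 1 → energy Ω ω P k ≤ M → ‖k‖ ≤ R := by
  by_cases hs : s = 0
  · have h1 := (hω.coercive hs).eventually_gt_atTop M
    obtain ⟨R, hR⟩ := (Metric.cobounded_eq_cocompact (α := E ν) ▸ h1 : ∀ᶠ k in Bornology.cobounded _,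
      M < ω k) |> fun h => (Metric.hasBasis_cobounded_compl_closedBall (0 : E ν)).eventually_iff.1 h
    refine ⟨R, fun P k _ hk => ?_⟩
    by_contra hlt
    have := hR.2 (show k ∈ (Metric.closedBall (0 : E ν) R)ᶜ by simpa using hlt)
    rw [energy] at hk
    linarith [hΩ.nonneg (P - k)]
  · have hs0 : 0 < s := lt_of_le_of_ne hΩ.exponent.1 (Ne.symm hs)
    obtain ⟨C, hC, hb⟩ := hΩ.rpow_le
    refine ⟨(C * (1 + M)) ^ s⁻¹ + ‖P₀‖ + 1, fun P k hP hk => ?_⟩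
    have hpos : 0 ≤ bracket (P - k) := zero_le_one.trans (one_le_bracket _)
    have h1 : bracket (P - k) ^ s ≤ C * (1 + M) := by
      refine (hb _).trans (mul_le_mul_of_nonneg_left ?_ hC.le)
      rw [energy] at hk
      linarith [hω.nonneg k]
    have h2 : bracket (P - k) ≤ (C * (1 + M)) ^ s⁻¹ := by
      have := Real.rpow_le_rpow (Real.rpow_nonneg hpos _) h1 (inv_nonneg.2 hs0.le)
      rwa [← Real.rpow_mul hpos, mul_inv_cancel₀ hs, Real.rpow_one] at this
    have h3 : ‖k‖ ≤ ‖P - k‖ + ‖P - P₀‖ + ‖P₀‖ := by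
      have e : k = -(P - k) + (P - P₀) + P₀ := by abel
      calc ‖k‖ = ‖-(P - k) + (P - P₀) + P₀‖ := by rw [← e]
        _ ≤ _ := norm_add₃_le
        _ = _ := by rw [norm_neg]
    linarith [norm_le_bracket (P - k)]

/-- Compactness: otherwise momenta `k_n` with `P_n → P₀`, energies tending to `l₀` and inner
products below `1/(n+1)` have a limit point `k₀`. There the energy at `P₀` is `l₀` and `v_{P₀}(k₀) =
0`, so `l₀` is a threshold. -/
theorem inner_vectorField_ge_on_shell (hΩ : IsMatterDispersion s Ω) (hω : IsFieldDispersion s ω)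
    {P₀ : E ν} {l₀ : ℝ} (hθ : l₀ ∉ thresholds Ω ω P₀) :
    ∃ c : ℝ, 0 < c ∧ c ≤ 1 ∧ ∀ P k, ‖P - P₀‖ ≤ c → |energy Ω ω P k - l₀| ≤ c →
      c ≤ ⟪vectorField Ω ω P₀ k, vectorField Ω ω P k⟫_ℝ := by
  by_contra! hcon
  have hn : ∀ n : ℕ, (0 : ℝ) < 1 / ((n : ℝ) + 1) ∧ 1 / ((n : ℝ) + 1) ≤ 1 := fun n =>
    ⟨Nat.one_div_pos_of_nat, by
      rw [div_le_one (by positivity)]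
      linarith [n.cast_nonneg (α := ℝ)]⟩
  choose P k h1 h2 h3 using fun n : ℕ => hcon (1 / ((n : ℝ) + 1)) (hn n).1 (hn n).2
  obtain ⟨R, hR⟩ := exists_norm_le_of_energy_le hΩ hω P₀ (l₀ + 1)
  have hk : ∀ n, k n ∈ Metric.closedBall (0 : E ν) R := fun n => by
    rw [mem_closedBall_zero_iff]
    refine hR (P n) (k n) ((h1 n).trans (hn n).2) ?_
    linarith [le_of_abs_le ((h2 n).trans (hn n).2)]
  obtain ⟨k₀, -, φ, hφ, hlim⟩ := (isCompact_closedBall (0 : E ν) R).tendsto_subseq hk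
  have h0 : Tendsto (fun n => 1 / ((φ n : ℝ) + 1)) atTop (𝓝 0) :=
    tendsto_one_div_add_atTop_nhds_zero_nat.comp hφ.tendsto_atTop
  have hP : Tendsto (fun n => P (φ n)) atTop (𝓝 P₀) := by
    rw [tendsto_iff_norm_sub_tendsto_zero]
    exact squeeze_zero (fun _ => norm_nonneg _) (fun n => h1 (φ n)) h0
  have hpair : Tendsto (fun n => (P (φ n), k (φ n))) atTop (𝓝 (P₀, k₀)) := hP.prodMk_nhds hlim
  have e1 : energy Ω ω P₀ k₀ = l₀ := by
    have t1 := ((continuous_energy_uncurry hΩ hω).tendsto (P₀, k₀)).comp hpair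
    have t2 : Tendsto (fun n => energy Ω ω (P (φ n)) (k (φ n))) atTop (𝓝 l₀) := by
      rw [tendsto_iff_norm_sub_tendsto_zero]
      exact squeeze_zero (fun _ => norm_nonneg _) (fun n => h2 (φ n)) h0
    exact tendsto_nhds_unique t1 t2
  have e2 : ⟪vectorField Ω ω P₀ k₀, vectorField Ω ω P₀ k₀⟫_ℝ ≤ 0 := by
    have t1 := ((continuous_vectorField_uncurry hΩ hω).tendsto (P₀, k₀)).comp hpair
    have t2 := ((continuous_vectorField_uncurry hΩ hω).tendsto (P₀, k₀)).comp
      (tendsto_const_nhds.prodMk_nhds hlim : Tendsto (fun n => (P₀, k (φ n))) atTop _)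
    exact le_of_tendsto_of_tendsto' (t2.inner t1) h0 fun n => (h3 (φ n)).le
  have e3 : vectorField Ω ω P₀ k₀ = 0 := by
    rw [real_inner_self_eq_norm_sq] at e2
    exact norm_eq_zero.1 (pow_eq_zero_iff two_ne_zero |>.1 (le_antisymm e2 (sq_nonneg _)))
  exact hθ ⟨k₀, e1.symm, (sub_eq_zero.1 e3).symm⟩

theorem inner_vectorField_ge (hΩ : IsMatterDispersion s Ω) (hω : IsFieldDispersion s ω)
    {P₀ : E ν} {l₀ : ℝ} (hθ : l₀ ∉ thresholds Ω ω P₀) :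
    ∃ c K : ℝ, 0 < c ∧ c ≤ 1 ∧ 0 ≤ K ∧ ∀ P k, ‖P - P₀‖ ≤ c →
      c - K * (energy Ω ω P k - l₀) ^ 2 ≤ ⟪vectorField Ω ω P₀ k, vectorField Ω ω P k⟫_ℝ := by
  obtain ⟨c, hc, hc1, hb⟩ := inner_vectorField_ge_on_shell hΩ hω hθ
  obtain ⟨C, hC, hb'⟩ := norm_mul_norm_vectorField_le hΩ hω
  set a := 1 + |l₀| with ha
  have ha0 : 0 ≤ a := by positivity
  -- Off the shell `|d| > c`, so `c`, `a` and `|d|` are at most `d²/c`, `a d²/c²` and `d²/c`. The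
  -- constant `K` collects these: the first pays for `c` itself, the others for `C(1 + E) ≤ C(a +
  -- |d|)`.
  refine ⟨c, c⁻¹ + C * (a / c ^ 2 + c⁻¹), hc, hc1, by positivity, fun P k hP => ?_⟩
  set d := energy Ω ω P k - l₀ with hd
  by_cases hsh : |d| ≤ c
  · have : 0 ≤ (c⁻¹ + C * (a / c ^ 2 + c⁻¹)) * d ^ 2 := by positivity
    linarith [hb P k hP hsh]
  · push Not at hsh
    have h1 := (abs_le.1 (abs_real_inner_le_norm (vectorField Ω ω P₀ k) (vectorField Ω ω P k))).1
    have h2 := hb' P₀ P k (hP.trans hc1)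
    have h3 : 1 + energy Ω ω P k ≤ a + |d| := by
      have : energy Ω ω P k = d + l₀ := by rw [hd]; ring
      rw [this, ha]
      linarith [le_abs_self d, le_abs_self l₀]
    have h4 : c ≤ c⁻¹ * d ^ 2 := by
      rw [le_inv_mul_iff₀ hc, ← sq_abs d]
      nlinarith
    have h5 : a ≤ a / c ^ 2 * d ^ 2 := by
      rw [div_mul_eq_mul_div, le_div_iff₀ (by positivity), ← sq_abs d]
      exact mul_le_mul_of_nonneg_left (pow_le_pow_left₀ hc.le hsh.le 2) ha0
    have h6 : |d| ≤ c⁻¹ * d ^ 2 := by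
      rw [le_inv_mul_iff₀ hc, ← sq_abs d, sq]
      exact mul_le_mul_of_nonneg_right hsh.le (abs_nonneg d)
    have h7 : C * (1 + energy Ω ω P k) ≤ C * ((a / c ^ 2 + c⁻¹) * d ^ 2) :=
      mul_le_mul_of_nonneg_left (by linarith) hC.le
    linarith

/-! ### The commutator of the conjugate operator with an unbounded multiplier -/

/-- The regularization `1 / (1 + e / (n + 1))`. -/
def cutoff (e : E ν → ℝ) (he : Continuous e) (h0 : ∀ ξ, 0 ≤ e ξ) (n : ℕ) :
    BoundedContinuousFunction (E ν) ℂ :=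
  BoundedContinuousFunction.ofNormedAddCommGroup
    (fun ξ => (((1 + e ξ / (n + 1))⁻¹ : ℝ) : ℂ))
    (Complex.continuous_ofReal.comp (Continuous.inv₀ (by fun_prop) fun ξ => by
      have := h0 ξ
      positivity)) 1
    (fun ξ => by
      have h : 0 ≤ e ξ / (n + 1) := div_nonneg (h0 ξ) (by positivity)
      rw [Complex.norm_real, Real.norm_of_nonneg (by positivity)]
      exact inv_le_one_of_one_le₀ (by linarith))

theorem cutoff_apply (e : E ν → ℝ) (he : Continuous e) (h0 : ∀ ξ, 0 ≤ e ξ) (n : ℕ) (ξ : E ν) :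
    cutoff e he h0 n ξ = (((1 + e ξ / (n + 1))⁻¹ : ℝ) : ℂ) := rfl

theorem norm_cutoff_le (e : E ν → ℝ) (he : Continuous e) (h0 : ∀ ξ, 0 ≤ e ξ) (n : ℕ) (ξ : E ν) :
    ‖cutoff e he h0 n ξ‖ ≤ 1 := by
  have h : 0 ≤ e ξ / (n + 1) := div_nonneg (h0 ξ) (by positivity)
  rw [cutoff_apply, Complex.norm_real, Real.norm_of_nonneg (by positivity)]
  exact inv_le_one_of_one_le₀ (by linarith)

theorem tendsto_cutoff (e : E ν → ℝ) (he : Continuous e) (h0 : ∀ ξ, 0 ≤ e ξ) (ξ : E ν) :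
    Tendsto (fun n => cutoff e he h0 n ξ) atTop (𝓝 1) := by
  have h1 : Tendsto (fun n : ℕ => (1 + e ξ / ((n : ℝ) + 1))⁻¹) atTop (𝓝 (1 + e ξ * 0)⁻¹) := by
    refine Tendsto.inv₀ ?_ (by simp)
    refine tendsto_const_nhds.add ?_
    have := (tendsto_one_div_add_atTop_nhds_zero_nat (𝕜 := ℝ)).const_mul (e ξ)
    refine this.congr fun n => ?_
    ring
  have h2 := (Complex.continuous_ofReal.tendsto _).comp h1
  simpa [Function.comp_def, cutoff_apply] using h2

/-- The derivative of `t/(1 + t/N)` is `(1 + t/N)⁻²`, so regularizing `e` multiplies its gradient by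
the square of the cutoff. -/
theorem partialDeriv_cutoff {e : E ν → ℝ} (he : Differentiable ℝ e) (h0 : ∀ ξ, 0 ≤ e ξ) (N : ℝ)
    (hN : 0 < N) (j : Fin ν) (ξ : E ν) :
    partialDeriv j (fun ξ => e ξ * (1 + e ξ / N)⁻¹) ξ =
      partialDeriv j e ξ * ((1 + e ξ / N)⁻¹) ^ 2 := by
  have hpos : 1 + e ξ / N ≠ 0 := by
    have := h0 ξ
    positivity
  have h1 : HasDerivAt (fun t : ℝ => t * (1 + t / N)⁻¹) (((1 + e ξ / N)⁻¹) ^ 2) (e ξ) := by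
    have a := ((hasDerivAt_id (e ξ)).div_const N).const_add 1
    have b := (hasDerivAt_id (e ξ)).mul (a.inv hpos)
    refine (b.congr_deriv ?_)
    simp only [id_eq, Pi.inv_apply]
    field_simp
    ring
  have h2 : HasFDerivAt (fun ξ => e ξ * (1 + e ξ / N)⁻¹) _ ξ :=
    h1.comp_hasFDerivAt ξ (he ξ).hasFDerivAt
  rw [partialDeriv, h2.fderiv]
  simp [partialDeriv, mul_comm]

/-- `e` is replaced by the bounded function `e h_n`, with `h_n` the cutoff. The commutator then has
symbol `q (1 + e) h_n²`. The factor `1 + e` is put on `ŵ`, giving `ŵ + g`, so that only the bounded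
symbols `q h_n²` remain and dominated convergence applies. -/
theorem commutator_multiplier {v : E ν → E ν} (hv : IsAdmissibleField v) {e : E ν → ℝ}
    (he : ContDiff ℝ 1 e) (h0 : ∀ ξ, 0 ≤ e ξ) {C : ℝ}
    (hC : ∀ j ξ, |partialDeriv j e ξ| ≤ C * (1 + e ξ)) {q : BoundedContinuousFunction (E ν) ℂ}
    (hq : ∀ ξ, q ξ * (1 + e ξ : ℝ) = (1 / (2 * Real.pi)) * ∑ j, (component v j ξ : ℂ) *
      ((partialDeriv j e ξ : ℝ) : ℂ))
    (u w : (conjugateOneParticle v).domain) {f g : L2 ν}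
    (hf : f =ᵐ[volume] fun ξ => (e ξ : ℂ) * fourierL2 ν u ξ)
    (hg : g =ᵐ[volume] fun ξ => (e ξ : ℂ) * fourierL2 ν w ξ) :
    ⟪f, fourierL2 ν (Complex.I • conjugateOneParticle v w)⟫_ℂ +
      ⟪fourierL2 ν (Complex.I • conjugateOneParticle v u), g⟫_ℂ =
    ⟪fourierL2 ν u, mulOp q (fourierL2 ν w + g)⟫_ℂ := by
  have hdiff : Differentiable ℝ e := he.differentiable one_ne_zero
  set h := fun n => cutoff e he.continuous h0 n with hh
  have hpos : ∀ (n : ℕ) ξ, 0 < 1 + e ξ / ((n : ℝ) + 1) := fun n ξ => by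
    have := h0 ξ
    positivity
  have hN : ∀ n : ℕ, (0 : ℝ) < (n : ℝ) + 1 := fun n => by positivity
  have step : ∀ n : ℕ,
      ⟪mulOp (h n) f, fourierL2 ν (Complex.I • conjugateOneParticle v w)⟫_ℂ +
        ⟪fourierL2 ν (Complex.I • conjugateOneParticle v u), mulOp (h n) g⟫_ℂ =
      ⟪fourierL2 ν u, mulOp (q * (h n * h n)) (fourierL2 ν w + g)⟫_ℂ := by
    intro n
    -- This uses `1 + e ≤ (n + 1) + e`, hence a cutoff scale of at least `1`.
    have hinv : ∀ ξ, (1 + e ξ) * (1 + e ξ / ((n : ℝ) + 1))⁻¹ ≤ (n : ℝ) + 1 := fun ξ => by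
      rw [← div_eq_mul_inv, div_le_iff₀ (hpos n ξ), mul_add, mul_div_cancel₀ _ (hN n).ne']
      linarith [n.cast_nonneg (α := ℝ)]
    have hle : ∀ ξ, (1 + e ξ / ((n : ℝ) + 1))⁻¹ ≤ 1 := fun ξ =>
      inv_le_one_of_one_le₀ (by linarith [div_nonneg (h0 ξ) (hN n).le])
    have hinv0 : ∀ ξ, 0 < (1 + e ξ / ((n : ℝ) + 1))⁻¹ := fun ξ => inv_pos.2 (hpos n ξ)
    have hcont : Continuous fun ξ => (1 + e ξ / ((n : ℝ) + 1))⁻¹ :=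
      Continuous.inv₀ (by have := he.continuous; fun_prop) fun ξ => (hpos n ξ).ne'
    have hGb : ∀ ξ, ‖((e ξ * (1 + e ξ / ((n : ℝ) + 1))⁻¹ : ℝ) : ℂ)‖ ≤ (n : ℝ) + 1 := fun ξ => by
      rw [Complex.norm_real, Real.norm_of_nonneg (mul_nonneg (h0 ξ) (hinv0 ξ).le)]
      linarith [hinv ξ, hinv0 ξ]
    let G : BoundedContinuousFunction (E ν) ℂ := BoundedContinuousFunction.ofNormedAddCommGroup
      (fun ξ => ((e ξ * (1 + e ξ / ((n : ℝ) + 1))⁻¹ : ℝ) : ℂ))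
      (Complex.continuous_ofReal.comp (he.continuous.mul hcont)) ((n : ℝ) + 1) hGb
    have hqb : ∀ ξ, ‖q ξ * ((1 + e ξ : ℝ) * (((1 + e ξ / ((n : ℝ) + 1))⁻¹ ^ 2 : ℝ) : ℂ))‖ ≤
        ‖q‖ * ((n : ℝ) + 1) := fun ξ => by
      rw [norm_mul, ← Complex.ofReal_mul, Complex.norm_real,
        Real.norm_of_nonneg (by have := h0 ξ; have := hinv0 ξ; positivity)]
      refine mul_le_mul (q.norm_coe_le_norm ξ) ?_
        (by have := h0 ξ; have := hinv0 ξ; positivity) (norm_nonneg _)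
      rw [sq, ← mul_assoc]
      exact (mul_le_of_le_one_right (by have := h0 ξ; have := hinv0 ξ; positivity) (hle ξ)).trans
        (hinv ξ)
    let Q : BoundedContinuousFunction (E ν) ℂ := BoundedContinuousFunction.ofNormedAddCommGroup
      (fun ξ => q ξ * ((1 + e ξ : ℝ) * (((1 + e ξ / ((n : ℝ) + 1))⁻¹ ^ 2 : ℝ) : ℂ)))
      (q.continuous.mul ((Complex.continuous_ofReal.comp (continuous_const.add he.continuous)).mul
        (Complex.continuous_ofReal.comp (hcont.pow 2)))) (‖q‖ * ((n : ℝ) + 1)) hqb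
    have hG1 : ContDiff ℝ 1 fun ξ => e ξ * (1 + e ξ / ((n : ℝ) + 1))⁻¹ :=
      he.mul (ContDiff.inv (contDiff_const.add (he.div_const _)) fun ξ => (hpos n ξ).ne')
    have key := commutator_mulOp hv hG1 (C := |C| * ((n : ℝ) + 1)) (g := G) (q := Q) ?_
      (fun ξ => rfl) ?_ u w
    · have e1 : mulOp G (fourierL2 ν u) = mulOp (h n) f := by
        apply Lp.ext
        filter_upwards [coeFn_mulOp G (fourierL2 ν u), coeFn_mulOp (h n) f, hf] with ξ h1 h2 h3
        rw [h1, h2, h3, hh, cutoff_apply]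
        change ((e ξ * (1 + e ξ / ((n : ℝ) + 1))⁻¹ : ℝ) : ℂ) * _ = _
        push_cast
        ring
      have e2 : mulOp G (fourierL2 ν w) = mulOp (h n) g := by
        apply Lp.ext
        filter_upwards [coeFn_mulOp G (fourierL2 ν w), coeFn_mulOp (h n) g, hg] with ξ h1 h2 h3
        rw [h1, h2, h3, hh, cutoff_apply]
        change ((e ξ * (1 + e ξ / ((n : ℝ) + 1))⁻¹ : ℝ) : ℂ) * _ = _
        push_cast
        ring
      have e3 : mulOp Q (fourierL2 ν w) = mulOp (q * (h n * h n)) (fourierL2 ν w + g) := by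
        apply Lp.ext
        filter_upwards [coeFn_mulOp Q (fourierL2 ν w),
          coeFn_mulOp (q * (h n * h n)) (fourierL2 ν w + g), Lp.coeFn_add (fourierL2 ν w) g, hg]
          with ξ h1 h2 h3 h4
        rw [h1, h2, h3, Pi.add_apply, h4, BoundedContinuousFunction.mul_apply,
          BoundedContinuousFunction.mul_apply, hh, cutoff_apply]
        change q ξ * ((1 + e ξ : ℝ) * (((1 + e ξ / ((n : ℝ) + 1))⁻¹ ^ 2 : ℝ) : ℂ)) * _ = _
        push_cast
        ring
      rw [← e1, ← e2, ← e3]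
      exact key
    · intro j ξ
      rw [partialDeriv_cutoff hdiff h0 _ (hN n), abs_mul, abs_of_nonneg (sq_nonneg (1 + e ξ / ((n : ℝ) + 1))⁻¹)]
      have hp := hinv0 ξ
      have he0 := h0 ξ
      calc |partialDeriv j e ξ| * (1 + e ξ / ((n : ℝ) + 1))⁻¹ ^ 2
          ≤ (|C| * (1 + e ξ)) * (1 + e ξ / ((n : ℝ) + 1))⁻¹ ^ 2 := by
            refine mul_le_mul_of_nonneg_right ((hC j ξ).trans ?_) (sq_nonneg _)
            exact mul_le_mul_of_nonneg_right (le_abs_self C) (by positivity)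
        _ = |C| * ((1 + e ξ) * (1 + e ξ / ((n : ℝ) + 1))⁻¹ * (1 + e ξ / ((n : ℝ) + 1))⁻¹) := by ring
        _ ≤ |C| * ((n : ℝ) + 1) := by
            refine mul_le_mul_of_nonneg_left ?_ (abs_nonneg C)
            exact (mul_le_of_le_one_right (by positivity) (hle ξ)).trans (hinv ξ)
    · intro ξ
      change q ξ * ((1 + e ξ : ℝ) * (((1 + e ξ / ((n : ℝ) + 1))⁻¹ ^ 2 : ℝ) : ℂ)) = _
      rw [← mul_assoc, hq, mul_assoc, Finset.sum_mul]
      congr 1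
      refine Finset.sum_congr rfl fun j _ => ?_
      rw [partialDeriv_cutoff hdiff h0 _ (hN n)]
      push_cast
      ring
  have hone : ∀ x : L2 ν, mulOp 1 x = x := fun x => by
    apply Lp.ext
    filter_upwards [coeFn_mulOp 1 x] with ξ h1
    rw [h1, show (1 : BoundedContinuousFunction (E ν) ℂ) ξ = 1 from rfl, one_mul]
  have l1 : ∀ x, Tendsto (fun n => mulOp (h n) x) atTop (𝓝 x) := fun x => by
    have := tendsto_mulOp (m' := 1) (norm_cutoff_le e he.continuous h0)
      (fun ξ => tendsto_cutoff e he.continuous h0 ξ) x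
    rwa [hone] at this
  have l2 : Tendsto (fun n => mulOp (q * (h n * h n)) (fourierL2 ν w + g)) atTop
      (𝓝 (mulOp q (fourierL2 ν w + g))) := by
    refine tendsto_mulOp (C := ‖q‖) (fun n ξ => ?_) (fun ξ => ?_) _
    · have h1 := norm_cutoff_le e he.continuous h0 n ξ
      simp only [BoundedContinuousFunction.mul_apply, norm_mul]
      have h2 := mul_le_one₀ h1 (norm_nonneg _) h1
      have h3 := mul_le_mul (q.norm_coe_le_norm ξ) h2 (by positivity) (norm_nonneg q)
      rwa [mul_one] at h3
    · have h1 := tendsto_cutoff e he.continuous h0 ξ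
      have h2 := (h1.mul h1).const_mul (q ξ)
      simpa using h2
  refine tendsto_nhds_unique (((l1 f).inner tendsto_const_nhds).add
    (tendsto_const_nhds.inner (l1 g))) ?_
  simp only [step]
  exact tendsto_const_nhds.inner l2

/-! ### The coupling function -/

/-- `η` is `-i a ρ`. It lies in `L²` because the linear growth of `v` is paid for by the weighted
gradient of `r`, while the divergence of `v` is bounded. -/
theorem exists_commutator_coupling {s : ℝ} {Ω ω : E ν → ℝ} (hΩ : IsMatterDispersion s Ω)
    (hω : IsFieldDispersion s ω) {ρ : L2 ν} (hρ : IsCoupling ρ) (P : E ν) :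
    ∃ η : L2 ν, ∀ w : (conjugateOneParticle (vectorField Ω ω P)).domain,
      ⟪ρ, Complex.I • conjugateOneParticle (vectorField Ω ω P) w⟫_ℂ = ⟪η, (w : L2 ν)⟫_ℂ := by
  obtain ⟨r, hr, hr2, hr1, -⟩ := hρ.fourier
  have hv := isAdmissibleField_vectorField hΩ hω P
  set v := vectorField Ω ω P with hvdef
  have hrC : ContDiff ℝ 1 r := hr2.of_le one_le_two
  obtain ⟨C, hC, hb⟩ := norm_vectorField_le_bracket hΩ hω P
  obtain ⟨D, hD⟩ := hv.bounded_deriv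
  have hrL : MemLp r 2 volume := (memLp_congr_ae hr).1 (Lp.memLp _)
  have hcr : ∀ j, MemLp (fun ξ => (component v j ξ : ℂ) * partialDeriv j r ξ) 2 volume := by
    intro j
    refine hr1.of_le_mul (c := C) ?_ (ae_of_all _ fun ξ => ?_)
    · exact ((Complex.continuous_ofReal.comp (hv.continuous_component j)).mul
        (continuous_partialDeriv hrC j)).aestronglyMeasurable
    · have h1 : ‖component v j ξ‖ ≤ C * bracket ξ :=
        (PiLp.norm_apply_le (v ((2 * Real.pi) • ξ)) j).trans (hb ξ)
      have h2 : ‖partialDeriv j r ξ‖ ≤ ‖fderiv ℝ r ξ‖ := by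
        have := (fderiv ℝ r ξ).le_opNorm (EuclideanSpace.single j 1)
        simpa [partialDeriv] using this
      have hpos : 0 ≤ bracket ξ := zero_le_one.trans (one_le_bracket ξ)
      rw [norm_mul, Complex.norm_real,
        Real.norm_of_nonneg (mul_nonneg hpos (norm_nonneg (fderiv ℝ r ξ))), ← mul_assoc]
      exact mul_le_mul h1 h2 (norm_nonneg _) (by positivity)
  have hdr : ∀ j, MemLp (fun ξ => ((partialDeriv j (component v j) ξ : ℝ) : ℂ) * r ξ) 2 volume := by
    intro j
    refine hrL.of_le_mul (c := D) ?_ (ae_of_all _ fun ξ => ?_)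
    · exact ((Complex.continuous_ofReal.comp (hv.continuous_partialDeriv j)).mul
        hrC.continuous).aestronglyMeasurable
    · rw [norm_mul, Complex.norm_real]
      exact mul_le_mul_of_nonneg_right (hD j ξ) (norm_nonneg _)
  have ht : MemLp (transport v r) 2 volume := by
    have := (memLp_finsetSum (Finset.univ : Finset (Fin ν)) fun j _ =>
      ((hcr j).const_mul 2).add (hdr j)).const_mul (-(1 / (4 * Real.pi)) : ℂ)
    refine (memLp_congr_ae (ae_of_all _ fun ξ => ?_)).1 this
    simp [transport, mul_assoc]
  refine ⟨-(fourierL2 ν).symm (ht.toLp _), fun w => ?_⟩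
  have := inner_fourier_I_smul_conjugateOneParticle hv hrC hcr hr ht.coeFn_toLp w
  rw [inner_neg_left, ← (fourierL2 ν).inner_map_map ((fourierL2 ν).symm _),
    LinearIsometryEquiv.apply_symm_apply, ← this]
  exact ((fourierL2 ν).inner_map_map _ _).symm

/-! ### Uniqueness of the extension -/

/-- A form bounded in the graph norm is determined by its values on a graph-norm dense set, and
`hcore` says that `D(T) ∩ D(A)` is one. -/
theorem IsCommutatorExtension.unique {K : Type*} [NormedAddCommGroup K] [InnerProductSpace ℂ K]
    {T A : K →ₗ.[ℂ] K} (hcore : ∀ u : T.domain, ∃ x : ℕ → T.domain,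
      (∀ n, (x n : K) ∈ A.domain) ∧ Tendsto (fun n => (x n : K)) atTop (𝓝 u) ∧
      Tendsto (fun n => T (x n)) atTop (𝓝 (T u)))
    {B B' : T.domain →ₗ⋆[ℂ] T.domain →ₗ[ℂ] ℂ} (hB : IsCommutatorExtension T A B)
    (hB' : IsCommutatorExtension T A B') : B' = B := by
  obtain ⟨M, hM⟩ := hB.bounded
  obtain ⟨M', hM'⟩ := hB'.bounded
  ext u w
  obtain ⟨x, hx, hx1, hx2⟩ := hcore u
  obtain ⟨y, hy, hy1, hy2⟩ := hcore w
  have conv : ∀ (S : T.domain →ₗ⋆[ℂ] T.domain →ₗ[ℂ] ℂ) (M : ℝ),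
      (∀ u w : T.domain, ‖S u w‖ ≤ M * (‖(u : K)‖ + ‖T u‖) * (‖(w : K)‖ + ‖T w‖)) →
      Tendsto (fun n => S (x n) (y n)) atTop (𝓝 (S u w)) := by
    intro S M hS
    rw [tendsto_iff_norm_sub_tendsto_zero]
    have l1 : Tendsto (fun n => ‖(x n : K) - u‖ + ‖T (x n) - T u‖) atTop (𝓝 0) := by
      simpa using (tendsto_iff_norm_sub_tendsto_zero.1 hx1).add
        (tendsto_iff_norm_sub_tendsto_zero.1 hx2)
    have l2 : Tendsto (fun n => ‖(y n : K) - w‖ + ‖T (y n) - T w‖) atTop (𝓝 0) := by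
      simpa using (tendsto_iff_norm_sub_tendsto_zero.1 hy1).add
        (tendsto_iff_norm_sub_tendsto_zero.1 hy2)
    have l3 : Tendsto (fun n => ‖(y n : K)‖ + ‖T (y n)‖) atTop (𝓝 (‖(w : K)‖ + ‖T w‖)) :=
      hy1.norm.add hy2.norm
    have l4 := ((l1.const_mul M).mul l3).add (l2.const_mul (M * (‖(u : K)‖ + ‖T u‖)))
    rw [mul_zero, zero_mul, mul_zero, add_zero] at l4
    refine squeeze_zero (fun _ => norm_nonneg _) (fun n => ?_) l4
    have h1 := hS (x n - u) (y n)
    have h2 := hS u (y n - w)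
    rw [T.map_sub] at h1 h2
    have h3 : S (x n) (y n) - S u w = S (x n - u) (y n) + S u (y n - w) := by
      rw [map_sub S, LinearMap.sub_apply, map_sub (S u)]
      ring
    rw [h3]
    exact (norm_add_le _ _).trans (add_le_add h1 h2)
  have heq : ∀ n, B' (x n) (y n) = B (x n) (y n) := fun n =>
    (hB'.extends_form _ _ (x n).2 (hx n) (y n).2 (hy n)).trans
      (hB.extends_form _ _ (x n).2 (hx n) (y n).2 (hy n)).symm
  refine tendsto_nhds_unique (conv B' M' hM') ?_
  simp only [heq]
  exact conv B M hM

/-! ### Schwartz functions form a core -/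

theorem coeFn_schwartzToL2 (φ : 𝓢(E ν, ℂ)) : schwartzToL2 ν φ =ᵐ[volume] φ :=
  φ.coeFn_toLp 2 volume

theorem exists_compactly_supported_schwartz_near (f : L2 ν) {ε : ℝ} (hε : 0 < ε) :
    ∃ χ : 𝓢(E ν, ℂ), HasCompactSupport χ ∧ ‖schwartzToL2 ν χ - f‖ ≤ ε := by
  obtain ⟨g, hg₁, hg₂, hg₃⟩ := MemLp.exist_eLpNorm_sub_le (p := 2) (by simp) (by norm_num)
    (Lp.memLp f) hε
  refine ⟨hg₁.toSchwartzMap hg₂, hg₁, ?_⟩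
  have h : ((f - schwartzToL2 ν (hg₁.toSchwartzMap hg₂) : L2 ν) : E ν → ℂ) =ᵐ[volume]
      (f : E ν → ℂ) - g := by
    filter_upwards [coeFn_schwartzToL2 (hg₁.toSchwartzMap hg₂),
      Lp.coeFn_sub f (schwartzToL2 ν (hg₁.toSchwartzMap hg₂))] with ξ h1 h2
    rw [h2, Pi.sub_apply, Pi.sub_apply, h1]
    rfl
  rw [norm_sub_rev, Lp.norm_def, eLpNorm_congr_ae h]
  exact ENNReal.toReal_le_of_le_ofReal hε.le hg₃

/-- On the compact support of `χ` the smooth symbol `(g - i)⁻¹` may multiply freely, so the solution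
is again Schwartz without any growth condition on `g`. -/
theorem exists_schwartz_resolvent {g : E ν → ℝ} (hg : ContDiff ℝ (⊤ : ℕ∞) g) (χ : 𝓢(E ν, ℂ))
    (hχ : HasCompactSupport χ) : ∃ (φ : 𝓢(E ν, ℂ))
      (hφ : schwartzToL2 ν φ ∈ (fourierMultiplier g).domain),
      fourierMultiplier g ⟨schwartzToL2 ν φ, hφ⟩ - Complex.I • schwartzToL2 ν φ =
        (fourierL2 ν).symm (schwartzToL2 ν χ) := by
  have hne : ∀ ξ : E ν, ((g ((2 * Real.pi) • ξ) : ℝ) : ℂ) - Complex.I ≠ 0 := fun ξ h => by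
    simpa using congrArg Complex.im h
  have hsm : ContDiff ℝ (⊤ : ℕ∞) fun ξ : E ν =>
      (((g ((2 * Real.pi) • ξ) : ℝ) : ℂ) - Complex.I)⁻¹ :=
    ContDiff.inv ((Complex.ofRealCLM.contDiff.comp (hg.comp (contDiff_id.const_smul _))).sub
      contDiff_const) hne
  have hc : HasCompactSupport fun ξ : E ν =>
      (((g ((2 * Real.pi) • ξ) : ℝ) : ℂ) - Complex.I)⁻¹ * χ ξ := hχ.mul_left
  set ψ : 𝓢(E ν, ℂ) := hc.toSchwartzMap (hsm.mul (χ.smooth _)) with hψ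
  have hψ' : ∀ ξ, ψ ξ = (((g ((2 * Real.pi) • ξ) : ℝ) : ℂ) - Complex.I)⁻¹ * χ ξ := fun ξ => rfl
  have hF : fourierL2 ν (schwartzToL2 ν (𝓕⁻ ψ)) = schwartzToL2 ν ψ := by
    have h1 : fourierL2 ν (schwartzToL2 ν (𝓕⁻ ψ)) = schwartzToL2 ν (𝓕 (𝓕⁻ ψ)) :=
      SchwartzMap.toLp_fourier_eq (𝓕⁻ ψ)
    rw [h1, FourierTransform.fourier_fourierInv_eq]
  have hd : (schwartzToL2 ν χ + Complex.I • schwartzToL2 ν ψ : L2 ν) =ᵐ[volume]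
      fun ξ => ((g ((2 * Real.pi) • ξ) : ℝ) : ℂ) * fourierL2 ν (schwartzToL2 ν (𝓕⁻ ψ)) ξ := by
    rw [hF]
    filter_upwards [Lp.coeFn_add (schwartzToL2 ν χ) (Complex.I • schwartzToL2 ν ψ),
      Lp.coeFn_smul Complex.I (schwartzToL2 ν ψ), coeFn_schwartzToL2 χ, coeFn_schwartzToL2 ψ]
      with ξ h1 h2 h3 h4
    rw [h1, Pi.add_apply, h2, Pi.smul_apply, h3, h4, hψ', smul_eq_mul]
    have := hne ξ
    field_simp
    ring
  refine ⟨𝓕⁻ ψ, mem_fourierMultiplier_domain hd, ?_⟩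
  apply (fourierL2 ν).injective
  have h3 := Lp.ext ((coeFn_fourier_fourierMultiplier
    ⟨_, mem_fourierMultiplier_domain hd⟩).trans hd.symm)
  rw [map_sub, h3, map_smul, hF, LinearIsometryEquiv.apply_symm_apply, add_sub_cancel_right]

/-- The approximation is made for `(g(D) - i)u`, by inverse transforms of compactly supported
functions. The resolvent carries it back, which gives convergence in the graph norm. -/
theorem exists_schwartz_approx {g : E ν → ℝ} (hg : ContDiff ℝ (⊤ : ℕ∞) g)
    (u : (fourierMultiplier g).domain) : ∃ x : ℕ → (fourierMultiplier g).domain,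
      (∀ n, ∃ φ : 𝓢(E ν, ℂ), (x n : L2 ν) = schwartzToL2 ν φ) ∧
      Tendsto (fun n => (x n : L2 ν)) atTop (𝓝 u) ∧
      Tendsto (fun n => fourierMultiplier g (x n)) atTop (𝓝 (fourierMultiplier g u)) := by
  have hI : Complex.I.im ≠ 0 := by simp
  obtain ⟨R, hR⟩ := (isSymm_fourierMultiplier g).exists_isResolventAt hI
    (fourierMultiplier_surjective hg.continuous hI)
  set f := fourierMultiplier g u - Complex.I • (u : L2 ν) with hf
  choose ψ hψ1 hψ2 using fun n : ℕ => exists_compactly_supported_schwartz_near (fourierL2 ν f)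
    (Nat.one_div_pos_of_nat (α := ℝ) (n := n))
  have hlim : Tendsto (fun n => schwartzToL2 ν (ψ n)) atTop (𝓝 (fourierL2 ν f)) := by
    rw [tendsto_iff_norm_sub_tendsto_zero]
    exact squeeze_zero (fun _ => norm_nonneg _) hψ2 tendsto_one_div_add_atTop_nhds_zero_nat
  choose φ hφ hφ' using fun n => exists_schwartz_resolvent hg (ψ n) (hψ1 n)
  have hlim' : Tendsto (fun n => (fourierL2 ν).symm (schwartzToL2 ν (ψ n))) atTop (𝓝 f) := by
    have := ((fourierL2 ν).symm.continuous.tendsto _).comp hlim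
    rwa [LinearIsometryEquiv.symm_apply_apply] at this
  have hx : ∀ n, schwartzToL2 ν (φ n) = R ((fourierL2 ν).symm (schwartzToL2 ν (ψ n))) := fun n => by
    rw [← hφ']
    exact (hR.2 ⟨_, hφ n⟩).symm
  have h1 : Tendsto (fun n => schwartzToL2 ν (φ n)) atTop (𝓝 (u : L2 ν)) := by
    simp only [hx]
    have := (R.continuous.tendsto _).comp hlim'
    rwa [hf, hR.2 u] at this
  refine ⟨fun n => ⟨_, hφ n⟩, fun n => ⟨φ n, rfl⟩, h1, ?_⟩
  have h2 : ∀ n, fourierMultiplier g ⟨_, hφ n⟩ =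
      (fourierL2 ν).symm (schwartzToL2 ν (ψ n)) + Complex.I • schwartzToL2 ν (φ n) := fun n => by
    exact eq_add_of_sub_eq (hφ' n)
  simp only [h2]
  have h3 := hlim'.add (h1.const_smul Complex.I)
  rwa [hf, sub_add_cancel] at h3

variable {ρ : L2 ν}

theorem hamiltonian_core (hΩ : IsMatterDispersion s Ω) (hω : IsFieldDispersion s ω) (P : E ν)
    (v : E ν → E ν) (u : (hamiltonian Ω ω ρ P).domain) : ∃ x : ℕ → (hamiltonian Ω ω ρ P).domain,
      (∀ n, (x n : FiberSpace ν) ∈ (diagonal 0 (conjugateOneParticle v)).domain) ∧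
      Tendsto (fun n => (x n : FiberSpace ν)) atTop (𝓝 u) ∧
      Tendsto (fun n => hamiltonian Ω ω ρ P (x n)) atTop (𝓝 (hamiltonian Ω ω ρ P u)) := by
  obtain ⟨x, hx, hx1, hx2⟩ := exists_schwartz_approx (contDiff_energy hΩ hω P)
    ⟨(u : FiberSpace ν).snd, u.2⟩
  have hmem : ∀ n, (WithLp.toLp 2 ((u : FiberSpace ν).fst, (x n : L2 ν)) : FiberSpace ν) ∈
      (hamiltonian Ω ω ρ P).domain := fun n => (x n).2
  refine ⟨fun n => ⟨_, hmem n⟩, fun n => ?_, ?_, ?_⟩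
  · obtain ⟨φ, hφ⟩ := hx n
    change (x n : L2 ν) ∈ (conjugateOneParticle v).domain
    rw [hφ]
    exact schwartzToL2_mem_domain v φ
  · exact ((WithLp.prod_continuous_toLp 2 ℂ (L2 ν)).tendsto _).comp
      (tendsto_const_nhds.prodMk_nhds hx1)
  · have h1 := (tendsto_const_nhds (x := ρ)).inner hx1 (𝕜 := ℂ)
    have h2 := h1.add_const (Ω P * (u : FiberSpace ν).fst : ℂ)
    have h3 := hx2.const_add ((u : FiberSpace ν).fst • ρ)
    exact ((WithLp.prod_continuous_toLp 2 ℂ (L2 ν)).tendsto _).comp (h2.prodMk_nhds h3)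

/-! ### Existence of the extension -/

theorem exists_commutatorSymbol (hΩ : IsMatterDispersion s Ω) (hω : IsFieldDispersion s ω)
    {P₀ P : E ν} (hP : ‖P - P₀‖ ≤ 1) : ∃ q : BoundedContinuousFunction (E ν) ℂ, ∀ ξ,
      q ξ * (1 + energy Ω ω P ((2 * Real.pi) • ξ) : ℝ) =
        ((⟪vectorField Ω ω P₀ ((2 * Real.pi) • ξ), vectorField Ω ω P ((2 * Real.pi) • ξ)⟫_ℝ : ℝ) :
          ℂ) := by
  obtain ⟨C, hC, hb⟩ := norm_mul_norm_vectorField_le hΩ hω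
  have hpos : ∀ ξ : E ν, 0 < 1 + energy Ω ω P ((2 * Real.pi) • ξ) := fun ξ => by
    linarith [energy_nonneg hΩ hω P ((2 * Real.pi) • ξ)]
  have c1 : Continuous fun ξ : E ν => vectorField Ω ω P₀ ((2 * Real.pi) • ξ) :=
    (continuous_vectorField_uncurry hΩ hω).comp (f := fun ξ : E ν => (P₀, (2 * Real.pi) • ξ))
      (by fun_prop)
  have c2 : Continuous fun ξ : E ν => vectorField Ω ω P ((2 * Real.pi) • ξ) :=
    (continuous_vectorField_uncurry hΩ hω).comp (f := fun ξ : E ν => (P, (2 * Real.pi) • ξ))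
      (by fun_prop)
  have c3 : Continuous fun ξ : E ν => energy Ω ω P ((2 * Real.pi) • ξ) :=
    (continuous_energy hΩ hω P).comp (by fun_prop)
  refine ⟨BoundedContinuousFunction.ofNormedAddCommGroup (fun ξ =>
    ((⟪vectorField Ω ω P₀ ((2 * Real.pi) • ξ), vectorField Ω ω P ((2 * Real.pi) • ξ)⟫_ℝ /
      (1 + energy Ω ω P ((2 * Real.pi) • ξ)) : ℝ) : ℂ))
    (Complex.continuous_ofReal.comp ((c1.inner c2).div (continuous_const.add c3)
      fun ξ => (hpos ξ).ne')) C (fun ξ => ?_), fun ξ => ?_⟩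
  · rw [Complex.norm_real, norm_div, Real.norm_of_nonneg (hpos ξ).le, div_le_iff₀ (hpos ξ)]
    exact (norm_inner_le_norm _ _).trans (hb P₀ P _ hP)
  · change ((_ / _ : ℝ) : ℂ) * _ = _
    rw [← Complex.ofReal_mul, div_mul_cancel₀ _ (hpos ξ).ne']

/-- The second component of an element of the domain of the Hamiltonian. -/
def sndDomain (Ω ω : E ν → ℝ) (ρ : L2 ν) (P : E ν) :
    (hamiltonian Ω ω ρ P).domain →ₗ[ℂ] (fourierMultiplier (energy Ω ω P)).domain :=
  LinearMap.codRestrict _ (WithLp.sndₗ (p := 2) (𝕜 := ℂ) (α := ℂ) (β := L2 ν) ∘ₗ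
    (hamiltonian Ω ω ρ P).domain.subtype) fun u => u.2

theorem coe_sndDomain (P : E ν) (u : (hamiltonian Ω ω ρ P).domain) :
    (sndDomain Ω ω ρ P u : L2 ν) = (u : FiberSpace ν).snd := rfl

/-- The extension of the commutator form, in terms of the symbol `q` and of `η`, which represents
the commutator of the interaction. -/
def commutatorForm (Ω ω : E ν → ℝ) (ρ η : L2 ν) (P : E ν)
    (q : BoundedContinuousFunction (E ν) ℂ) :
    (hamiltonian Ω ω ρ P).domain →ₗ⋆[ℂ] (hamiltonian Ω ω ρ P).domain →ₗ[ℂ] ℂ :=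
  LinearMap.mk₂'ₛₗ (starRingEnd ℂ) (RingHom.id ℂ)
    (fun u w => ⟪fourierL2 ν (sndDomain Ω ω ρ P u), mulOp q (fourierL2 ν (sndDomain Ω ω ρ P w) +
        fourierL2 ν (fourierMultiplier (energy Ω ω P) (sndDomain Ω ω ρ P w)))⟫_ℂ +
      conj (u : FiberSpace ν).fst * ⟪η, (sndDomain Ω ω ρ P w : L2 ν)⟫_ℂ +
      ⟪(sndDomain Ω ω ρ P u : L2 ν), η⟫_ℂ * (w : FiberSpace ν).fst)
    (fun u u' w => by
      simp only [map_add, Submodule.coe_add, WithLp.add_fst, inner_add_left]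
      ring)
    (fun c u w => by
      simp only [map_smul, Submodule.coe_smul, WithLp.smul_fst, inner_smul_left, smul_eq_mul,
        map_mul]
      ring)
    (fun u w w' => by
      simp only [map_add, LinearPMap.map_add, Submodule.coe_add, WithLp.add_fst, inner_add_right]
      ring)
    (fun c u w => by
      simp only [map_smul, LinearPMap.map_smul, map_add, Submodule.coe_smul, WithLp.smul_fst,
        inner_smul_right, inner_add_right, smul_eq_mul, RingHom.id_apply]
      ring)

theorem commutatorForm_apply (η : L2 ν) (P : E ν) (q : BoundedContinuousFunction (E ν) ℂ)
    (u w : (hamiltonian Ω ω ρ P).domain) : commutatorForm Ω ω ρ η P q u w =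
      ⟪fourierL2 ν (sndDomain Ω ω ρ P u), mulOp q (fourierL2 ν (sndDomain Ω ω ρ P w) +
        fourierL2 ν (fourierMultiplier (energy Ω ω P) (sndDomain Ω ω ρ P w)))⟫_ℂ +
      conj (u : FiberSpace ν).fst * ⟪η, (sndDomain Ω ω ρ P w : L2 ν)⟫_ℂ +
      ⟪(sndDomain Ω ω ρ P u : L2 ν), η⟫_ℂ * (w : FiberSpace ν).fst := rfl

theorem norm_commutatorForm_le (η : L2 ν) (P : E ν) (q : BoundedContinuousFunction (E ν) ℂ) :
    ∃ M : ℝ, ∀ u w : (hamiltonian Ω ω ρ P).domain, ‖commutatorForm Ω ω ρ η P q u w‖ ≤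
      M * (‖(u : FiberSpace ν)‖ + ‖hamiltonian Ω ω ρ P u‖) *
        (‖(w : FiberSpace ν)‖ + ‖hamiltonian Ω ω ρ P w‖) := by
  refine ⟨‖mulOp q‖ * (1 + ‖ρ‖) + 2 * ‖η‖, fun u w => ?_⟩
  have f1 : ∀ u : FiberSpace ν, ‖u.fst‖ ≤ ‖u‖ := fun u => WithLp.norm_fst_le _ u
  have f2 : ∀ u : FiberSpace ν, ‖u.snd‖ ≤ ‖u‖ := fun u => WithLp.norm_snd_le _ u
  -- The interaction is bounded, so the graph norm of `H(P)` controls that of the free energy.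
  have hE : ‖fourierMultiplier (energy Ω ω P) (sndDomain Ω ω ρ P w)‖ ≤
      ‖hamiltonian Ω ω ρ P w‖ + ‖(w : FiberSpace ν)‖ * ‖ρ‖ := by
    have h1 : fourierMultiplier (energy Ω ω P) (sndDomain Ω ω ρ P w) =
        (hamiltonian Ω ω ρ P w).snd - (w : FiberSpace ν).fst • ρ := by
      rw [hamiltonian_snd, add_sub_cancel_left]
      rfl
    rw [h1]
    refine (norm_sub_le _ _).trans (add_le_add (f2 _) ?_)
    rw [norm_smul]
    exact mul_le_mul_of_nonneg_right (f1 _) (norm_nonneg _)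
  rw [commutatorForm_apply]
  set a := ‖(u : FiberSpace ν)‖
  set b := ‖(w : FiberSpace ν)‖
  set a' := ‖hamiltonian Ω ω ρ P u‖
  set b' := ‖hamiltonian Ω ω ρ P w‖
  have ha : 0 ≤ a := norm_nonneg _
  have hb : 0 ≤ b := norm_nonneg _
  have ha' : 0 ≤ a' := norm_nonneg _
  have hb' : 0 ≤ b' := norm_nonneg _
  have hab : a * b ≤ (a + a') * (b + b') :=
    mul_le_mul (by linarith) (by linarith) hb (by linarith)
  have t1 : ‖⟪fourierL2 ν (sndDomain Ω ω ρ P u), mulOp q (fourierL2 ν (sndDomain Ω ω ρ P w) +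
        fourierL2 ν (fourierMultiplier (energy Ω ω P) (sndDomain Ω ω ρ P w)))⟫_ℂ‖ ≤
      ‖mulOp q‖ * (1 + ‖ρ‖) * ((a + a') * (b + b')) := by
    refine (norm_inner_le_norm _ _).trans ?_
    rw [LinearIsometryEquiv.norm_map]
    have h1 : ‖mulOp q (fourierL2 ν (sndDomain Ω ω ρ P w) +
        fourierL2 ν (fourierMultiplier (energy Ω ω P) (sndDomain Ω ω ρ P w)))‖ ≤
        ‖mulOp q‖ * ((1 + ‖ρ‖) * (b + b')) := by
      refine ((mulOp q).le_opNorm _).trans (mul_le_mul_of_nonneg_left ?_ (norm_nonneg _))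
      refine (norm_add_le _ _).trans ?_
      rw [LinearIsometryEquiv.norm_map, LinearIsometryEquiv.norm_map]
      have := f2 w
      rw [← coe_sndDomain] at this
      nlinarith [norm_nonneg ρ, mul_nonneg (norm_nonneg ρ) hb']
    have h2 : ‖(sndDomain Ω ω ρ P u : L2 ν)‖ ≤ a + a' := (f2 u).trans (by linarith)
    refine (mul_le_mul h2 h1 (norm_nonneg _) (by linarith)).trans (le_of_eq (by ring))
  have t2 : ‖conj (u : FiberSpace ν).fst * ⟪η, (sndDomain Ω ω ρ P w : L2 ν)⟫_ℂ‖ ≤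
      ‖η‖ * ((a + a') * (b + b')) := by
    rw [norm_mul, RCLike.norm_conj]
    refine (mul_le_mul (f1 u) ((norm_inner_le_norm _ _).trans
      (mul_le_mul_of_nonneg_left (f2 w) (norm_nonneg η))) (norm_nonneg _) ha).trans ?_
    have := mul_le_mul_of_nonneg_left hab (norm_nonneg η)
    linarith
  have t3 : ‖⟪(sndDomain Ω ω ρ P u : L2 ν), η⟫_ℂ * (w : FiberSpace ν).fst‖ ≤
      ‖η‖ * ((a + a') * (b + b')) := by
    rw [norm_mul]
    refine (mul_le_mul ((norm_inner_le_norm _ _).trans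
      (mul_le_mul_of_nonneg_right (f2 u) (norm_nonneg η))) (f1 w) (norm_nonneg _)
      (by positivity)).trans ?_
    have := mul_le_mul_of_nonneg_left hab (norm_nonneg η)
    linarith
  refine (norm_add₃_le).trans ((add_le_add (add_le_add t1 t2) t3).trans (le_of_eq (by ring)))

/-- The diagonal part is `commutator_multiplier`: differentiating the energy at `2πξ` gives a factor
`2π` that cancels its `1/(2π)`. The off-diagonal part is `hη` and its conjugate. The entry `Ω(P)`
drops out because the conjugate operator vanishes on the first component. -/
theorem isCommutatorExtension_commutatorForm (hΩ : IsMatterDispersion s Ω)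
    (hω : IsFieldDispersion s ω) {P₀ P : E ν} {η : L2 ν}
    (hη : ∀ w : (conjugateOneParticle (vectorField Ω ω P₀)).domain,
      ⟪ρ, Complex.I • conjugateOneParticle (vectorField Ω ω P₀) w⟫_ℂ = ⟪η, (w : L2 ν)⟫_ℂ)
    {q : BoundedContinuousFunction (E ν) ℂ}
    (hq : ∀ ξ, q ξ * (1 + energy Ω ω P ((2 * Real.pi) • ξ) : ℝ) =
        ((⟪vectorField Ω ω P₀ ((2 * Real.pi) • ξ), vectorField Ω ω P ((2 * Real.pi) • ξ)⟫_ℝ : ℝ) :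
          ℂ)) :
    IsCommutatorExtension (hamiltonian Ω ω ρ P) (conjugateOperator Ω ω P₀)
      (commutatorForm Ω ω ρ η P q) := by
  refine ⟨norm_commutatorForm_le η P q, fun u w hu hu' hw hw' => ?_⟩
  obtain ⟨C, hC, hb⟩ := norm_vectorField_sq_le hΩ hω
  have hC' : ∀ (j : Fin ν) (ξ : E ν),
      |partialDeriv j (fun ξ => energy Ω ω P ((2 * Real.pi) • ξ)) ξ| ≤
        2 * Real.pi * (1 + C) * (1 + energy Ω ω P ((2 * Real.pi) • ξ)) := by
    intro j ξ
    rw [partialDeriv_energy hΩ hω, abs_mul, abs_of_pos Real.two_pi_pos, mul_assoc (2 * Real.pi)]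
    refine mul_le_mul_of_nonneg_left ?_ (by positivity)
    have h1 := hb P ((2 * Real.pi) • ξ)
    have h2 : |component (vectorField Ω ω P) j ξ| ≤ ‖vectorField Ω ω P ((2 * Real.pi) • ξ)‖ :=
      PiLp.norm_apply_le (vectorField Ω ω P ((2 * Real.pi) • ξ)) j
    have h3 := energy_nonneg hΩ hω P ((2 * Real.pi) • ξ)
    nlinarith [sq_nonneg (‖vectorField Ω ω P ((2 * Real.pi) • ξ)‖ - 1)]
  have hq' : ∀ ξ, q ξ * (1 + energy Ω ω P ((2 * Real.pi) • ξ) : ℝ) = (1 / (2 * Real.pi)) *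
      ∑ j, (component (vectorField Ω ω P₀) j ξ : ℂ) *
        ((partialDeriv j (fun ξ => energy Ω ω P ((2 * Real.pi) • ξ)) ξ : ℝ) : ℂ) := by
    intro ξ
    rw [hq, PiLp.inner_apply, Complex.ofReal_sum, Finset.mul_sum]
    refine Finset.sum_congr rfl fun j _ => ?_
    rw [partialDeriv_energy hΩ hω, component, component]
    have : (Real.pi : ℂ) ≠ 0 := by exact_mod_cast Real.pi_ne_zero
    simp only [RCLike.inner_apply, conj_trivial]
    push_cast
    field_simp
  have key := commutator_multiplier (isAdmissibleField_vectorField hΩ hω P₀)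
    (e := fun ξ => energy Ω ω P ((2 * Real.pi) • ξ))
    ((contDiff_energy hΩ hω P).comp (contDiff_id.const_smul _))
    (fun ξ => energy_nonneg hΩ hω P _) (C := 2 * Real.pi * (1 + C)) hC' (q := q) hq'
    ⟨u.snd, hu'⟩ ⟨w.snd, hw'⟩
    (coeFn_fourier_fourierMultiplier (g := energy Ω ω P) ⟨u.snd, hu⟩)
    (coeFn_fourier_fourierMultiplier (g := energy Ω ω P) ⟨w.snd, hw⟩)
  have e1 := hη ⟨u.snd, hu'⟩
  have e2 := hη ⟨w.snd, hw'⟩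
  rw [LinearIsometryEquiv.inner_map_map, LinearIsometryEquiv.inner_map_map] at key
  rw [commutatorForm_apply]
  change ⟪fourierL2 ν u.snd, mulOp q (fourierL2 ν w.snd +
      fourierL2 ν (fourierMultiplier (energy Ω ω P) ⟨w.snd, hw⟩))⟫_ℂ +
    conj u.fst * ⟪η, w.snd⟫_ℂ + ⟪u.snd, η⟫_ℂ * w.fst = _
  rw [inner_neg_left, sub_neg_eq_add, fiber_inner, fiber_inner, ← key]
  have s1 : (Complex.I • conjugateOperator Ω ω P₀ ⟨w, hw'⟩).fst = 0 := by
    change Complex.I * (0 * w.fst) = 0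
    ring
  have s2 : (Complex.I • conjugateOperator Ω ω P₀ ⟨u, hu'⟩).fst = 0 := by
    change Complex.I * (0 * u.fst) = 0
    ring
  have s3 : (Complex.I • conjugateOperator Ω ω P₀ ⟨w, hw'⟩).snd =
      Complex.I • conjugateOneParticle (vectorField Ω ω P₀) ⟨w.snd, hw'⟩ := rfl
  have s4 : (Complex.I • conjugateOperator Ω ω P₀ ⟨u, hu'⟩).snd =
      Complex.I • conjugateOneParticle (vectorField Ω ω P₀) ⟨u.snd, hu'⟩ := rfl
  have e3 : ⟪Complex.I • conjugateOneParticle (vectorField Ω ω P₀) ⟨u.snd, hu'⟩, ρ⟫_ℂ =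
      ⟪u.snd, η⟫_ℂ := by
    rw [← inner_conj_symm, e1, inner_conj_symm]
  rw [s1, s2, s3, s4, hamiltonian_snd, hamiltonian_snd, inner_add_left, inner_add_right,
    inner_smul_left ρ, inner_smul_right _ ρ, e2, e3]
  simp only [mul_zero, map_zero, zero_mul, zero_add]
  ring

/-! ### Lower bound on the commutator form -/

theorem re_inner_eq_integral (f g : L2 ν) : (⟪f, g⟫_ℂ).re = ∫ ξ, (conj (f ξ) * g ξ).re := by
  have h : Integrable (fun ξ => conj (f ξ) * g ξ) volume := by
    refine (L2.integrable_inner (𝕜 := ℂ) f g).congr (ae_of_all _ fun ξ => ?_)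
    simp [mul_comm]
  rw [inner_L2_eq]
  exact (integral_re h).symm

theorem integrable_re_inner (f g : L2 ν) :
    Integrable (fun ξ => (conj (f ξ) * g ξ).re) volume := by
  have h : Integrable (fun ξ => conj (f ξ) * g ξ) volume := by
    refine (L2.integrable_inner (𝕜 := ℂ) f g).congr (ae_of_all _ fun ξ => ?_)
    simp [mul_comm]
  exact h.re

/-- On the Fourier side the claim is the pointwise inequality `hlow` multiplied by `|û|²` and
integrated. -/
theorem re_inner_symbol_ge {P₀ P : E ν} {l₀ c K : ℝ}
    (hlow : ∀ k, c - K * (energy Ω ω P k - l₀) ^ 2 ≤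
      ⟪vectorField Ω ω P₀ k, vectorField Ω ω P k⟫_ℝ)
    {q : BoundedContinuousFunction (E ν) ℂ}
    (hq : ∀ ξ, q ξ * (1 + energy Ω ω P ((2 * Real.pi) • ξ) : ℝ) =
        ((⟪vectorField Ω ω P₀ ((2 * Real.pi) • ξ), vectorField Ω ω P ((2 * Real.pi) • ξ)⟫_ℝ : ℝ) :
          ℂ)) (u : (fourierMultiplier (energy Ω ω P)).domain) :
    c * ‖(u : L2 ν)‖ ^ 2 - K * ‖fourierMultiplier (energy Ω ω P) u - (l₀ : ℂ) • (u : L2 ν)‖ ^ 2 ≤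
      (⟪fourierL2 ν u, mulOp q (fourierL2 ν u +
        fourierL2 ν (fourierMultiplier (energy Ω ω P) u))⟫_ℂ).re := by
  set y := fourierL2 ν u with hy
  set z := fourierL2 ν (fourierMultiplier (energy Ω ω P) u - (l₀ : ℂ) • (u : L2 ν)) with hz
  have n1 : ‖(u : L2 ν)‖ ^ 2 = (⟪y, y⟫_ℂ).re := by
    rw [inner_self_eq_ofReal, Complex.ofReal_re, hy, LinearIsometryEquiv.norm_map]
  have n2 : ‖fourierMultiplier (energy Ω ω P) u - (l₀ : ℂ) • (u : L2 ν)‖ ^ 2 = (⟪z, z⟫_ℂ).re := by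
    rw [inner_self_eq_ofReal, Complex.ofReal_re, hz, LinearIsometryEquiv.norm_map]
  rw [n1, n2, re_inner_eq_integral, re_inner_eq_integral, re_inner_eq_integral,
    ← integral_const_mul, ← integral_const_mul,
    ← integral_sub ((integrable_re_inner _ _).const_mul _) ((integrable_re_inner _ _).const_mul _)]
  refine integral_mono_ae (((integrable_re_inner _ _).const_mul _).sub
    ((integrable_re_inner _ _).const_mul _)) (integrable_re_inner _ _) ?_
  have hz' : z = fourierL2 ν (fourierMultiplier (energy Ω ω P) u) - (l₀ : ℂ) • y := by
    rw [hz, map_sub, map_smul]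
  filter_upwards [coeFn_fourier_fourierMultiplier u,
    coeFn_mulOp q (y + fourierL2 ν (fourierMultiplier (energy Ω ω P) u)),
    Lp.coeFn_add y (fourierL2 ν (fourierMultiplier (energy Ω ω P) u)),
    Lp.coeFn_sub (fourierL2 ν (fourierMultiplier (energy Ω ω P) u)) ((l₀ : ℂ) • y),
    Lp.coeFn_smul (l₀ : ℂ) y] with ξ h1 h2 h3 h4 h5
  rw [hz', h2, h3, h4, Pi.add_apply, Pi.sub_apply, h5, Pi.smul_apply, h1, smul_eq_mul, ← hy]
  set e := energy Ω ω P ((2 * Real.pi) • ξ) with he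
  have i1 : conj (y ξ) * (q ξ * (y ξ + (e : ℂ) * y ξ)) =
      ((⟪vectorField Ω ω P₀ ((2 * Real.pi) • ξ), vectorField Ω ω P ((2 * Real.pi) • ξ)⟫_ℝ *
        Complex.normSq (y ξ) : ℝ) : ℂ) := by
    rw [Complex.ofReal_mul, ← hq, Complex.normSq_eq_conj_mul_self]
    push_cast
    ring
  have i2 : conj ((e : ℂ) * y ξ - (l₀ : ℂ) * y ξ) * ((e : ℂ) * y ξ - (l₀ : ℂ) * y ξ) =
      (((e - l₀) ^ 2 * Complex.normSq (y ξ) : ℝ) : ℂ) := by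
    rw [Complex.ofReal_mul, Complex.normSq_eq_conj_mul_self]
    simp only [map_sub, map_mul, Complex.conj_ofReal]
    push_cast
    ring
  rw [i1, i2, ← Complex.normSq_eq_conj_mul_self, Complex.ofReal_re, Complex.ofReal_re,
    Complex.ofReal_re]
  have := mul_le_mul_of_nonneg_right (hlow ((2 * Real.pi) • ξ)) (Complex.normSq_nonneg (y ξ))
  rw [← he] at this
  linarith

/-- The extension of the commutator form exists, is unique, and is bounded from below. -/
theorem exists_commutatorExtension (hΩ : IsMatterDispersion s Ω) (hω : IsFieldDispersion s ω)
    (hρ : IsCoupling ρ) {P₀ : E ν} {l₀ : ℝ} (hθ : l₀ ∉ thresholds Ω ω P₀) :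
    ∃ (η : L2 ν) (c K : ℝ), 0 < c ∧ ∀ P, ‖P - P₀‖ ≤ c →
      ∃ B : (hamiltonian Ω ω ρ P).domain →ₗ⋆[ℂ] (hamiltonian Ω ω ρ P).domain →ₗ[ℂ] ℂ,
        (IsCommutatorExtension (hamiltonian Ω ω ρ P) (conjugateOperator Ω ω P₀) B ∧
          ∀ B', IsCommutatorExtension (hamiltonian Ω ω ρ P) (conjugateOperator Ω ω P₀) B' →
            B' = B) ∧
        ∀ u : (hamiltonian Ω ω ρ P).domain,
          c * ‖(u : FiberSpace ν).snd‖ ^ 2 -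
            K * ‖fourierMultiplier (energy Ω ω P) (sndDomain Ω ω ρ P u) -
              (l₀ : ℂ) • (u : FiberSpace ν).snd‖ ^ 2 +
            2 * (conj (u : FiberSpace ν).fst * ⟪η, (u : FiberSpace ν).snd⟫_ℂ).re ≤
          (B u u).re := by
  obtain ⟨η, hη⟩ := exists_commutator_coupling hΩ hω hρ P₀
  obtain ⟨c, K, hc, hc1, -, hlow⟩ := inner_vectorField_ge hΩ hω hθ
  refine ⟨η, c, K, hc, fun P hP => ?_⟩
  obtain ⟨q, hq⟩ := exists_commutatorSymbol hΩ hω (hP.trans hc1)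
  have hB := isCommutatorExtension_commutatorForm hΩ hω hη hq
  refine ⟨commutatorForm Ω ω ρ η P q, ⟨hB, fun B' hB' =>
    hB.unique (hamiltonian_core hΩ hω P (vectorField Ω ω P₀)) hB'⟩, fun u => ?_⟩
  have h1 := re_inner_symbol_ge (fun k => hlow P k hP) hq (sndDomain Ω ω ρ P u)
  rw [commutatorForm_apply, Complex.add_re, Complex.add_re]
  have h2 : (⟪(sndDomain Ω ω ρ P u : L2 ν), η⟫_ℂ * (u : FiberSpace ν).fst).re =
      (conj (u : FiberSpace ν).fst * ⟪η, (u : FiberSpace ν).snd⟫_ℂ).re := by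
    rw [← Complex.conj_re, map_mul, inner_conj_symm, mul_comm]
    rfl
  rw [h2]
  rw [coe_sndDomain] at h1 ⊢
  linarith

/-! ### Weak convergence -/

section WeakLimits

variable {K : Type*} [NormedAddCommGroup K] [InnerProductSpace ℂ K]

/-- Weak convergence of `u` to `x` along `l`. -/
def WeakTendsto (u : ℕ → K) (l : Filter ℕ) (x : K) : Prop :=
  ∀ φ, Tendsto (fun n => ⟪φ, u n⟫_ℂ) l (𝓝 ⟪φ, x⟫_ℂ)

/-- Banach–Alaoglu in the dual, transported by the Riesz isometry. Working along an ultrafilter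
replaces the extraction of subsequences. -/
theorem exists_weakTendsto [CompleteSpace K] {u : ℕ → K} {M : ℝ} (hu : ∀ n, ‖u n‖ ≤ M)
    (𝒰 : Ultrafilter ℕ) : ∃ x, WeakTendsto u 𝒰 x := by
  have hc := WeakDual.isCompact_closedBall (𝕜 := ℂ) (E := K) 0 M
  let d : ℕ → WeakDual ℂ K := fun n => StrongDual.toWeakDual (InnerProductSpace.toDual ℂ K (u n))
  have hd : ∀ n, d n ∈ (WeakDual.toStrongDual ⁻¹' Metric.closedBall (0 : StrongDual ℂ K) M) := by
    intro n
    rw [Set.mem_preimage, mem_closedBall_zero_iff]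
    change ‖InnerProductSpace.toDual ℂ K (u n)‖ ≤ M
    rw [LinearIsometryEquiv.norm_map]
    exact hu n
  obtain ⟨y, -, hy⟩ := hc.ultrafilter_le_nhds (𝒰.map d)
    (by
      rw [Ultrafilter.coe_map]
      exact tendsto_principal.2 (Eventually.of_forall hd))
  rw [Ultrafilter.coe_map] at hy
  refine ⟨(InnerProductSpace.toDual ℂ K).symm (WeakDual.toStrongDual y), fun φ => ?_⟩
  have h := ((WeakDual.eval_continuous φ).tendsto y).comp hy
  have h2 := (Complex.continuous_conj.tendsto _).comp h
  rw [← inner_conj_symm, InnerProductSpace.toDual_symm_apply]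
  refine h2.congr fun n => ?_
  rw [Function.comp_apply, ← inner_conj_symm]
  rfl

theorem WeakTendsto.add {u w : ℕ → K} {l : Filter ℕ} {x y : K} (hu : WeakTendsto u l x)
    (hw : WeakTendsto w l y) : WeakTendsto (fun n => u n + w n) l (x + y) := fun φ => by
  simp only [inner_add_right]
  exact (hu φ).add (hw φ)

theorem WeakTendsto.smul {u : ℕ → K} {l : Filter ℕ} {x : K} (hu : WeakTendsto u l x)
    {a : ℕ → ℂ} {b : ℂ} (ha : Tendsto a l (𝓝 b)) : WeakTendsto (fun n => a n • u n) l (b • x) :=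
  fun φ => by
    simp only [inner_smul_right]
    exact ha.mul (hu φ)

theorem weakTendsto_of_tendsto {u : ℕ → K} {l : Filter ℕ} {x : K} (hu : Tendsto u l (𝓝 x)) :
    WeakTendsto u l x := fun _ => tendsto_const_nhds.inner hu

/-- Inner products of strongly and weakly convergent sequences converge. -/
theorem WeakTendsto.inner {u ψ : ℕ → K} {l : Filter ℕ} {x φ : K} (hu : WeakTendsto u l x)
    {M : ℝ} (hM : ∀ n, ‖u n‖ ≤ M) (hψ : Tendsto ψ l (𝓝 φ)) :
    Tendsto (fun n => ⟪ψ n, u n⟫_ℂ) l (𝓝 ⟪φ, x⟫_ℂ) := by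
  have h1 : Tendsto (fun n => ⟪ψ n - φ, u n⟫_ℂ) l (𝓝 0) := by
    refine squeeze_zero_norm (a := fun n => ‖ψ n - φ‖ * M) (fun n => ?_) ?_
    · exact (norm_inner_le_norm _ _).trans (mul_le_mul_of_nonneg_left (hM n) (norm_nonneg _))
    · have := (tendsto_iff_norm_sub_tendsto_zero.1 hψ).mul_const M
      rwa [zero_mul] at this
  have h2 := h1.add (hu φ)
  rw [zero_add] at h2
  refine h2.congr fun n => ?_
  rw [← inner_add_left, sub_add_cancel]

theorem WeakTendsto.map {K' : Type*} [NormedAddCommGroup K'] [InnerProductSpace ℂ K']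
    {u : ℕ → K} {l : Filter ℕ} {x : K} (hu : WeakTendsto u l x) (U : K ≃ₗᵢ[ℂ] K') :
    WeakTendsto (fun n => U (u n)) l (U x) := fun φ => by
  have := hu (U.symm φ)
  simpa only [← U.inner_map_map, U.apply_symm_apply] using this

end WeakLimits

/-! ### Stability of the resolvents of the fibers -/

theorem fourier_eq_mulOp_resolventSymbol {g : E ν → ℝ} (hg : Continuous g) {z : ℂ} (hz : z.im ≠ 0)
    (w : (fourierMultiplier g).domain) :
    fourierL2 ν w = mulOp (resolventSymbol g hg z hz)
      (fourierL2 ν (fourierMultiplier g w - z • (w : L2 ν))) := by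
  apply Lp.ext
  rw [map_sub, map_smul]
  filter_upwards [coeFn_mulOp (resolventSymbol g hg z hz)
    (fourierL2 ν (fourierMultiplier g w) - z • fourierL2 ν w),
    Lp.coeFn_sub (fourierL2 ν (fourierMultiplier g w)) (z • fourierL2 ν w),
    Lp.coeFn_smul z (fourierL2 ν (w : L2 ν)), coeFn_fourier_fourierMultiplier w] with ξ h1 h2 h3 h4
  rw [h1, h2, Pi.sub_apply, h3, h4, Pi.smul_apply, smul_eq_mul, resolventSymbol_apply, ← sub_mul]
  have : (((g ((2 * Real.pi) • ξ) : ℝ) : ℂ) - z) ≠ 0 :=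
    fun h => hz (by simpa using congrArg Complex.im h)
  field_simp

/-- Weak limits of solutions of `(g_n(D) - z) w_n = f_n` solve the limiting equation. -/
theorem weakTendsto_fourierMultiplier {g : ℕ → E ν → ℝ} {g₀ : E ν → ℝ} (hg : ∀ n, Continuous (g n))
    (hg₀ : Continuous g₀) (hlim : ∀ k, Tendsto (fun n => g n k) atTop (𝓝 (g₀ k)))
    {l : Filter ℕ} [l.NeBot] (hl : l ≤ atTop) (w : ∀ n, (fourierMultiplier (g n)).domain) {z : ℂ}
    (hz : z.im ≠ 0) {M : ℝ} (hM : ∀ n, ‖fourierMultiplier (g n) (w n) - z • (w n : L2 ν)‖ ≤ M)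
    {y f : L2 ν} (hw : WeakTendsto (fun n => (w n : L2 ν)) l y)
    (hf : WeakTendsto (fun n => fourierMultiplier (g n) (w n) - z • (w n : L2 ν)) l f) :
    ∃ h : y ∈ (fourierMultiplier g₀).domain, fourierMultiplier g₀ ⟨y, h⟩ - z • y = f := by
  obtain ⟨v, hv⟩ := fourierMultiplier_surjective hg₀ hz f
  have hz' : (conj z).im ≠ 0 := by simpa using hz
  have key : fourierL2 ν y = fourierL2 ν v := by
    refine ext_inner_left ℂ fun φ => ?_
    have h1 := hw.map (fourierL2 ν) φ
    refine tendsto_nhds_unique h1 ?_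
    rw [fourier_eq_mulOp_resolventSymbol hg₀ hz v, hv]
    have e : ∀ (g : E ν → ℝ) (hg : Continuous g) (ψ : L2 ν),
        ⟪φ, mulOp (resolventSymbol g hg z hz) ψ⟫_ℂ =
          ⟪mulOp (resolventSymbol g hg (conj z) hz') φ, ψ⟫_ℂ := by
      intro g hg ψ
      refine (inner_mulOp_left _ _ (fun ξ => ?_) _ _).symm
      simp [resolventSymbol_apply]
    -- The adjoint resolvents converge strongly on the fixed `φ`; pairing them with the weakly
    -- convergent right-hand sides identifies the limit.
    have h2 : Tendsto (fun n => mulOp (resolventSymbol (g n) (hg n) (conj z) hz') φ) l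
        (𝓝 (mulOp (resolventSymbol g₀ hg₀ (conj z) hz') φ)) := by
      refine (tendsto_mulOp (C := |(conj z).im|⁻¹)
        (fun n ξ => norm_resolventSymbol_le _ _ _ hz' ξ) (fun ξ => ?_) φ).mono_left hl
      simp only [resolventSymbol_apply]
      refine Tendsto.inv₀ ?_ fun h => hz' (by simpa using congrArg Complex.im h)
      exact ((Complex.continuous_ofReal.tendsto _).comp (hlim _)).sub_const _
    have h3 := (hf.map (fourierL2 ν)).inner (M := M) (fun n => by
      rw [LinearIsometryEquiv.norm_map]; exact hM n) h2
    rw [e]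
    refine h3.congr fun n => ?_
    rw [← e, ← fourier_eq_mulOp_resolventSymbol (hg n) hz (w n)]
  have key' : y = v := (fourierL2 ν).injective key
  subst key'
  exact ⟨v.2, hv⟩

/-! ### Positivity near the spectral value -/

theorem norm_fiber_sq (u : FiberSpace ν) : ‖u‖ ^ 2 = ‖u.fst‖ ^ 2 + ‖u.snd‖ ^ 2 :=
  WithLp.prod_norm_sq_eq_of_L2 u

/-- If `l₀` is not an eigenvalue of `H(P₀)`, normalized approximate eigenvectors of nearby fibers
converge weakly to zero. -/
theorem weakTendsto_zero_of_approximate_eigenvector (hΩ : IsMatterDispersion s Ω)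
    (hω : IsFieldDispersion s ω) {P₀ : E ν} {l₀ : ℝ}
    (hpp : l₀ ∉ pointSpectrum (hamiltonian Ω ω ρ P₀)) {P : ℕ → E ν}
    (hP : Tendsto P atTop (𝓝 P₀)) (u : ∀ n, (hamiltonian Ω ω ρ (P n)).domain)
    (hu : ∀ n, ‖(u n : FiberSpace ν)‖ = 1)
    (hH : Tendsto (fun n => hamiltonian Ω ω ρ (P n) (u n) - (l₀ : ℂ) • (u n : FiberSpace ν)) atTop
      (𝓝 0)) (𝒰 : Ultrafilter ℕ) (h𝒰 : (𝒰 : Filter ℕ) ≤ atTop) :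
    Tendsto (fun n => (u n : FiberSpace ν).fst) 𝒰 (𝓝 0) ∧
      WeakTendsto (fun n => (u n : FiberSpace ν).snd) 𝒰 0 := by
  have f1 : ∀ n, ‖(u n : FiberSpace ν).fst‖ ≤ 1 := fun n =>
    (WithLp.norm_fst_le _ (u n : FiberSpace ν)).trans_eq (hu n)
  have f2 : ∀ n, ‖(u n : FiberSpace ν).snd‖ ≤ 1 := fun n =>
    (WithLp.norm_snd_le _ (u n : FiberSpace ν)).trans_eq (hu n)
  obtain ⟨x, hx'⟩ := exists_weakTendsto f1 𝒰
  obtain ⟨y, hy⟩ := exists_weakTendsto f2 𝒰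
  -- In `ℂ` weak convergence is convergence: test against `1`.
  have hx : Tendsto (fun n => (u n : FiberSpace ν).fst) 𝒰 (𝓝 x) := by simpa using hx' 1
  set G := fun n => hamiltonian Ω ω ρ (P n) (u n) - (l₀ : ℂ) • (u n : FiberSpace ν) with hG
  have hG0 := hH.mono_left h𝒰
  have hG1 : Tendsto (fun n => (G n).fst) 𝒰 (𝓝 0) := squeeze_zero_norm
    (fun n => WithLp.norm_fst_le _ (G n)) (tendsto_zero_iff_norm_tendsto_zero.1 hG0)
  have hG2 : Tendsto (fun n => (G n).snd) 𝒰 (𝓝 0) := squeeze_zero_norm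
    (fun n => WithLp.norm_snd_le _ (G n)) (tendsto_zero_iff_norm_tendsto_zero.1 hG0)
  have e1 : ⟪ρ, y⟫_ℂ + Ω P₀ * x = l₀ * x := by
    have h1 : Tendsto (fun n => ⟪ρ, (u n : FiberSpace ν).snd⟫_ℂ +
        (Ω (P n) : ℂ) * (u n : FiberSpace ν).fst - l₀ * (u n : FiberSpace ν).fst) 𝒰
        (𝓝 (⟪ρ, y⟫_ℂ + Ω P₀ * x - l₀ * x)) := by
      have hΩc : Continuous Ω := (hΩ.contDiff (n := 0)).continuous
      have h2 : Tendsto (fun n => (Ω (P n) : ℂ)) 𝒰 (𝓝 (Ω P₀ : ℂ)) :=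
        ((Complex.continuous_ofReal.comp hΩc).tendsto P₀).comp (hP.mono_left h𝒰)
      exact ((hy ρ).add (h2.mul hx)).sub (hx.const_mul _)
    exact sub_eq_zero.1 (tendsto_nhds_unique h1 hG1)
  -- The real point `l₀` may lie in the spectrum of the free energy, so the equation is rewritten at
  -- `i` and the difference moved to the right-hand side, which still converges weakly.
  have e2 : ∀ n, fourierMultiplier (energy Ω ω (P n)) (sndDomain Ω ω ρ (P n) (u n)) -
      Complex.I • (sndDomain Ω ω ρ (P n) (u n) : L2 ν) =
      (G n).snd + (((l₀ : ℂ) - Complex.I) • (u n : FiberSpace ν).snd +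
        (-(u n : FiberSpace ν).fst) • ρ) := by
    intro n
    have : (G n).snd = (u n : FiberSpace ν).fst • ρ +
        fourierMultiplier (energy Ω ω (P n)) (sndDomain Ω ω ρ (P n) (u n)) -
          (l₀ : ℂ) • (u n : FiberSpace ν).snd := rfl
    rw [this, coe_sndDomain]
    module
  obtain ⟨M, hM⟩ : ∃ M, ∀ n, ‖(G n).snd‖ ≤ M := by
    have : Tendsto (fun n => (G n).snd) atTop (𝓝 0) := squeeze_zero_norm
      (fun n => WithLp.norm_snd_le _ (G n)) (tendsto_zero_iff_norm_tendsto_zero.1 hH)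
    obtain ⟨M, hM⟩ := (Metric.isBounded_range_of_tendsto _ this).exists_norm_le
    exact ⟨M, fun n => hM _ ⟨n, rfl⟩⟩
  have hw : WeakTendsto (fun n => (G n).snd + (((l₀ : ℂ) - Complex.I) • (u n : FiberSpace ν).snd +
      (-(u n : FiberSpace ν).fst) • ρ)) 𝒰 (0 + (((l₀ : ℂ) - Complex.I) • y + (-x) • ρ)) :=
    (weakTendsto_of_tendsto hG2).add ((hy.smul tendsto_const_nhds).add
      (weakTendsto_of_tendsto (hx.neg.smul_const ρ)))
  obtain ⟨hyd, hyE⟩ := weakTendsto_fourierMultiplier (g := fun n => energy Ω ω (P n))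
    (g₀ := energy Ω ω P₀) (fun n => continuous_energy hΩ hω (P n)) (continuous_energy hΩ hω P₀)
    (fun k => ((continuous_energy_uncurry hΩ hω).tendsto (P₀, k)).comp
      (hP.prodMk_nhds tendsto_const_nhds)) h𝒰 (fun n => sndDomain Ω ω ρ (P n) (u n))
    (z := Complex.I) (by simp) (M := M + (‖(l₀ : ℂ) - Complex.I‖ + ‖ρ‖)) (fun n => by
      rw [e2]
      refine (norm_add_le _ _).trans (add_le_add (hM n) ((norm_add_le _ _).trans (add_le_add ?_ ?_)))
      · rw [norm_smul]
        exact mul_le_of_le_one_right (norm_nonneg _) (f2 n)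
      · rw [norm_smul, norm_neg]
        exact mul_le_of_le_one_left (norm_nonneg _) (f1 n)) hy
    (by simp only [e2]; exact hw)
  -- The weak limit `(x, y)` solves the eigenvalue equation of `H(P₀)` at `l₀`, so it must vanish.
  by_cases hw0 : (WithLp.toLp 2 (x, y) : FiberSpace ν) = 0
  · have hx0 : x = 0 := congrArg WithLp.fst hw0
    have hy0 : y = 0 := congrArg WithLp.snd hw0
    exact ⟨hx0 ▸ hx, hy0 ▸ hy⟩
  · refine absurd ⟨⟨WithLp.toLp 2 (x, y), hyd⟩, hw0, ?_⟩ hpp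
    refine congrArg (WithLp.toLp 2) (Prod.ext e1 ?_)
    change x • ρ + fourierMultiplier (energy Ω ω P₀) ⟨y, hyd⟩ = (l₀ : ℂ) • y
    rw [eq_add_of_sub_eq hyE]
    module

/-- Along a sequence of counterexamples the weak limit is zero, so the first component vanishes in
the limit and all mass sits in the second. The bound then tends to `c > 0`, against its being below
`1/(n+1)`. -/
theorem exists_positivity (hΩ : IsMatterDispersion s Ω)
    (hω : IsFieldDispersion s ω) {P₀ : E ν} {l₀ : ℝ}
    (hpp : l₀ ∉ pointSpectrum (hamiltonian Ω ω ρ P₀)) (η : L2 ν) {c : ℝ} (hc : 0 < c) (K : ℝ) :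
    ∃ ε, 0 < ε ∧ ∀ P, ‖P - P₀‖ ≤ ε → ∀ u : (hamiltonian Ω ω ρ P).domain,
      ‖(u : FiberSpace ν)‖ = 1 →
      ‖hamiltonian Ω ω ρ P u - (l₀ : ℂ) • (u : FiberSpace ν)‖ ≤ ε →
      ε ≤ c * ‖(u : FiberSpace ν).snd‖ ^ 2 -
            K * ‖fourierMultiplier (energy Ω ω P) (sndDomain Ω ω ρ P u) -
              (l₀ : ℂ) • (u : FiberSpace ν).snd‖ ^ 2 +
            2 * (conj (u : FiberSpace ν).fst * ⟪η, (u : FiberSpace ν).snd⟫_ℂ).re := by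
  by_contra! hneg
  have hpos : ∀ n : ℕ, 0 < 1 / ((n : ℝ) + 1) := fun n => Nat.one_div_pos_of_nat
  choose P hP u hu hH hlt using fun n : ℕ => hneg (1 / ((n : ℝ) + 1)) (hpos n)
  have hn := tendsto_one_div_add_atTop_nhds_zero_nat (𝕜 := ℝ)
  have hP' : Tendsto P atTop (𝓝 P₀) := tendsto_iff_norm_sub_tendsto_zero.2
    (squeeze_zero (fun _ => norm_nonneg _) hP hn)
  have hH' := squeeze_zero_norm hH hn
  have h𝒰 : (hyperfilter ℕ : Filter ℕ) ≤ atTop := Nat.hyperfilter_le_atTop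
  obtain ⟨hx, hy⟩ := weakTendsto_zero_of_approximate_eigenvector hΩ hω hpp hP' u hu hH'
    (hyperfilter ℕ) h𝒰
  have t1 : Tendsto (fun n => c * ‖(u n : FiberSpace ν).snd‖ ^ 2) (hyperfilter ℕ)
      (𝓝 (c * (1 - ‖(0 : ℂ)‖ ^ 2))) := by
    refine (((hx.norm.pow 2).const_sub 1).const_mul c).congr fun n => ?_
    have := norm_fiber_sq (u n : FiberSpace ν)
    rw [hu n] at this
    rw [show ‖(u n : FiberSpace ν).snd‖ ^ 2 = 1 - ‖(u n : FiberSpace ν).fst‖ ^ 2 by linarith]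
  -- Here `(E - l₀)u₁` equals the second component of `(H - l₀)u` minus `u₀ρ`, and both terms tend
  -- to zero in norm.
  have t2 : Tendsto (fun n => K * ‖fourierMultiplier (energy Ω ω (P n))
      (sndDomain Ω ω ρ (P n) (u n)) - (l₀ : ℂ) • (u n : FiberSpace ν).snd‖ ^ 2) (hyperfilter ℕ)
      (𝓝 (K * ‖(0 : L2 ν) - (0 : ℂ) • ρ‖ ^ 2)) := by
    have hG2 : Tendsto (fun n => (hamiltonian Ω ω ρ (P n) (u n) -
        (l₀ : ℂ) • (u n : FiberSpace ν)).snd) (hyperfilter ℕ) (𝓝 0) := squeeze_zero_norm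
      (fun n => WithLp.norm_snd_le _ _) (tendsto_zero_iff_norm_tendsto_zero.1 (hH'.mono_left h𝒰))
    refine (((hG2.sub (hx.smul_const ρ)).norm.pow 2).const_mul K).congr fun n => ?_
    congr 3
    change (u n : FiberSpace ν).fst • ρ +
        fourierMultiplier (energy Ω ω (P n)) (sndDomain Ω ω ρ (P n) (u n)) -
          (l₀ : ℂ) • (u n : FiberSpace ν).snd - (u n : FiberSpace ν).fst • ρ = _
    abel
  have t3 : Tendsto (fun n => 2 * (conj (u n : FiberSpace ν).fst *
      ⟪η, (u n : FiberSpace ν).snd⟫_ℂ).re) (hyperfilter ℕ)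
      (𝓝 (2 * (conj (0 : ℂ) * ⟪η, (0 : L2 ν)⟫_ℂ).re)) :=
    ((Complex.continuous_re.tendsto _).comp
      (((Complex.continuous_conj.tendsto _).comp hx).mul (hy η))).const_mul 2
  have := le_of_tendsto_of_tendsto' ((t1.sub t2).add t3) (hn.mono_left h𝒰) fun n => (hlt n).le
  simp at this
  linarith

/-- The Mourre estimate near a spectral value that is neither a threshold nor an eigenvalue. -/
theorem exists_mourre_estimate (hΩ : IsMatterDispersion s Ω) (hω : IsFieldDispersion s ω)
    (hρ : IsCoupling ρ) {P₀ : E ν} {l₀ : ℝ} (hθ : l₀ ∉ thresholds Ω ω P₀)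
    (hpp : l₀ ∉ pointSpectrum (hamiltonian Ω ω ρ P₀)) :
    ∃ ε, 0 < ε ∧ ∀ P, ‖P - P₀‖ ≤ ε →
      ∃ B : (hamiltonian Ω ω ρ P).domain →ₗ⋆[ℂ] (hamiltonian Ω ω ρ P).domain →ₗ[ℂ] ℂ,
        (IsCommutatorExtension (hamiltonian Ω ω ρ P) (conjugateOperator Ω ω P₀) B ∧
          ∀ B', IsCommutatorExtension (hamiltonian Ω ω ρ P) (conjugateOperator Ω ω P₀) B' →
            B' = B) ∧
        ∀ u : (hamiltonian Ω ω ρ P).domain,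
          ‖hamiltonian Ω ω ρ P u - (l₀ : ℂ) • (u : FiberSpace ν)‖ ≤ ε * ‖(u : FiberSpace ν)‖ →
          ε * ‖(u : FiberSpace ν)‖ ^ 2 ≤ (B u u).re := by
  obtain ⟨η, c, K, hc, hB⟩ := exists_commutatorExtension hΩ hω hρ hθ
  obtain ⟨ε, hε, hpos⟩ := exists_positivity hΩ hω hpp η hc K
  -- `c` limits the fibers for which the form exists, `ε` those for which it is positive.
  -- Normalizing `u` and using homogeneity of the form removes the condition `‖u‖ = 1`.
  refine ⟨min ε c, lt_min hε hc, fun P hP => ?_⟩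
  obtain ⟨B, hB1, hB2⟩ := hB P (hP.trans (min_le_right _ _))
  refine ⟨B, hB1, fun u hu => ?_⟩
  rcases eq_or_ne u 0 with rfl | hu0
  · simp
  have hn : 0 < ‖(u : FiberSpace ν)‖ := norm_pos_iff.2 fun h => hu0 (Subtype.ext h)
  set a : ℂ := ((‖(u : FiberSpace ν)‖⁻¹ : ℝ) : ℂ) with ha
  have han : ‖a‖ = ‖(u : FiberSpace ν)‖⁻¹ := by
    rw [ha, Complex.norm_real, norm_inv, norm_norm]
  have h1 : ‖((a • u : (hamiltonian Ω ω ρ P).domain) : FiberSpace ν)‖ = 1 := by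
    rw [Submodule.coe_smul, norm_smul, han, inv_mul_cancel₀ hn.ne']
  have h2 : ‖hamiltonian Ω ω ρ P (a • u) -
      (l₀ : ℂ) • ((a • u : (hamiltonian Ω ω ρ P).domain) : FiberSpace ν)‖ ≤ ε := by
    rw [LinearPMap.map_smul, Submodule.coe_smul, smul_comm, ← smul_sub, norm_smul, han,
      inv_mul_le_iff₀ hn, mul_comm]
    exact hu.trans (mul_le_mul_of_nonneg_right (min_le_left _ _) hn.le)
  have h3 := (hpos P (hP.trans (min_le_left _ _)) (a • u) h1 h2).trans (hB2 (a • u))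
  rw [map_smul (B (a • u)), map_smulₛₗ B, LinearMap.smul_apply, smul_smul, ha, Complex.conj_ofReal,
    ← Complex.ofReal_mul, smul_eq_mul, Complex.re_ofReal_mul] at h3
  have h4 : ‖(u : FiberSpace ν)‖⁻¹ * ‖(u : FiberSpace ν)‖⁻¹ * (B u u).re =
      (B u u).re / ‖(u : FiberSpace ν)‖ ^ 2 := by
    field_simp
  rw [h4, le_div_iff₀ (by positivity)] at h3
  exact (mul_le_mul_of_nonneg_right (min_le_left _ _) (sq_nonneg _)).trans h3

end Nelson

end

/-! ### The theorem, by localization in energy -/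

theorem mainTheorem6 {ν : ℕ} (s : ℝ) (Ω ω : Nelson.E ν → ℝ) (ρ : Nelson.L2 ν)
    (hΩ : Nelson.IsMatterDispersion s Ω) (hω : Nelson.IsFieldDispersion s ω)
    (hρ : Nelson.IsCoupling ρ) (P₀ : Nelson.E ν) (l₀ : ℝ)
    (hθ : l₀ ∉ Nelson.thresholds Ω ω P₀)
    (hpp : l₀ ∉ Nelson.pointSpectrum (Nelson.hamiltonian Ω ω ρ P₀)) :
    ∃ C : ℝ, 0 < C ∧ ∃ O ∈ 𝓝 P₀, ∃ f : ℝ → ℝ,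
      ContDiff ℝ (⊤ : ℕ∞) f ∧ HasCompactSupport f ∧ (∀ᶠ x in 𝓝 l₀, f x = 1) ∧
      ∀ P ∈ O,
        ∃ B : (Nelson.hamiltonian Ω ω ρ P).domain →ₗ⋆[ℂ]
            (Nelson.hamiltonian Ω ω ρ P).domain →ₗ[ℂ] ℂ,
          (Nelson.IsCommutatorExtension (Nelson.hamiltonian Ω ω ρ P)
              (Nelson.conjugateOperator Ω ω P₀) B ∧
            ∀ B', Nelson.IsCommutatorExtension (Nelson.hamiltonian Ω ω ρ P)
              (Nelson.conjugateOperator Ω ω P₀) B' → B' = B) ∧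
          ∀ u : Nelson.FiberSpace ν,
            ∃ hu : Nelson.functionalCalculus (Nelson.hamiltonian Ω ω ρ P) f u ∈
                (Nelson.hamiltonian Ω ω ρ P).domain,
              C * (⟪u, Nelson.functionalCalculus (Nelson.hamiltonian Ω ω ρ P)
                  (fun x => f x ^ 2) u⟫_ℂ).re ≤
                (B ⟨Nelson.functionalCalculus (Nelson.hamiltonian Ω ω ρ P) f u, hu⟩
                  ⟨Nelson.functionalCalculus (Nelson.hamiltonian Ω ω ρ P) f u, hu⟩).re := by
  obtain ⟨ε, hε, h⟩ := Nelson.exists_mourre_estimate hΩ hω hρ hθ hpp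
  -- The outer radius `ε` is the tolerance of `exists_mourre_estimate`, so each `f(H(P))u` satisfies
  -- its hypothesis; the same `ε` is then the constant of the estimate.
  let f : ContDiffBump l₀ := ⟨ε / 2, ε, by linarith, by linarith⟩
  refine ⟨ε, hε, Metric.closedBall P₀ ε, Metric.closedBall_mem_nhds _ hε, f, f.contDiff,
    f.hasCompactSupport, f.eventuallyEq_one, fun P hP => ?_⟩
  obtain ⟨B, hB, hpos⟩ := h P (by rwa [mem_closedBall_iff_norm] at hP)
  refine ⟨B, hB, fun u => ?_⟩
  have hE := Nelson.continuous_energy hΩ hω P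
  obtain ⟨R, hR⟩ := Nelson.exists_isResolventAt_hamiltonian (ρ := ρ) hE (z := Complex.I) (by simp)
  obtain ⟨R', hR'⟩ := Nelson.exists_isResolventAt_hamiltonian (ρ := ρ) hE (z := -Complex.I)
    (by simp)
  have hfs : ∀ x, f x ≠ 0 → |x - l₀| ≤ ε := fun x hx => by
    have : x ∈ Function.support f := hx
    rw [f.support_eq, Metric.mem_ball, Real.dist_eq] at this
    exact this.le
  obtain ⟨hu, hle⟩ := Nelson.norm_sub_smul_functionalCalculus_le Nelson.isSymm_hamiltonian hR hR'
    f.continuous f.hasCompactSupport hfs u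
  refine ⟨hu, ?_⟩
  rw [Nelson.inner_functionalCalculus_sq Nelson.isSymm_hamiltonian hR hR' f.continuous
    f.hasCompactSupport]
  exact hpos ⟨_, hu⟩ hle
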